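/- Let $d\ge 3$ and let $f_0,f_1,f_2\in\mathbb{C}[s,t]$ be homogeneous polynomials of degree $d$ without a common zero in $\mathbb{P}^1$. Let $\phi:\mathbb{P}^1\to\mathbb{P}^2$, $(s:t)\mapsto(f_0:f_1:f_2)$, and let $C=\phi(\mathbb{P}^1)$; assume that $\phi$ is generically one-to-one onto $C$, i.e. all but finitely many points of $C$ have exactly one preimage. Write $f_j=\sum_{i=0}^d a_{j,i}s^{d-i}t^i$, let $P_2=u_0s^2+u_1st+u_2t^2$ be the generic binary quadric, and let $M_2$ be the $(d+1)\times(d+2)$ matrix over $\mathbb{A}=\mathbb{C}[u_0,u_1,u_2]$ whose columns are the coefficient vectors, in the basis $s^d,s^{d-1}t,\dots,t^d$, of $s^{d-2-j}t^jP_2$ ($0\le j\le d-2$) and of $f_0,f_1,f_2$. Let $X_2\subset\mathbb{P}^2=\mathrm{Proj}(\mathbb{A})$ be the closed subscheme defined by the ideal generated by the maximal minors, i.e. the $(d+1)$-minors, of $M_2$. Let $\delta(C)=\sum_{P\in C}\dim_{\mathbb{C}}\bigl(\widetilde{\mathcal{O}}_{C,P}/\mathcal{O}_{C,P}\bigr)$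 be the total delta invariant of $C$, where $\widetilde{\mathcal{O}}_{C,P}$ is the normalization of the local ring $\mathcal{O}_{C,P}$ of $C$ at $P$. Then $X_2$ is a non-empty scheme of dimension $0$, of degree $$\deg X_2=\delta(C)=\frac{(d-1)(d-2)}{2}.$$ Moreover, $C$ is cuspidal (i.e. $C$ is unibranch at each of its singular points) if and only if the support of $X_2$ is contained in the conic $V(u_1^2-4u_0u_2)\subset\mathbb{P}^2$. -/

import Mathlib

open MvPolynomial Filter
open scoped LinearAlgebra.Projectivization

noncomputable section

namespace RationalCurve

/-! ### Parametrizations of rational plane curves -/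

/-- A regular map `ℙ¹ → ℙ²`, `(s : t) ↦ (f₀ : f₁ : f₂)`, given by three binary forms of the same
degree `d` without a common zero in `ℙ¹`.  The variables `s, t` are `X 0, X 1`. -/
structure Param (d : ℕ) where
  /-- the forms `f₀, f₁, f₂` -/
  f : Fin 3 → MvPolynomial (Fin 2) ℂ
  homogeneous : ∀ j, (f j).IsHomogeneous d
  no_common_zero : ∀ v : Fin 2 → ℂ, v ≠ 0 → (fun j => eval v (f j)) ≠ 0

variable {d : ℕ}

/-- The map `ℙ¹ → ℙ²` itself. -/
def Param.map (φ : Param d) (Q : ℙ ℂ (Fin 2 → ℂ)) : ℙ ℂ (Fin 3 → ℂ) :=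
  Projectivization.mk ℂ (fun j => eval Q.rep (φ.f j)) (φ.no_common_zero _ Q.rep_nonzero)

/-- The map does not depend on the homogeneous coordinates chosen for the point. -/
theorem Param.map_mk (φ : Param d) (v : Fin 2 → ℂ) (hv : v ≠ 0) :
    φ.map (Projectivization.mk ℂ v hv)
      = Projectivization.mk ℂ (fun j => eval v (φ.f j)) (φ.no_common_zero v hv) := by
  obtain ⟨a, ha⟩ := Projectivization.exists_smul_eq_mk_rep ℂ v hv
  unfold Param.map
  rw [Projectivization.mk_eq_mk_iff']
  refine ⟨(a : ℂ) ^ d, ?_⟩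
  funext j
  rw [← ha]
  have key : eval ((a : ℂ) • v) (φ.f j) = (a : ℂ) ^ d * eval v (φ.f j) := by
    rw [eval_eq, eval_eq, Finset.mul_sum]
    refine Finset.sum_congr rfl fun m hm => ?_
    have hdeg : ∑ i, m i = d := by
      have := φ.homogeneous j (mem_support_iff.mp hm)
      rw [Finsupp.weight_apply, Finsupp.sum_fintype _ _ (by simp)] at this
      simpa using this
    simp only [Pi.smul_apply, smul_eq_mul, mul_pow, Finset.prod_mul_distrib,
      Finset.prod_pow_eq_pow_sum]
    rw [Finset.sum_subset (Finset.subset_univ m.support) (by simp), hdeg]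
    ring
  exact key.symm

/-- The set of points of the curve `C = φ(ℙ¹) ⊆ ℙ²`. -/
def Param.curve (φ : Param d) : Set (ℙ ℂ (Fin 3 → ℂ)) := Set.range φ.map

/-- `φ` is generically `1`-to-`1` on `C`: all but finitely many points of `C` have exactly one
preimage. -/
def Param.IsGenericallyInjective (φ : Param d) : Prop :=
  {P ∈ φ.curve | ¬ ∃! Q, φ.map Q = P}.Finite

/-! ### Local rings, branches, the delta invariant -/

/-- The local ring `𝒪_{C,P}`, for a point `P` of `C`.  The homogeneous coordinate ring
`ℂ[x,y,z] / I(C)` is identified with its image `ℂ[f₀,f₁,f₂]` under `x, y, z ↦ f₀, f₁, f₂`;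
so `𝒪_{C,P}` consists of the quotients `g(f₀,f₁,f₂) / h(f₀,f₁,f₂)` with `g, h` forms of the same
degree and `h(P) ≠ 0`, inside `ℂ(s,t)`. -/
def Param.localRing (φ : Param d) (P : ℙ ℂ (Fin 3 → ℂ)) :
    Subalgebra ℂ (FractionRing (MvPolynomial (Fin 2) ℂ)) where
  carrier := {x | ∃ (n : ℕ) (g h : MvPolynomial (Fin 3) ℂ),
    g.IsHomogeneous n ∧ h.IsHomogeneous n ∧ eval P.rep h ≠ 0 ∧
      x * algebraMap _ _ (aeval φ.f h) = algebraMap _ _ (aeval φ.f g)}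
  mul_mem' := by
    rintro x y ⟨n, g, h, hg, hh, h0, hx⟩ ⟨m, g', h', hg', hh', h0', hy⟩
    refine ⟨n + m, g * g', h * h', hg.mul hg', hh.mul hh', by simp [h0, h0'], ?_⟩
    simp only [map_mul]
    rw [← hx, ← hy]
    ring
  add_mem' := by
    rintro x y ⟨n, g, h, hg, hh, h0, hx⟩ ⟨m, g', h', hg', hh', h0', hy⟩
    refine ⟨n + m, g * h' + h * g', h * h', (hg.mul hh').add (hh.mul hg'), hh.mul hh',
      by simp [h0, h0'], ?_⟩
    simp only [map_mul, map_add]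
    rw [← hx, ← hy]
    ring
  algebraMap_mem' c := by
    refine ⟨0, C c, 1, isHomogeneous_C _ _, isHomogeneous_one _ _, by simp, ?_⟩
    simp only [map_one, mul_one, aeval_C]
    exact IsScalarTower.algebraMap_apply ℂ (MvPolynomial (Fin 2) ℂ) _ c

/-- The normalization of a domain `O`: its integral closure in its fraction field. -/
abbrev Normalization (O : Type*) [CommRing O] : Type _ := integralClosure O (FractionRing O)

/-- The delta invariant of a local domain `O` over `ℂ`: the dimension over `ℂ` of the quotient of
the normalization of `O` by `O`. -/
def deltaInvariant (O : Type*) [CommRing O] [Algebra ℂ O] : ℕ :=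
  Module.finrank ℂ (Normalization O ⧸
    LinearMap.range ((Algebra.linearMap O (Normalization O)).restrictScalars ℂ))

/-- `P` is a singular point of the curve: the (one-dimensional) local ring at `P` is not regular,
that is, not a discrete valuation ring. -/
def Param.IsSingularPoint (φ : Param d) (P : ℙ ℂ (Fin 3 → ℂ)) : Prop :=
  P ∈ φ.curve ∧ ¬ IsDiscreteValuationRing (φ.localRing P)

/-- The curve is unibranch at `P`: the normalization of the local domain `𝒪_{C,P}` is local. -/
def Param.IsUnibranchAt (φ : Param d) (P : ℙ ℂ (Fin 3 → ℂ)) : Prop :=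
  IsLocalRing (Normalization (φ.localRing P))

/-- The curve is cuspidal: all its singular points are unibranch. -/
def Param.IsCuspidal (φ : Param d) : Prop :=
  ∀ P, φ.IsSingularPoint P → φ.IsUnibranchAt P

/-- The delta invariant `δ_P` of the curve at `P`. -/
def Param.deltaAt (φ : Param d) (P : ℙ ℂ (Fin 3 → ℂ)) : ℕ := deltaInvariant (φ.localRing P)

/-- The total delta invariant `δ(C) = ∑_{P ∈ C} δ_P`. -/
def Param.delta (φ : Param d) : ℕ := ∑ᶠ P ∈ φ.curve, φ.deltaAt P

/-! ### The matrices `M_k` and the schemes `X_k` -/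

/-- The matrix `M_k`, over `ℂ[u₀,…,u_k]`, of the map
`(g, c₀, c₁, c₂) ↦ P_k g + c₀ f₀ + c₁ f₁ + c₂ f₂` in degree `d`, where
`P_k = ∑ u_i s^(k-i) t^i` is the generic binary form of degree `k`.  Row `i` belongs to
`s^(d-i) t^i`; the first `d-k+1` columns are the shifted coefficient vectors of `P_k`, the last three
the coefficient vectors of `f₀, f₁, f₂`. -/
def Param.M (φ : Param d) (k : ℕ) :
    Matrix (Fin (d + 1)) (Fin (d - k + 1) ⊕ Fin 3) (MvPolynomial (Fin (k + 1)) ℂ) :=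
  fun i c => match c with
    | .inl j =>
        if h : (j : ℕ) ≤ i ∧ (i : ℕ) - j < k + 1 then X ⟨(i : ℕ) - j, h.2⟩ else 0
    | .inr j => C (coeff (Finsupp.single 0 (d - (i : ℕ)) + Finsupp.single 1 (i : ℕ)) (φ.f j))

/-- The ideal generated by the minors of size `r` of a matrix. -/
def minorsIdeal {m n A : Type*} [CommRing A] (r : ℕ) (M : Matrix m n A) : Ideal A :=
  Ideal.span {x | ∃ (a : Fin r → m) (b : Fin r → n), x = (M.submatrix a b).det}

/-- The homogeneous ideal in `ℂ[u₀,…,u_k]` generated by the `(d-k+3)`-minors of `M_k`; it defines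
the closed subscheme `X_k` of `ℙ^k = Proj ℂ[u₀,…,u_k]`.  For `k = 2` these are the maximal minors. -/
def Param.idealX (φ : Param d) (k : ℕ) : Ideal (MvPolynomial (Fin (k + 1)) ℂ) :=
  minorsIdeal (d - k + 3) (φ.M k)

attribute [local instance] MvPolynomial.gradedAlgebra

theorem Param.idealX_isHomogeneous (φ : Param d) (k : ℕ) :
    (φ.idealX k).IsHomogeneous (homogeneousSubmodule (Fin (k + 1)) ℂ) := by
  refine Ideal.homogeneous_span _ _ ?_
  rintro _ ⟨a, b, rfl⟩
  refine ⟨∑ i, (b i).elim (fun _ => 1) (fun _ => 0), ?_⟩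
  rw [Matrix.det_apply]
  refine Submodule.sum_mem _ fun σ _ => ?_
  rw [Units.smul_def]
  refine zsmul_mem ?_ _
  refine IsHomogeneous.prod _ _ _ fun i _ => ?_
  rw [Matrix.submatrix_apply]
  unfold Param.M
  cases b i with
  | inl j =>
    dsimp only [Sum.elim_inl]
    split_ifs
    · exact isHomogeneous_X _ _
    · exact isHomogeneous_zero _ _ _
  | inr j => exact isHomogeneous_C _ _

/-- The underlying set (support) of the closed subscheme of `ℙ^k = Proj ℂ[u₀,…,u_k]` defined by a
homogeneous ideal. -/
def projSupport {k : ℕ} (I : Ideal (MvPolynomial (Fin (k + 1)) ℂ)) :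
    Set (ProjectiveSpectrum (homogeneousSubmodule (Fin (k + 1)) ℂ)) :=
  ProjectiveSpectrum.zeroLocus (homogeneousSubmodule (Fin (k + 1)) ℂ) (I : Set _)

/-- The Hilbert function `n ↦ dim_ℂ (A/I)_n` of the quotient of `A = ℂ[u₀,…,u_k]` by a homogeneous
ideal `I`. -/
def hilbertFunction {k : ℕ} (I : Ideal (MvPolynomial (Fin (k + 1)) ℂ)) (n : ℕ) : ℕ :=
  Module.finrank ℂ
    ((homogeneousSubmodule (Fin (k + 1)) ℂ n).map (Ideal.Quotient.mkₐ ℂ I).toLinearMap)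

/-- The closed subscheme of `ℙ^k` defined by the homogeneous ideal `I` is non-empty, of dimension
`r` and degree `e`: its Hilbert polynomial is nonzero, of degree `r` and with leading coefficient
`e / r!`. -/
def HasDimensionAndDegree {k : ℕ} (I : Ideal (MvPolynomial (Fin (k + 1)) ℂ)) (r e : ℕ) : Prop :=
  ∃ H : Polynomial ℚ, (∀ᶠ n : ℕ in atTop, (hilbertFunction I n : ℚ) = H.eval (n : ℚ)) ∧
    H ≠ 0 ∧ H.natDegree = r ∧ (r.factorial : ℚ) * H.leadingCoeff = e

end RationalCurve

end

/-!
Write `S n` for the binary forms of degree `d n`, and `R n ⊆ S n` for those that are forms of degree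
`n` in `f₀, f₁, f₂`, so that `⨁ R n` is the homogeneous coordinate ring of the curve.  The theorem
combines three facts.

*The delta invariant.*  All but finitely many points `v` of the line are good: the pencil of lines
through `φ(v)` cuts out on the line, once the common zero `v` is removed, divisors without a common
point (`Param.finite_not_isGood`).  A good point gives a form `H`, not identically zero on the curve, with
`H S n ⊆ R (m + n)` (`Param.IsGood.exists_conductor`).  So the codimension of `R n` in `S n` is
bounded, the curve has a prime equation of degree `d`, and the codimension is `(d - 1)(d - 2)/2` for
large `n` (`Param.finrank_R`).  The normalization of the local ring at a point `P` of the curve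
consists of the quotients `a / h(f₀, f₁, f₂)` with `a ∈ S n` and `h` a form of degree `n` not
vanishing at `P` (`Param.exists_normEmb_eq_iff_mem_normRing`).  Choose a linear form `z` that
vanishes at none of the zeros of `H` on the curve.  The map sending `a ∈ S n` to the classes of
`a / zⁿ` modulo the local rings at these zeros has kernel `R n` for large `n`
(`Param.IsConductor.exists_ker_classMap`) and is onto for large `n`
(`Param.IsConductor.exists_approximation`); comparing dimensions, `δ(C) = (d - 1)(d - 2)/2`
(`Param.two_mul_delta`).

*The degree of `X_2`.*  The minors have no common factor: such a factor would vanish at some quadric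
with a given good root `v`, but at all these quadrics the matrix has full rank
(`Param.exists_not_dvd_det`). Hence the Hilbert–Burch complex of the matrix resolves the ideal of
maximal minors, which gives its Hilbert function (`hilbertFunction_span_signedMinor`).

*The support.*  The normalization of the local ring at `P` is local if and only if `P` has only one
preimage, so that the curve is cuspidal if and only if `φ` is injective (`Param.isCuspidal_iff`).
The matrix has full rank at the quadric with distinct roots `v, w` if and only if `φ(v) ≠ φ(w)`: a
linear form that separates these points yields enough forms of degree `d`, and if the points agree,
evaluation at `v` and `w` gives a relation between the rows (`Param.injective_iff`).  By the
Nullstellensatz this is a statement about supports (`projSupport_subset_iff`).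
-/

noncomputable section

namespace RationalCurve

/-! ### Homogeneous polynomials -/

section Homogeneous

variable {σ : Type*} {m n : ℕ}

theorem aeval_mul_of_isHomogeneous {A : Type*} [CommRing A] [Algebra ℂ A]
    {p : MvPolynomial σ ℂ} (hp : p.IsHomogeneous n) (c : A) (y : σ → A) :
    aeval (fun i => c * y i) p = c ^ n * aeval y p := by
  rw [aeval_def, aeval_def, eval₂_eq, eval₂_eq, Finset.mul_sum]
  refine Finset.sum_congr rfl fun k hk => ?_
  have hdeg : n = ∑ i ∈ k.support, k i := hp.degree_eq_sum_deg_support hk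
  simp only [mul_pow, Finset.prod_mul_distrib, Finset.prod_pow_eq_pow_sum]
  rw [← hdeg]
  ring

theorem eval_smul_of_isHomogeneous {p : MvPolynomial σ ℂ} (hp : p.IsHomogeneous n) (c : ℂ)
    (y : σ → ℂ) : eval (c • y) p = c ^ n * eval y p := by
  have := aeval_mul_of_isHomogeneous hp c y
  rwa [aeval_eq_eval, aeval_eq_eval] at this

theorem homogeneousComponent_mul_of_isHomogeneous {a : MvPolynomial σ ℂ}
    (ha : a.IsHomogeneous m) (b : MvPolynomial σ ℂ) (k : ℕ) :
    homogeneousComponent (m + k) (a * b) = a * homogeneousComponent k b := by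
  let := MvPolynomial.gradedAlgebra (σ := σ) (R := ℂ)
  have h := DirectSum.coe_decompose_mul_add_of_left_mem (homogeneousSubmodule σ ℂ)
    (i := m) (j := k) (a := a) (b := b) ha
  have key : ∀ (p : MvPolynomial σ ℂ) (i : ℕ),
      (DirectSum.decompose (homogeneousSubmodule σ ℂ) p i : MvPolynomial σ ℂ)
        = homogeneousComponent i p := fun p i => decomposition.decompose'_apply p i
  rwa [key, key] at h

theorem isHomogeneous_of_homogeneousComponent_eq_zero {p : MvPolynomial σ ℂ}
    (h : ∀ k, k ≠ n → homogeneousComponent k p = 0) : p.IsHomogeneous n := by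
  have h2 : p = homogeneousComponent n p := by
    conv_lhs => rw [← sum_homogeneousComponent p]
    by_cases hmem : n ∈ Finset.range (p.totalDegree + 1)
    · rw [Finset.sum_eq_single_of_mem _ hmem]
      exact fun k _ hk => h k hk
    · rw [homogeneousComponent_eq_zero _ _ (by rw [Finset.mem_range] at hmem; omega)]
      exact Finset.sum_eq_zero fun k hk => h k (fun h => hmem (h ▸ hk))
  rw [h2]
  exact homogeneousComponent_isHomogeneous _ _

/-- A cofactor of a homogeneous polynomial in a homogeneous polynomial is homogeneous. -/
theorem isHomogeneous_of_mul_left {a b : MvPolynomial σ ℂ} (ha : a.IsHomogeneous m)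
    (ha0 : a ≠ 0) (hab : (a * b).IsHomogeneous n) : b.IsHomogeneous (n - m) := by
  refine isHomogeneous_of_homogeneousComponent_eq_zero fun k hk => ?_
  have := homogeneousComponent_mul_of_isHomogeneous ha b k
  rw [homogeneousComponent_of_mem hab, if_neg (by omega)] at this
  exact (mul_eq_zero.mp this.symm).resolve_left ha0

/-- The polynomial `p(T x)` in an extra variable `T`; its coefficients are the homogeneous
components of `p`. -/
def scaling (σ : Type*) : MvPolynomial σ ℂ →ₐ[ℂ] Polynomial (MvPolynomial σ ℂ) :=
  aeval fun i => Polynomial.X * Polynomial.C (X i)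

theorem scaling_of_isHomogeneous {p : MvPolynomial σ ℂ} (hp : p.IsHomogeneous n) :
    scaling σ p = Polynomial.monomial n p := by
  have h := aeval_mul_of_isHomogeneous hp (Polynomial.X : Polynomial (MvPolynomial σ ℂ))
    (fun i => Polynomial.C (X i))
  have h2 : aeval (fun i => (Polynomial.C (X i) : Polynomial (MvPolynomial σ ℂ))) p
      = Polynomial.C p := by
    have : (aeval (fun i => (Polynomial.C (X i) : Polynomial (MvPolynomial σ ℂ))))
        = (Polynomial.CAlgHom (R := ℂ) (A := MvPolynomial σ ℂ)) := by
      ext i; simp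
    rw [this]; simp
  unfold scaling
  rw [h, h2, ← Polynomial.C_mul_X_pow_eq_monomial, mul_comm]

theorem coeff_scaling (p : MvPolynomial σ ℂ) (k : ℕ) :
    (scaling σ p).coeff k = homogeneousComponent k p := by
  conv_lhs => rw [← sum_homogeneousComponent p]
  rw [map_sum, Polynomial.finsetSum_coeff]
  simp_rw [scaling_of_isHomogeneous (homogeneousComponent_isHomogeneous _ p),
    Polynomial.coeff_monomial]
  rw [Finset.sum_ite_eq']
  split_ifs with h
  · rfl
  · rw [homogeneousComponent_eq_zero _ _ (by simpa using h)]

theorem scaling_ne_zero {p : MvPolynomial σ ℂ} (hp : p ≠ 0) : scaling σ p ≠ 0 := by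
  intro h
  refine hp ?_
  rw [← sum_homogeneousComponent p]
  refine Finset.sum_eq_zero fun k _ => ?_
  rw [← coeff_scaling, h, Polynomial.coeff_zero]

/-- A factor of a nonzero homogeneous polynomial is homogeneous. -/
theorem exists_isHomogeneous_of_mul {p q : MvPolynomial σ ℂ} (h : (p * q).IsHomogeneous n)
    (h0 : p * q ≠ 0) : ∃ k, p.IsHomogeneous k := by
  have hp0 := scaling_ne_zero (left_ne_zero_of_mul h0)
  have hq0 := scaling_ne_zero (right_ne_zero_of_mul h0)
  have hpq : scaling σ p * scaling σ q = Polynomial.monomial n (p * q) := by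
    rw [← map_mul, scaling_of_isHomogeneous h]
  have d1 := Polynomial.natDegree_mul hp0 hq0
  have d2 := Polynomial.natTrailingDegree_mul hp0 hq0
  rw [hpq, Polynomial.natDegree_monomial_eq _ h0] at d1
  rw [hpq, Polynomial.natTrailingDegree_monomial h0] at d2
  have l1 := Polynomial.natTrailingDegree_le_natDegree (scaling σ p)
  have l2 := Polynomial.natTrailingDegree_le_natDegree (scaling σ q)
  refine ⟨(scaling σ p).natDegree,
    isHomogeneous_of_homogeneousComponent_eq_zero fun k hk => ?_⟩
  rw [← coeff_scaling]
  rcases lt_or_gt_of_ne hk with h1 | h1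
  · exact Polynomial.coeff_eq_zero_of_lt_natTrailingDegree (by omega)
  · exact Polynomial.coeff_eq_zero_of_natDegree_lt h1

instance finiteDimensional_homogeneousSubmodule [Finite σ] (n : ℕ) :
    Module.Finite ℂ (homogeneousSubmodule σ ℂ n) :=
  Module.Finite.iff_fg.mpr (homogeneousSubmodule_fg σ ℂ n)

theorem finrank_homogeneousSubmodule (k n : ℕ) :
    Module.finrank ℂ (homogeneousSubmodule (Fin k) ℂ n) = (k + n - 1).choose n := by
  have e : homogeneousSubmodule (Fin k) ℂ n
      = restrictSupport ℂ {d : Fin k →₀ ℕ | d.degree = n} :=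
    homogeneousSubmodule_eq_finsupp_supported (Fin k) ℂ n
  rw [e, Module.finrank_eq_nat_card_basis (basisRestrictSupport ℂ {d : Fin k →₀ ℕ | d.degree = n})]
  have : {d : Fin k →₀ ℕ | d.degree = n}
      = ((Finset.univ : Finset (Fin k)).finsuppAntidiag n : Set (Fin k →₀ ℕ)) := by
    ext d
    simp [Finset.mem_finsuppAntidiag, Finsupp.degree_eq_sum]
  rw [this, Nat.card_coe_set_eq, Set.ncard_coe_finset, Finset.card_finsuppAntidiag_nat_eq_choose]
  simp

theorem finrank_homogeneousSubmodule_two (n : ℕ) :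
    Module.finrank ℂ (homogeneousSubmodule (Fin 2) ℂ n) = n + 1 := by
  rw [finrank_homogeneousSubmodule, show 2 + n - 1 = n + 1 by omega]
  simp

theorem two_mul_finrank_homogeneousSubmodule_three (n : ℕ) :
    2 * Module.finrank ℂ (homogeneousSubmodule (Fin 3) ℂ n) = (n + 1) * (n + 2) := by
  rw [finrank_homogeneousSubmodule, show 3 + n - 1 = n + 2 by omega,
    show n + 2 = n + 2 from rfl, Nat.choose_symm_add, Nat.choose_two_right,
    Nat.mul_div_cancel' (Nat.even_mul_pred_self _).two_dvd, mul_comm]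
  rfl

end Homogeneous

/-! ### Binary forms -/

section BinaryForms

variable {n : ℕ}

/-- The linear form `v₁ s - v₀ t`, whose only zero in `ℙ¹` is the point `v`. -/
def lin (v : Fin 2 → ℂ) : MvPolynomial (Fin 2) ℂ := C (v 1) * X 0 - C (v 0) * X 1

theorem lin_isHomogeneous (v : Fin 2 → ℂ) : (lin v).IsHomogeneous 1 :=
  (isHomogeneous_C_mul_X _ _).sub (isHomogeneous_C_mul_X _ _)

@[simp]
theorem eval_lin (v w : Fin 2 → ℂ) : eval w (lin v) = v 1 * w 0 - v 0 * w 1 := by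
  simp [lin]

theorem eval_lin_self (v : Fin 2 → ℂ) : eval v (lin v) = 0 := by
  rw [eval_lin]; ring

theorem eval_lin_eq_zero_iff {v w : Fin 2 → ℂ} (hv : v ≠ 0) (hw : w ≠ 0) :
    eval w (lin v) = 0 ↔ Projectivization.mk ℂ v hv = Projectivization.mk ℂ w hw := by
  rw [Projectivization.mk_eq_mk_iff', eval_lin]
  constructor
  · intro h
    by_cases h0 : w 0 = 0
    · have h1 : w 1 ≠ 0 := by
        intro h1
        exact hw (by ext i; fin_cases i <;> simp [h0, h1])
      refine ⟨v 1 / w 1, ?_⟩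
      ext i
      fin_cases i
      · have : v 0 * w 1 = 0 := by rw [h0] at h; simpa using h
        simp [h0, (mul_eq_zero.mp this).resolve_right h1]
      · simp [h1]
    · refine ⟨v 0 / w 0, ?_⟩
      ext i
      fin_cases i
      · simp [h0]
      · simp only [Fin.mk_one, Pi.smul_apply, smul_eq_mul]
        field_simp
        linear_combination -h
  · rintro ⟨a, rfl⟩
    simp; ring

theorem lin_ne_zero {v : Fin 2 → ℂ} (hv : v ≠ 0) : lin v ≠ 0 := by
  intro h
  have h1 : eval ![1, 0] (lin v) = 0 := by rw [h]; simp
  have h2 : eval ![0, 1] (lin v) = 0 := by rw [h]; simp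
  rw [eval_lin] at h1 h2
  exact hv (by ext i; fin_cases i <;> simp_all)

/-- A point at which `lin w` does not vanish. -/
theorem exists_eval_lin_ne_zero {v : Fin 2 → ℂ} (hv : v ≠ 0) : ∃ w, eval v (lin w) ≠ 0 := by
  by_contra! h
  have h1 := h ![1, 0]
  have h2 := h ![0, 1]
  rw [eval_lin] at h1 h2
  exact hv (by ext i; fin_cases i <;> simp_all)

/-- There is a binary form of every degree that does not vanish at a given point. -/
theorem exists_form_eval_eq_one {v : Fin 2 → ℂ} (hv : v ≠ 0) (n : ℕ) :
    ∃ a : MvPolynomial (Fin 2) ℂ, a.IsHomogeneous n ∧ eval v a = 1 := by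
  obtain ⟨w, hw⟩ := exists_eval_lin_ne_zero hv
  refine ⟨C ((eval v (lin w)) ^ n)⁻¹ * lin w ^ n, ?_, ?_⟩
  · simpa using (isHomogeneous_C (Fin 2) _).mul ((lin_isHomogeneous w).pow n)
  · rw [map_mul, map_pow, eval_C, inv_mul_cancel₀ (pow_ne_zero _ hw)]

/-- A binary form vanishing at a point is divisible by the linear form of that point. -/
theorem exists_eq_lin_mul {F : MvPolynomial (Fin 2) ℂ} (hF : F.IsHomogeneous n)
    {v : Fin 2 → ℂ} (hv : v ≠ 0) (h : eval v F = 0) :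
    ∃ G : MvPolynomial (Fin 2) ℂ, G.IsHomogeneous (n - 1) ∧ F = lin v * G := by
  obtain ⟨k, hk⟩ : ∃ k, v k ≠ 0 := by
    by_contra! h; exact hv (funext h)
  let π := Ideal.Quotient.mkₐ ℂ (Ideal.span {lin v})
  have hπ : π (lin v) = 0 := by
    rw [Ideal.Quotient.mkₐ_eq_mk, Ideal.Quotient.eq_zero_iff_mem]
    exact Ideal.mem_span_singleton_self _
  have hπ' : π (C (v 1)) * π (X 0) = π (C (v 0)) * π (X 1) := by
    rw [← sub_eq_zero, ← map_mul, ← map_mul, ← map_sub]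
    exact hπ
  have e1 : (fun i => π (C (v k)) * π (X i)) = fun i => π (X k) * π (C (v i)) := by
    funext i
    fin_cases k <;> fin_cases i
    · exact mul_comm _ _
    · exact hπ'.symm.trans (mul_comm _ _)
    · exact hπ'.trans (mul_comm _ _)
    · exact mul_comm _ _
  have e2 := aeval_mul_of_isHomogeneous hF (π (C (v k))) (fun i => π (X i))
  rw [e1, aeval_mul_of_isHomogeneous hF (π (X k)) (fun i => π (C (v i)))] at e2
  have e3 : aeval (fun i => π (C (v i))) F = 0 := by
    have : aeval (fun i => π (C (v i)))
        = (Algebra.ofId ℂ (MvPolynomial (Fin 2) ℂ ⧸ Ideal.span {lin v})).comp (aeval v) := by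
      ext i
      simp
    rw [this, AlgHom.comp_apply, aeval_eq_eval, h, map_zero]
  have e4 : aeval (fun i => π (X i)) F = π F := by
    have : aeval (fun i => π (X i)) = π := by ext i; simp
    rw [this]
  rw [e3, mul_zero, e4, ← map_pow, ← map_mul, eq_comm, Ideal.Quotient.mkₐ_eq_mk,
    Ideal.Quotient.eq_zero_iff_mem, Ideal.mem_span_singleton, ← C_pow] at e2
  obtain ⟨G, hG⟩ := e2
  have hFG : F = lin v * (C ((v k ^ n)⁻¹) * G) := by
    calc F = C ((v k ^ n)⁻¹) * (C (v k ^ n) * F) := by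
          rw [← mul_assoc, ← C_mul, inv_mul_cancel₀ (pow_ne_zero _ hk), C_1, one_mul]
      _ = _ := by rw [hG]; ring
  refine ⟨_, ?_, hFG⟩
  refine isHomogeneous_of_mul_left (lin_isHomogeneous v) (lin_ne_zero hv) ?_
  rwa [← hFG]

/-- A binary form of positive degree has a zero in `ℙ¹`. -/
theorem exists_eval_eq_zero {F : MvPolynomial (Fin 2) ℂ} (hF : F.IsHomogeneous n) (hn : n ≠ 0) :
    ∃ v : Fin 2 → ℂ, v ≠ 0 ∧ eval v F = 0 := by
  let p : Polynomial ℂ := aeval ![Polynomial.X, 1] F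
  have hp : ∀ x, p.eval x = eval ![x, 1] F := by
    intro x
    have : ((Polynomial.aeval x).comp (aeval ![Polynomial.X, 1])) F = aeval ![x, 1] F := by
      congr 1
      ext i; fin_cases i <;> simp
    simpa [p, Polynomial.coe_aeval_eq_eval, aeval_eq_eval] using this
  by_cases hd : p.degree = 0
  · obtain ⟨c, hc⟩ : ∃ c, p = Polynomial.C c := ⟨_, Polynomial.eq_C_of_degree_eq_zero hd⟩
    -- `F` is constant on the chart `t = 1`, hence equal to `c tⁿ`
    have h0 : X 1 * (F - C c * X 1 ^ n) = 0 := by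
      refine MvPolynomial.funext fun v => ?_
      by_cases h1 : v 1 = 0
      · simp [h1]
      · have hv : v = v 1 • ![v 0 / v 1, 1] := by
          ext i; fin_cases i <;> simp [mul_div_cancel₀, h1]
        have : eval v F = v 1 ^ n * c := by
          rw [hv, eval_smul_of_isHomogeneous hF, ← hp, hc]; simp
        simp [this]; right; ring
    have h1 : F = C c * X 1 ^ n := by
      rw [← sub_eq_zero]
      exact (mul_eq_zero.mp h0).resolve_left (X_ne_zero 1)
    refine ⟨![1, 0], fun h => by simpa using congrFun h 0, ?_⟩
    rw [h1]; simp [hn]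
  · obtain ⟨x, hx⟩ := IsAlgClosed.exists_root p hd
    refine ⟨![x, 1], fun h => by simpa using congrFun h 1, ?_⟩
    rw [← hp]; exact hx

theorem finite_zeros {F : MvPolynomial (Fin 2) ℂ} (hF : F.IsHomogeneous n) (h0 : F ≠ 0) :
    {Q : ℙ ℂ (Fin 2 → ℂ) | eval Q.rep F = 0}.Finite := by
  induction n generalizing F with
  | zero =>
    obtain ⟨c, rfl⟩ : ∃ c, F = C c := ⟨_, by
      rw [← totalDegree_eq_zero_iff_eq_C, ]; exact Nat.le_zero.mp hF.totalDegree_le⟩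
    have hc : c ≠ 0 := fun h => h0 (by rw [h, C_0])
    simp [hc]
  | succ n ih =>
    by_cases hne : ∃ Q : ℙ ℂ (Fin 2 → ℂ), eval Q.rep F = 0
    · obtain ⟨Q, hQ⟩ := hne
      obtain ⟨G, hG, rfl⟩ := exists_eq_lin_mul hF Q.rep_nonzero hQ
      refine ((Set.finite_singleton Q).union (ih hG (right_ne_zero_of_mul h0))).subset ?_
      intro Q' hQ'
      rw [Set.mem_ofPred_eq, map_mul, mul_eq_zero,
        eval_lin_eq_zero_iff Q.rep_nonzero Q'.rep_nonzero, Projectivization.mk_rep,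
        Projectivization.mk_rep] at hQ'
      rcases hQ' with rfl | h
      · exact Or.inl rfl
      · exact Or.inr h
    · push Not at hne
      convert Set.finite_empty
      ext Q
      simp [hne Q]

theorem eq_C_of_isHomogeneous_zero {σ : Type*} {F : MvPolynomial σ ℂ} (hF : F.IsHomogeneous 0) :
    ∃ c, F = C c :=
  ⟨_, totalDegree_eq_zero_iff_eq_C.mp (Nat.le_zero.mp hF.totalDegree_le)⟩

/-- Two binary forms of degrees `j` and `k` without a common zero generate all forms of degree
`≥ j + k - 1`.  The induction strips the linear factors of the first form one by one. -/
theorem exists_eq_mul_add_mul {j k n : ℕ} {g₀ g₁ : MvPolynomial (Fin 2) ℂ}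
    (h₀ : g₀.IsHomogeneous j) (h₁ : g₁.IsHomogeneous k)
    (h : ∀ w, w ≠ 0 → eval w g₀ ≠ 0 ∨ eval w g₁ ≠ 0) (hn : j + k ≤ n + 1)
    {F : MvPolynomial (Fin 2) ℂ} (hF : F.IsHomogeneous n) :
    ∃ α β : MvPolynomial (Fin 2) ℂ, α.IsHomogeneous (n - j) ∧ β.IsHomogeneous (n - k) ∧
      F = α * g₀ + β * g₁ := by
  suffices H : ∃ α β : MvPolynomial (Fin 2) ℂ, α.IsHomogeneous (n - j) ∧
      β.IsHomogeneous (n - k) ∧ (n < k → β = 0) ∧ F = α * g₀ + β * g₁ by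
    obtain ⟨α, β, hα, hβ, -, hF⟩ := H
    exact ⟨α, β, hα, hβ, hF⟩
  induction j generalizing g₀ n F with
  | zero =>
    obtain ⟨c, rfl⟩ := eq_C_of_isHomogeneous_zero h₀
    by_cases hc : c = 0
    · subst hc
      have hk : k = 0 := by
        by_contra hk
        obtain ⟨v, hv, hv0⟩ := exists_eval_eq_zero h₁ hk
        simpa [hv0] using h v hv
      subst hk
      obtain ⟨c, rfl⟩ := eq_C_of_isHomogeneous_zero h₁
      have hc : c ≠ 0 := by simpa using h ![1, 0] (fun h => by simpa using congrFun h 0)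
      refine ⟨0, F * C c⁻¹, isHomogeneous_zero _ _ _, hF.mul (isHomogeneous_C _ _), by simp, ?_⟩
      rw [mul_assoc, ← C_mul, inv_mul_cancel₀ hc]; simp
    · refine ⟨F * C c⁻¹, 0, hF.mul (isHomogeneous_C _ _), isHomogeneous_zero _ _ _, by simp, ?_⟩
      rw [mul_assoc, ← C_mul, inv_mul_cancel₀ hc]; simp
  | succ j ih =>
    obtain ⟨v, hv, hv0⟩ := exists_eval_eq_zero h₀ (Nat.succ_ne_zero j)
    obtain ⟨g, hg, rfl⟩ := exists_eq_lin_mul h₀ hv hv0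
    have hv1 : eval v g₁ ≠ 0 := by
      rcases h v hv with h | h
      · exact absurd hv0 h
      · exact h
    rcases Nat.eq_zero_or_pos n with rfl | hnpos
    · obtain rfl : k = 0 := by omega
      obtain ⟨c, rfl⟩ := eq_C_of_isHomogeneous_zero h₁
      have hc : c ≠ 0 := by simpa using hv1
      refine ⟨0, F * C c⁻¹, isHomogeneous_zero _ _ _, hF.mul (isHomogeneous_C _ _), by simp, ?_⟩
      rw [mul_assoc, ← C_mul, inv_mul_cancel₀ hc]; simp
    · obtain ⟨b, hb, hb1⟩ := exists_form_eval_eq_one hv (n - k)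
      set β₀ := C (eval v F / eval v g₁) * b with hβ₀
      have hβ₀h : β₀.IsHomogeneous (n - k) := by
        simpa using (isHomogeneous_C (Fin 2) (eval v F / eval v g₁)).mul hb
      have hsub : (F - β₀ * g₁).IsHomogeneous n := by
        refine hF.sub ?_
        have := hβ₀h.mul h₁
        rwa [Nat.sub_add_cancel (by omega)] at this
      obtain ⟨F', hF', hFF'⟩ := exists_eq_lin_mul hsub hv (by
        simp [hβ₀, hb1, div_mul_cancel₀ _ hv1])
      obtain ⟨α, β, hα, hβ, hβ0, hαβ⟩ := ih (n := n - 1) (F := F') hg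
        (fun w hw => by
          rcases h w hw with h | h
          · exact Or.inl fun h' => h (by rw [map_mul, h', mul_zero])
          · exact Or.inr h) (by omega) hF'
      refine ⟨α, β₀ + lin v * β, by convert hα using 1; omega, hβ₀h.add ?_, by omega, ?_⟩
      · by_cases hk : n - 1 < k
        · rw [hβ0 hk, mul_zero]; exact isHomogeneous_zero _ _ _
        · have := (lin_isHomogeneous v).mul hβ
          convert this using 1; omega
      · rw [← sub_add_cancel F (β₀ * g₁), hFF', hαβ]; ring

/-- If a form `B` vanishes at every zero of a nonzero form `A`, then `A ∣ B ^ deg A`. -/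
theorem dvd_pow_of_zeros {k : ℕ} {A B : MvPolynomial (Fin 2) ℂ} (hA : A.IsHomogeneous n)
    (hA0 : A ≠ 0) (hB : B.IsHomogeneous k) (h : ∀ w, w ≠ 0 → eval w A = 0 → eval w B = 0) :
    A ∣ B ^ n := by
  induction n generalizing A with
  | zero =>
    obtain ⟨c, rfl⟩ := eq_C_of_isHomogeneous_zero hA
    have hc : c ≠ 0 := fun h => hA0 (by rw [h, C_0])
    exact ⟨C c⁻¹, by rw [← C_mul, mul_inv_cancel₀ hc]; simp⟩
  | succ n ih =>
    obtain ⟨v, hv, hv0⟩ := exists_eval_eq_zero hA (Nat.succ_ne_zero n)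
    obtain ⟨A', hA', rfl⟩ := exists_eq_lin_mul hA hv hv0
    obtain ⟨B', -, hB'⟩ := exists_eq_lin_mul hB hv (h v hv hv0)
    rw [pow_succ']
    exact mul_dvd_mul ⟨B', hB'⟩ (ih hA' (right_ne_zero_of_mul hA0)
      fun w hw h0 => h w hw (by rw [map_mul, h0, mul_zero]))

end BinaryForms

/-! ### The parametrization: fibres, ramification, good points -/

section GoodPoints

variable {d : ℕ}

/-- The image `(f₀(v), f₁(v), f₂(v))` of a coordinate vector `v`. -/
def Param.pt (φ : Param d) (v : Fin 2 → ℂ) : Fin 3 → ℂ := fun j => eval v (φ.f j)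

theorem Param.pt_ne_zero (φ : Param d) {v : Fin 2 → ℂ} (hv : v ≠ 0) : φ.pt v ≠ 0 :=
  φ.no_common_zero v hv

theorem Param.eval_aeval (φ : Param d) (v : Fin 2 → ℂ) (h : MvPolynomial (Fin 3) ℂ) :
    eval v (aeval φ.f h) = eval (φ.pt v) h := by
  have : (aeval v : MvPolynomial (Fin 2) ℂ →ₐ[ℂ] ℂ).comp (aeval φ.f) = aeval (φ.pt v) := by
    ext j
    simp [Param.pt, aeval_eq_eval]
  simpa [aeval_eq_eval] using DFunLike.congr_fun this h

theorem Param.aeval_isHomogeneous (φ : Param d) {n : ℕ} {h : MvPolynomial (Fin 3) ℂ}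
    (hh : h.IsHomogeneous n) : (aeval φ.f h).IsHomogeneous (d * n) :=
  hh.aeval φ.f φ.homogeneous

/-- The ternary linear form with coefficient vector `c`. -/
def lform (c : Fin 3 → ℂ) : MvPolynomial (Fin 3) ℂ := ∑ j, C (c j) * X j

theorem lform_isHomogeneous (c : Fin 3 → ℂ) : (lform c).IsHomogeneous 1 :=
  IsHomogeneous.sum _ _ _ fun _ _ => isHomogeneous_C_mul_X _ _

theorem eval_lform (c p : Fin 3 → ℂ) : eval p (lform c) = ∑ j, c j * p j := by
  simp [lform]

theorem Param.aeval_lform (φ : Param d) (c : Fin 3 → ℂ) :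
    aeval φ.f (lform c) = ∑ j, C (c j) * φ.f j := by
  simp [lform, algebraMap_eq]

/-- The linear form `pᵢ xⱼ - pⱼ xᵢ`, vanishing at `p`. -/
def minorForm (p : Fin 3 → ℂ) (i j : Fin 3) : MvPolynomial (Fin 3) ℂ :=
  C (p i) * X j - C (p j) * X i

theorem minorForm_isHomogeneous (p : Fin 3 → ℂ) (i j : Fin 3) :
    (minorForm p i j).IsHomogeneous 1 :=
  (isHomogeneous_C_mul_X _ _).sub (isHomogeneous_C_mul_X _ _)

theorem eval_minorForm (p q : Fin 3 → ℂ) (i j : Fin 3) :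
    eval q (minorForm p i j) = p i * q j - p j * q i := by
  simp [minorForm]

theorem Param.aeval_minorForm (φ : Param d) (p : Fin 3 → ℂ) (i j : Fin 3) :
    aeval φ.f (minorForm p i j) = C (p i) * φ.f j - C (p j) * φ.f i := by
  simp [minorForm, algebraMap_eq]

theorem mk_eq_mk_of_minors {p q : Fin 3 → ℂ} (hp : p ≠ 0) (hq : q ≠ 0)
    (h : ∀ i j, p i * q j = p j * q i) :
    Projectivization.mk ℂ p hp = Projectivization.mk ℂ q hq := by
  obtain ⟨i, hi⟩ : ∃ i, q i ≠ 0 := by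
    by_contra! h; exact hq (funext h)
  rw [Projectivization.mk_eq_mk_iff']
  refine ⟨p i / q i, ?_⟩
  ext j
  simp only [Pi.smul_apply, smul_eq_mul]
  rw [div_mul_eq_mul_div, div_eq_iff hi, h]

theorem exists_smul_of_mk_eq_mk {K V : Type*} [Field K] [AddCommGroup V] [Module K V] {p q : V}
    {hp : p ≠ 0} {hq : q ≠ 0} (h : Projectivization.mk K p hp = Projectivization.mk K q hq) :
    ∃ a : K, a ≠ 0 ∧ p = a • q := by
  obtain ⟨a, ha⟩ := (Projectivization.mk_eq_mk_iff' K p q hp hq).mp h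
  exact ⟨a, fun h0 => hp (by rw [← ha, h0, zero_smul]), ha.symm⟩

theorem Param.mk_pt_rep (φ : Param d) (Q : ℙ ℂ (Fin 2 → ℂ)) :
    Projectivization.mk ℂ (φ.pt Q.rep) (φ.pt_ne_zero Q.rep_nonzero) = φ.map Q := rfl

theorem Param.mk_pt (φ : Param d) {v : Fin 2 → ℂ} (hv : v ≠ 0) :
    Projectivization.mk ℂ (φ.pt v) (φ.pt_ne_zero hv) = φ.map (Projectivization.mk ℂ v hv) :=
  (φ.map_mk v hv).symm

theorem Param.not_proportional (φ : Param d) (hd : d ≠ 0) (i : Fin 3) (c : Fin 3 → ℂ) :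
    ¬ ∀ j, φ.f j = C (c j) * φ.f i := by
  intro h
  obtain ⟨v, hv, hv0⟩ := exists_eval_eq_zero (φ.homogeneous i) hd
  refine φ.no_common_zero v hv (funext fun j => ?_)
  change eval v (φ.f j) = 0
  rw [h j, map_mul, hv0, mul_zero]

theorem Param.finite_fiber (φ : Param d) (hd : d ≠ 0) (P : ℙ ℂ (Fin 3 → ℂ)) :
    {Q | φ.map Q = P}.Finite := by
  obtain ⟨i, hi⟩ : ∃ i, P.rep i ≠ 0 := by
    by_contra! h; exact P.rep_nonzero (funext h)
  obtain ⟨j, hj⟩ : ∃ j, aeval φ.f (minorForm P.rep i j) ≠ 0 := by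
    by_contra! h
    refine φ.not_proportional hd i (fun j => P.rep j / P.rep i) fun j => ?_
    have := h j
    rw [φ.aeval_minorForm, sub_eq_zero] at this
    rw [div_eq_inv_mul, C_mul, mul_assoc, ← this, ← mul_assoc, ← C_mul, inv_mul_cancel₀ hi]
    simp
  refine (finite_zeros (φ.aeval_isHomogeneous (minorForm_isHomogeneous P.rep i j)) hj).subset ?_
  intro Q hQ
  rw [Set.mem_ofPred_eq] at hQ ⊢
  rw [φ.eval_aeval, eval_minorForm]
  have h1 : Projectivization.mk ℂ P.rep P.rep_nonzero
      = Projectivization.mk ℂ (φ.pt Q.rep) (φ.pt_ne_zero Q.rep_nonzero) := by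
    rw [φ.mk_pt_rep, hQ, Projectivization.mk_rep]
  obtain ⟨a, -, ha⟩ := exists_smul_of_mk_eq_mk h1
  rw [ha]
  simp; ring

theorem Param.finite_multiple (φ : Param d) (hd : d ≠ 0) (hφ : φ.IsGenericallyInjective) :
    {Q | ∃ Q', Q' ≠ Q ∧ φ.map Q' = φ.map Q}.Finite := by
  refine (Set.Finite.preimage' (f := φ.map) hφ fun P _ => φ.finite_fiber hd P).subset ?_
  rintro Q ⟨Q', hne, h⟩
  refine ⟨⟨Q, rfl⟩, ?_⟩
  rintro ⟨Q₀, -, huniq⟩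
  exact hne ((huniq Q' h).trans (huniq Q rfl).symm)

/-- The form `fᵢ ∂ₖfⱼ - fⱼ ∂ₖfᵢ`, which vanishes where the map ramifies. -/
def Param.ramForm (φ : Param d) (i j : Fin 3) (k : Fin 2) : MvPolynomial (Fin 2) ℂ :=
  φ.f i * pderiv k (φ.f j) - φ.f j * pderiv k (φ.f i)

theorem pderiv_lin_ne_zero {v : Fin 2 → ℂ} (hv : v ≠ 0) :
    ∃ k, eval v (pderiv k (lin v)) ≠ 0 := by
  by_contra! h
  have h0 := h 0
  have h1 := h 1
  simp [lin, pderiv_X] at h0 h1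
  exact hv (by ext i; fin_cases i <;> simp_all)

/-- If all the forms `fᵢ ∂ₖfⱼ - fⱼ ∂ₖfᵢ` were zero, the `fⱼ` would be proportional: compare orders
of vanishing at a point of `fⱼ - c fᵢ`. -/
theorem Param.exists_ramForm_ne_zero (φ : Param d) (hd : d ≠ 0) :
    ∃ i j k, φ.ramForm i j k ≠ 0 := by
  by_contra! h
  have hv : (![1, 0] : Fin 2 → ℂ) ≠ 0 := fun h => by simpa using congrFun h 0
  set v : Fin 2 → ℂ := ![1, 0]
  obtain ⟨i, hi⟩ : ∃ i, eval v (φ.f i) ≠ 0 := by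
    by_contra! h; exact φ.pt_ne_zero hv (funext h)
  refine φ.not_proportional hd i (fun j => eval v (φ.f j) / eval v (φ.f i)) fun j => ?_
  set c := eval v (φ.f j) / eval v (φ.f i) with hc
  rw [← sub_eq_zero]
  by_contra hg
  set g := φ.f j - C c * φ.f i with hgdef
  have hgh : g.IsHomogeneous d := (φ.homogeneous j).sub ((φ.homogeneous i).C_mul c)
  have hlu : ¬ IsUnit (lin v) := fun hu => by
    have := hu.map (eval v)
    rw [eval_lin_self] at this
    exact not_isUnit_zero this
  obtain ⟨b, hb, hndvd⟩ :=
    (FiniteMultiplicity.of_not_isUnit hlu hg).exists_eq_pow_mul_and_not_dvd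
  set m := multiplicity (lin v) g
  have hbh : b.IsHomogeneous (d - m) := by
    have := (lin_isHomogeneous v).pow m
    rw [one_mul] at this
    exact isHomogeneous_of_mul_left this (pow_ne_zero _ (lin_ne_zero hv)) (hb ▸ hgh)
  have hbv : eval v b ≠ 0 := fun h0 => by
    obtain ⟨G, -, hG⟩ := exists_eq_lin_mul hbh hv h0
    exact hndvd ⟨G, hG⟩
  have hgv : eval v g = 0 := by
    rw [hgdef, map_sub, map_mul, eval_C, hc, div_mul_cancel₀ _ hi, sub_self]
  obtain ⟨m', hm'⟩ : ∃ m', m = m' + 1 := by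
    refine Nat.exists_eq_succ_of_ne_zero fun h0 => ?_
    rw [hb, h0, pow_zero, one_mul] at hgv
    exact hbv hgv
  obtain ⟨k, hk⟩ := pderiv_lin_ne_zero hv
  have e1 : φ.f i * pderiv k g = g * pderiv k (φ.f i) := by
    have := h i j k
    rw [Param.ramForm] at this
    rw [hgdef, map_sub, pderiv_C_mul]
    linear_combination this
  rw [hb, hm', pderiv_mul, pderiv_pow, Nat.add_sub_cancel, pow_succ] at e1
  have e2 : lin v ^ m' * (φ.f i * ((m' + 1 : ℕ) * pderiv k (lin v) * b + lin v * pderiv k b)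
      - lin v * b * pderiv k (φ.f i)) = 0 := by
    linear_combination e1
  have e3 := (mul_eq_zero.mp e2).resolve_left (pow_ne_zero _ (lin_ne_zero hv))
  have e4 := congrArg (eval v) e3
  simp only [map_sub, map_mul, map_add, eval_lin_self, map_natCast, map_zero, zero_mul, add_zero,
    sub_zero, mul_eq_zero, hi, hk, hbv, or_false, false_or] at e4
  exact Nat.cast_ne_zero.mpr (Nat.succ_ne_zero m') e4

/-- A point `v` of `ℙ¹` is good if no point `w ≠ v` has the same image and the map is unramified at
`v`.  Uniformly in `w`: some linear form through `φ(v)` pulls back to the linear form of `v` times a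
form not vanishing at `w`. -/
def Param.IsGood (φ : Param d) (v : Fin 2 → ℂ) : Prop :=
  ∀ w, w ≠ 0 → ∃ (c : Fin 3 → ℂ) (g : MvPolynomial (Fin 2) ℂ), g.IsHomogeneous (d - 1) ∧
    aeval φ.f (lform c) = lin v * g ∧ eval w g ≠ 0

theorem minorForm_eq_lform (p : Fin 3 → ℂ) (i j : Fin 3) :
    minorForm p i j = lform (fun k => p i * Pi.single (M := fun _ => ℂ) j 1 k
      - p j * Pi.single (M := fun _ => ℂ) i 1 k) := by
  unfold minorForm lform
  simp only [Pi.single_apply, mul_ite, mul_one, mul_zero, map_sub, sub_mul,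
    Finset.sum_sub_distrib, apply_ite C, map_zero, ite_mul, zero_mul, Finset.sum_ite_eq',
    Finset.mem_univ, if_true]

/-- All but finitely many points of `ℙ¹` are good. -/
theorem Param.finite_not_isGood (φ : Param d) (hd : d ≠ 0) (hφ : φ.IsGenericallyInjective) :
    {Q : ℙ ℂ (Fin 2 → ℂ) | ¬ φ.IsGood Q.rep}.Finite := by
  obtain ⟨i₀, j₀, k₀, hN⟩ := φ.exists_ramForm_ne_zero hd
  have hNh : (φ.ramForm i₀ j₀ k₀).IsHomogeneous (d + (d - 1)) :=
    ((φ.homogeneous _).mul (φ.homogeneous _).pderiv).sub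
      ((φ.homogeneous _).mul (φ.homogeneous _).pderiv)
  refine ((φ.finite_multiple hd hφ).union (finite_zeros hNh hN)).subset ?_
  intro Q hQ
  rw [Set.mem_ofPred_eq] at hQ
  have hv := Q.rep_nonzero
  unfold Param.IsGood at hQ
  push Not at hQ
  obtain ⟨w, hw, H⟩ := hQ
  -- the cofactor of every linear form through `φ(v)` vanishes at `w`
  have H' : ∀ i j, ∃ g : MvPolynomial (Fin 2) ℂ, g.IsHomogeneous (d - 1) ∧ eval w g = 0 ∧
      aeval φ.f (minorForm (φ.pt Q.rep) i j) = lin Q.rep * g := by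
    intro i j
    have h1 : (aeval φ.f (minorForm (φ.pt Q.rep) i j)).IsHomogeneous d := by
      simpa using φ.aeval_isHomogeneous (minorForm_isHomogeneous (φ.pt Q.rep) i j)
    obtain ⟨g, hg, hgeq⟩ := exists_eq_lin_mul h1 hv (by
      rw [φ.eval_aeval, eval_minorForm]; ring)
    refine ⟨g, hg, ?_, hgeq⟩
    rw [minorForm_eq_lform] at hgeq
    exact H _ g hg hgeq
  by_cases hwv : Projectivization.mk ℂ Q.rep hv = Projectivization.mk ℂ w hw
  · right
    obtain ⟨a, ha0, ha⟩ := exists_smul_of_mk_eq_mk hwv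
    rw [Set.mem_ofPred_eq]
    obtain ⟨g, hg, hgw, hgeq⟩ := H' i₀ j₀
    have hgv : eval Q.rep g = 0 := by
      rw [ha, eval_smul_of_isHomogeneous hg, hgw, mul_zero]
    have := congrArg (fun p => eval Q.rep (pderiv k₀ p)) hgeq
    simp only [φ.aeval_minorForm, map_sub, pderiv_mul, pderiv_C, map_add, map_mul, eval_C,
      hgv, eval_lin_self, mul_zero, zero_mul, add_zero, zero_add] at this
    rw [Param.ramForm, map_sub, map_mul, map_mul]
    exact this
  · left
    refine ⟨Projectivization.mk ℂ w hw, ?_, ?_⟩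
    · rw [← Projectivization.mk_rep Q]; exact fun h => hwv h.symm
    · rw [← φ.mk_pt hw, ← φ.mk_pt_rep, eq_comm]
      refine mk_eq_mk_of_minors _ _ fun i j => ?_
      obtain ⟨g, hg, hgw, hgeq⟩ := H' i j
      have := congrArg (eval w) hgeq
      rw [φ.eval_aeval, eval_minorForm, map_mul, hgw, mul_zero] at this
      linear_combination this

theorem infinite_projectiveLine : Infinite (ℙ ℂ (Fin 2 → ℂ)) := by
  refine Infinite.of_injective
    (fun x : ℂ => Projectivization.mk ℂ ![x, 1] (fun h => by simpa using congrFun h 1)) ?_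
  intro x y h
  obtain ⟨a, -, ha⟩ := exists_smul_of_mk_eq_mk h
  have h0 := congrFun ha 0
  have h1 := congrFun ha 1
  simp at h0 h1
  rw [h0, ← h1, one_mul]

theorem Param.exists_isGood (φ : Param d) (hd : d ≠ 0) (hφ : φ.IsGenericallyInjective) :
    ∃ v, v ≠ 0 ∧ φ.IsGood v := by
  have := infinite_projectiveLine
  obtain ⟨Q, hQ⟩ := (φ.finite_not_isGood hd hφ).exists_notMem
  exact ⟨Q.rep, Q.rep_nonzero, by simpa using hQ⟩

/-- At a good point, two linear forms through `φ(v)` have pullbacks with greatest common divisor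
the linear form of `v`. -/
theorem Param.IsGood.exists_pair {φ : Param d} {v : Fin 2 → ℂ} (hv : v ≠ 0) (h : φ.IsGood v) :
    ∃ (x y : MvPolynomial (Fin 3) ℂ) (g₀ g₁ : MvPolynomial (Fin 2) ℂ),
      x.IsHomogeneous 1 ∧ y.IsHomogeneous 1 ∧
      eval (φ.pt v) x = 0 ∧ eval (φ.pt v) y = 0 ∧
      g₀.IsHomogeneous (d - 1) ∧ g₁.IsHomogeneous (d - 1) ∧
      aeval φ.f x = lin v * g₀ ∧ aeval φ.f y = lin v * g₁ ∧
      ∀ w, w ≠ 0 → eval w g₀ ≠ 0 ∨ eval w g₁ ≠ 0 := by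
  obtain ⟨i, hi⟩ : ∃ i, φ.pt v i ≠ 0 := by
    by_contra! h; exact φ.pt_ne_zero hv (funext h)
  have H : ∀ j, ∃ g : MvPolynomial (Fin 2) ℂ, g.IsHomogeneous (d - 1) ∧
      aeval φ.f (minorForm (φ.pt v) i j) = lin v * g := by
    intro j
    have h1 : (aeval φ.f (minorForm (φ.pt v) i j)).IsHomogeneous d := by
      simpa using φ.aeval_isHomogeneous (minorForm_isHomogeneous (φ.pt v) i j)
    exact exists_eq_lin_mul h1 hv (by rw [φ.eval_aeval, eval_minorForm]; ring)
  choose g hg hgeq using H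
  refine ⟨minorForm (φ.pt v) i (i.succAbove 0), minorForm (φ.pt v) i (i.succAbove 1),
    g (i.succAbove 0), g (i.succAbove 1), minorForm_isHomogeneous _ _ _,
    minorForm_isHomogeneous _ _ _, by rw [eval_minorForm]; ring, by rw [eval_minorForm]; ring,
    hg _, hg _, hgeq _, hgeq _, fun w hw => ?_⟩
  by_contra! h0
  obtain ⟨c, g', -, hceq, hg'w⟩ := h w hw
  have hall : ∀ j, eval w (g j) = 0 := by
    intro j
    rcases Fin.eq_self_or_eq_succAbove i j with rfl | ⟨k, rfl⟩
    · have := hgeq j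
      rw [minorForm, sub_self, map_zero, eq_comm, mul_eq_zero] at this
      rw [this.resolve_left (lin_ne_zero hv), map_zero]
    · fin_cases k
      · exact h0.1
      · exact h0.2
  -- `pᵢ ∑ cⱼ fⱼ = ∑ cⱼ (pᵢ fⱼ - pⱼ fᵢ)`, because `∑ cⱼ pⱼ = 0`
  have hcp : ∑ j, c j * φ.pt v j = 0 := by
    rw [← eval_lform, ← φ.eval_aeval, hceq, map_mul, eval_lin_self, zero_mul]
  have key : lin v * (C (φ.pt v i) * g') = lin v * ∑ j, C (c j) * g j := by
    rw [mul_left_comm, ← hceq, φ.aeval_lform, Finset.mul_sum, Finset.mul_sum]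
    have : ∀ j, lin v * (C (c j) * g j)
        = C (φ.pt v i) * (C (c j) * φ.f j) - C (c j * φ.pt v j) * φ.f i := by
      intro j
      rw [mul_left_comm, ← hgeq, φ.aeval_minorForm, C_mul]; ring
    simp_rw [this]
    rw [Finset.sum_sub_distrib, ← Finset.sum_mul, ← map_sum, hcp]
    simp
  have := congrArg (eval w) (mul_left_cancel₀ (lin_ne_zero hv) key)
  rw [map_mul, eval_C, map_sum] at this
  simp only [map_mul, hall, mul_zero, Finset.sum_const_zero] at this
  exact mul_ne_zero hi hg'w this

/-- A linear form not vanishing at `p`. -/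
theorem exists_linear_eval_ne_zero {p : Fin 3 → ℂ} (hp : p ≠ 0) :
    ∃ z : MvPolynomial (Fin 3) ℂ, z.IsHomogeneous 1 ∧ eval p z ≠ 0 := by
  obtain ⟨i, hi⟩ : ∃ i, p i ≠ 0 := by
    by_contra! h; exact hp (funext h)
  exact ⟨X i, isHomogeneous_X _ _, by simpa using hi⟩

theorem Param.homogeneousComponent_aeval (φ : Param d) (hd : d ≠ 0) (G : MvPolynomial (Fin 3) ℂ)
    (m : ℕ) :
    homogeneousComponent (d * m) (aeval φ.f G) = aeval φ.f (homogeneousComponent m G) := by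
  conv_lhs => rw [← sum_homogeneousComponent G, map_sum, map_sum]
  have h1 : ∀ k, homogeneousComponent (d * m) (aeval φ.f (homogeneousComponent k G))
      = if k = m then aeval φ.f (homogeneousComponent k G) else 0 := by
    intro k
    rw [homogeneousComponent_of_mem
      (φ.aeval_isHomogeneous (homogeneousComponent_isHomogeneous k G))]
    refine if_congr ?_ rfl rfl
    rw [Nat.mul_right_inj hd, eq_comm]
  simp_rw [h1, Finset.sum_ite_eq']
  split_ifs with h
  · rfl
  · rw [homogeneousComponent_eq_zero _ _ (by rw [Finset.mem_range] at h; omega), map_zero]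

/-- A form in `s, t` that is a polynomial in the `fⱼ` is a form in the `fⱼ`. -/
theorem Param.exists_isHomogeneous_of_mem_range (φ : Param d) (hd : d ≠ 0) {m : ℕ}
    {a : MvPolynomial (Fin 2) ℂ} (ha : a.IsHomogeneous (d * m))
    (h : a ∈ (aeval φ.f : MvPolynomial (Fin 3) ℂ →ₐ[ℂ] _).range) :
    ∃ g : MvPolynomial (Fin 3) ℂ, g.IsHomogeneous m ∧ aeval φ.f g = a := by
  obtain ⟨G, rfl⟩ := h
  refine ⟨homogeneousComponent m G, homogeneousComponent_isHomogeneous _ _, ?_⟩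
  rw [← φ.homogeneousComponent_aeval hd]
  exact homogeneousComponent_eq_self ha

/-- At a good point `v`, forms of degree `d (n + 2)` are generated by a power of a linear form `z`
not vanishing at `φ(v)` and by the linear forms `x, y` through `φ(v)`. -/
theorem exists_eq_add_of_good {φ : Param d} {v : Fin 2 → ℂ} (hv : v ≠ 0) (hd : d ≠ 0)
    {x y z : MvPolynomial (Fin 3) ℂ} {g₀ g₁ : MvPolynomial (Fin 2) ℂ}
    (hz : z.IsHomogeneous 1) (hz0 : eval (φ.pt v) z ≠ 0)
    (hg₀ : g₀.IsHomogeneous (d - 1)) (hg₁ : g₁.IsHomogeneous (d - 1))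
    (hx : aeval φ.f x = lin v * g₀) (hy : aeval φ.f y = lin v * g₁)
    (hg : ∀ w, w ≠ 0 → eval w g₀ ≠ 0 ∨ eval w g₁ ≠ 0) (n : ℕ)
    {a : MvPolynomial (Fin 2) ℂ} (ha : a.IsHomogeneous (d * (n + 2))) :
    ∃ (κ : ℂ) (b₀ b₁ : MvPolynomial (Fin 2) ℂ), b₀.IsHomogeneous (d * (n + 1)) ∧
      b₁.IsHomogeneous (d * (n + 1)) ∧
      a = aeval φ.f (C κ * z ^ (n + 2)) + aeval φ.f x * b₀ + aeval φ.f y * b₁ := by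
  set κ := eval v a / eval (φ.pt v) z ^ (n + 2) with hκ
  have h1 : (C κ * z ^ (n + 2)).IsHomogeneous (n + 2) := by
    simpa using (hz.pow (n + 2)).C_mul κ
  obtain ⟨a', ha', haeq⟩ := exists_eq_lin_mul (ha.sub (φ.aeval_isHomogeneous h1)) hv (by
    rw [map_sub, φ.eval_aeval, map_mul, map_pow, eval_C, hκ,
      div_mul_cancel₀ _ (pow_ne_zero _ hz0), sub_self])
  have e : d * (n + 2) = d * (n + 1) + d := by ring
  have e' : d ≤ d * (n + 1) := Nat.le_mul_of_pos_right d (Nat.succ_pos n)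
  obtain ⟨α, β, hα, hβ, hαβ⟩ := exists_eq_mul_add_mul hg₀ hg₁ hg (by omega) ha'
  refine ⟨κ, α, β, ?_, ?_, ?_⟩
  · convert hα using 1; omega
  · convert hβ using 1; omega
  · rw [hx, hy, ← sub_add_cancel a (aeval φ.f (C κ * z ^ (n + 2))), haeq, hαβ]; ring

/-- Near the image of a good point `v`, every form of degree divisible by `d` is a polynomial in
the `fⱼ`: there is a form `H` with `H(φ(v)) ≠ 0` and `H(f) a ∈ ℂ[f₀, f₁, f₂]` for all such forms
`a`.  The form `H` is the determinant of multiplication by `z` modulo `(x, y)`, where `z` is a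
linear form not vanishing at `φ(v)`. -/
theorem Param.IsGood.exists_conductor {φ : Param d} {v : Fin 2 → ℂ} (hv : v ≠ 0) (hd : d ≠ 0)
    (h : φ.IsGood v) :
    ∃ (m : ℕ) (H : MvPolynomial (Fin 3) ℂ), H.IsHomogeneous m ∧ eval (φ.pt v) H ≠ 0 ∧
      ∀ (n : ℕ) (a : MvPolynomial (Fin 2) ℂ), a.IsHomogeneous (d * n) →
        ∃ g : MvPolynomial (Fin 3) ℂ, g.IsHomogeneous (m + n) ∧
          aeval φ.f g = aeval φ.f H * a := by
  obtain ⟨x, y, g₀, g₁, hxh, hyh, hx0, hy0, hg₀, hg₁, hx, hy, hg⟩ := h.exists_pair hv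
  obtain ⟨z, hz, hz0⟩ := exists_linear_eval_ne_zero (φ.pt_ne_zero hv)
  let S₁ := homogeneousSubmodule (Fin 2) ℂ d
  let e := Module.finBasis ℂ S₁
  set N := Module.finrank ℂ S₁
  have hstep : ∀ k, ∃ (κ : ℂ) (b₀ b₁ : S₁), aeval φ.f z * (e k : MvPolynomial (Fin 2) ℂ)
      = aeval φ.f (C κ * z ^ 2) + aeval φ.f x * b₀ + aeval φ.f y * b₁ := by
    intro k
    have ha : (aeval φ.f z * (e k : MvPolynomial (Fin 2) ℂ)).IsHomogeneous (d * (0 + 2)) := by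
      have := (φ.aeval_isHomogeneous hz).mul (e k).2
      convert this using 1; ring
    obtain ⟨κ, b₀, b₁, hb₀, hb₁, heq⟩ := exists_eq_add_of_good hv hd hz hz0 hg₀ hg₁ hx hy hg 0 ha
    refine ⟨κ, ⟨b₀, ?_⟩, ⟨b₁, ?_⟩, heq⟩
    · rw [zero_add, mul_one] at hb₀; exact hb₀
    · rw [zero_add, mul_one] at hb₁; exact hb₁
  choose κ b₀ b₁ hb using hstep
  -- `M` applied to the basis `e` of the forms of degree `d` gives multiples of `z ^ 2`
  let M : Matrix (Fin N) (Fin N) (MvPolynomial (Fin 3) ℂ) := Matrix.of fun k j =>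
    (if k = j then z else 0) - (C (e.repr (b₀ k) j) * x + C (e.repr (b₁ k) j) * y)
  have hM : ∀ k j, M k j
      = (if k = j then z else 0) - (C (e.repr (b₀ k) j) * x + C (e.repr (b₁ k) j) * y) :=
    fun _ _ => rfl
  have hexp : ∀ b : S₁, (b : MvPolynomial (Fin 2) ℂ)
      = ∑ j, C (e.repr b j) * (e j : MvPolynomial (Fin 2) ℂ) := by
    intro b
    have := congrArg (Submodule.subtype S₁) (e.sum_repr b)
    simp only [map_sum, map_smul, Submodule.subtype_apply, smul_eq_C_mul] at this
    exact this.symm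
  have hMe : ∀ k, ∑ j, aeval φ.f (M k j) * (e j : MvPolynomial (Fin 2) ℂ)
      = aeval φ.f (C (κ k) * z ^ 2) := by
    intro k
    have h1 : ∀ j, aeval φ.f (M k j) * (e j : MvPolynomial (Fin 2) ℂ)
        = (if k = j then aeval φ.f z * (e j : MvPolynomial (Fin 2) ℂ) else 0)
          - (aeval φ.f x * (C (e.repr (b₀ k) j) * (e j : MvPolynomial (Fin 2) ℂ))
            + aeval φ.f y * (C (e.repr (b₁ k) j) * (e j : MvPolynomial (Fin 2) ℂ))) := by
      intro j
      rw [hM]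
      simp only [map_sub, map_add, map_mul, aeval_C, algebraMap_eq]
      split_ifs
      · ring
      · rw [map_zero]; ring
    simp_rw [h1]
    rw [Finset.sum_sub_distrib, Finset.sum_add_distrib, ← Finset.mul_sum, ← Finset.mul_sum,
      ← hexp, ← hexp, Finset.sum_ite_eq, if_pos (Finset.mem_univ k), hb]
    ring
  -- so, by the adjugate of `M`, `det M` multiplies the forms of degree `d` into `ℂ[f₀, f₁, f₂]`
  have hdet : ∀ j, aeval φ.f M.det * (e j : MvPolynomial (Fin 2) ℂ)
      = aeval φ.f (∑ k, M.adjugate j k * (C (κ k) * z ^ 2)) := by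
    intro j
    rw [map_sum]
    simp_rw [map_mul (aeval φ.f) (M.adjugate j _), ← hMe, Finset.mul_sum]
    rw [Finset.sum_comm]
    have h1 : ∀ l, ∑ k, aeval φ.f (M.adjugate j k) * (aeval φ.f (M k l) *
        (e l : MvPolynomial (Fin 2) ℂ))
        = if j = l then aeval φ.f M.det * (e l : MvPolynomial (Fin 2) ℂ) else 0 := by
      intro l
      have h2 := congrFun (congrFun (Matrix.adjugate_mul M) j) l
      rw [Matrix.mul_apply, Matrix.smul_apply, Matrix.one_apply] at h2
      simp_rw [← mul_assoc, ← map_mul]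
      rw [← Finset.sum_mul, ← map_sum, h2]
      split_ifs <;> simp
    simp_rw [h1]
    rw [Finset.sum_ite_eq, if_pos (Finset.mem_univ j)]
  have hrange : ∀ n (a : MvPolynomial (Fin 2) ℂ), a.IsHomogeneous (d * n) →
      aeval φ.f M.det * a ∈ (aeval φ.f : MvPolynomial (Fin 3) ℂ →ₐ[ℂ] _).range := by
    intro n
    induction n with
    | zero =>
      intro a ha
      obtain ⟨c, rfl⟩ := eq_C_of_isHomogeneous_zero ha
      exact ⟨M.det * C c, by simp [algebraMap_eq]⟩
    | succ n ih =>
      intro a ha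
      rcases n with - | n
      · rw [zero_add, mul_one] at ha
        rw [show a = ∑ j, C (e.repr ⟨a, ha⟩ j) * (e j : MvPolynomial (Fin 2) ℂ) from hexp ⟨a, ha⟩,
          Finset.mul_sum]
        refine Subalgebra.sum_mem _ fun j _ => ?_
        rw [mul_left_comm, hdet]
        exact Subalgebra.mul_mem _ ⟨C _, by simp [algebraMap_eq]; rfl⟩ ⟨_, rfl⟩
      · obtain ⟨κ, c₀, c₁, hc₀, hc₁, heq⟩ :=
          exists_eq_add_of_good hv hd hz hz0 hg₀ hg₁ hx hy hg n ha
        rw [heq, mul_add, mul_add, mul_left_comm, mul_left_comm _ (aeval φ.f y)]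
        exact Subalgebra.add_mem _ (Subalgebra.add_mem _
          (Subalgebra.mul_mem _ ⟨_, rfl⟩ ⟨_, rfl⟩) (Subalgebra.mul_mem _ ⟨_, rfl⟩ (ih _ hc₀)))
          (Subalgebra.mul_mem _ ⟨_, rfl⟩ (ih _ hc₁))
  have hdeth : M.det.IsHomogeneous N := by
    rw [Matrix.det_apply]
    refine Submodule.sum_mem (homogeneousSubmodule _ _ N) fun τ _ => ?_
    rw [Units.smul_def]
    refine zsmul_mem ?_ _
    have : ∀ k l, (M k l).IsHomogeneous 1 := by
      intro k l
      rw [hM]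
      refine IsHomogeneous.sub ?_ ((hxh.C_mul _).add (hyh.C_mul _))
      split_ifs
      · exact hz
      · exact isHomogeneous_zero _ _ _
    simpa using IsHomogeneous.prod Finset.univ (fun i => M (τ i) i) (fun _ => 1)
      fun i _ => this _ _
  refine ⟨N, M.det, hdeth, ?_, fun n a ha =>
    φ.exists_isHomogeneous_of_mem_range hd ?_ (hrange n a ha)⟩
  · -- `x` and `y` vanish at `φ(v)`, where `M` is therefore the scalar matrix `z(φ(v))`
    rw [RingHom.map_det]
    have : (eval (φ.pt v)).mapMatrix M = Matrix.diagonal fun _ => eval (φ.pt v) z := by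
      ext k l
      rw [RingHom.mapMatrix_apply, Matrix.map_apply, hM, Matrix.diagonal_apply]
      simp only [map_sub, map_add, map_mul, hx0, hy0, mul_zero, add_zero, sub_zero]
      split_ifs <;> simp
    rw [this, Matrix.det_diagonal]
    exact Finset.prod_ne_zero_iff.mpr fun _ _ => hz0
  · rw [mul_add]
    exact (φ.aeval_isHomogeneous hdeth).mul ha

end GoodPoints

/-! ### The Hilbert function of the curve -/

section HilbertFunction

variable {d : ℕ}

theorem finrank_map_add_finrank_inf_ker {V W : Type*} [AddCommGroup V] [Module ℂ V]
    [AddCommGroup W] [Module ℂ W] (f : V →ₗ[ℂ] W) (S : Submodule ℂ V) [Module.Finite ℂ S] :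
    Module.finrank ℂ (S.map f) + Module.finrank ℂ (S ⊓ LinearMap.ker f : Submodule ℂ V)
      = Module.finrank ℂ S := by
  have h := LinearMap.finrank_range_add_finrank_ker (f.domRestrict S)
  rw [LinearMap.range_domRestrict, LinearMap.ker_domRestrict,
    ← Submodule.finrank_map_subtype_eq] at h
  have h2 := Submodule.map_comap_subtype S (LinearMap.ker f)
  rw [← h2]
  exact h

/-- The degree `n` part of `ℂ[f₀, f₁, f₂]`, the homogeneous coordinate ring of the curve. -/
def Param.R (φ : Param d) (n : ℕ) : Submodule ℂ (MvPolynomial (Fin 2) ℂ) :=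
  (homogeneousSubmodule (Fin 3) ℂ n).map (aeval φ.f : MvPolynomial (Fin 3) ℂ →ₐ[ℂ] _).toLinearMap

theorem Param.mem_R (φ : Param d) {n : ℕ} {a : MvPolynomial (Fin 2) ℂ} :
    a ∈ φ.R n ↔ ∃ g : MvPolynomial (Fin 3) ℂ, g.IsHomogeneous n ∧ aeval φ.f g = a := Iff.rfl

theorem Param.R_le (φ : Param d) (n : ℕ) : φ.R n ≤ homogeneousSubmodule (Fin 2) ℂ (d * n) := by
  rintro _ ⟨g, hg, rfl⟩
  exact φ.aeval_isHomogeneous hg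

/-- The degree `n` part of the ideal of the curve. -/
def Param.K (φ : Param d) (n : ℕ) : Submodule ℂ (MvPolynomial (Fin 3) ℂ) :=
  homogeneousSubmodule (Fin 3) ℂ n ⊓
    LinearMap.ker (aeval φ.f : MvPolynomial (Fin 3) ℂ →ₐ[ℂ] MvPolynomial (Fin 2) ℂ).toLinearMap

theorem Param.mem_K (φ : Param d) {n : ℕ} {g : MvPolynomial (Fin 3) ℂ} :
    g ∈ φ.K n ↔ g.IsHomogeneous n ∧ aeval φ.f g = 0 := Iff.rfl

theorem Param.finrank_R_add_finrank_K (φ : Param d) (n : ℕ) :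
    Module.finrank ℂ (φ.R n) + Module.finrank ℂ (φ.K n)
      = Module.finrank ℂ (homogeneousSubmodule (Fin 3) ℂ n) :=
  finrank_map_add_finrank_inf_ker _ _

instance (φ : Param d) (n : ℕ) : Module.Finite ℂ (φ.K n) :=
  Submodule.finiteDimensional_of_le inf_le_left

instance (φ : Param d) (n : ℕ) : Module.Finite ℂ (φ.R n) :=
  Submodule.finiteDimensional_of_le (φ.R_le n)

theorem Param.finrank_R_le (φ : Param d) (n : ℕ) : Module.finrank ℂ (φ.R n) ≤ d * n + 1 := by
  rw [← finrank_homogeneousSubmodule_two]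
  exact Submodule.finrank_mono (φ.R_le n)

theorem finrank_map_mulLeft {σ : Type*} {F : MvPolynomial σ ℂ} (hF : F ≠ 0)
    (S : Submodule ℂ (MvPolynomial σ ℂ)) :
    Module.finrank ℂ (S.map (LinearMap.mulLeft ℂ F)) = Module.finrank ℂ S :=
  (Submodule.equivMapOfInjective _ (mul_right_injective₀ hF) S).finrank_eq.symm

theorem Param.le_finrank_R (φ : Param d) {m : ℕ} {H : MvPolynomial (Fin 3) ℂ}
    (hH0 : aeval φ.f H ≠ 0)
    (hcond : ∀ (n : ℕ) (a : MvPolynomial (Fin 2) ℂ), a.IsHomogeneous (d * n) →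
        ∃ g : MvPolynomial (Fin 3) ℂ, g.IsHomogeneous (m + n) ∧ aeval φ.f g = aeval φ.f H * a)
    (n : ℕ) : d * n + 1 ≤ Module.finrank ℂ (φ.R (m + n)) := by
  rw [← finrank_homogeneousSubmodule_two, ← finrank_map_mulLeft hH0]
  refine Submodule.finrank_mono ?_
  rintro _ ⟨a, ha, rfl⟩
  exact hcond n a ha

/-- The ideal of the curve contains a homogeneous prime element. -/
theorem Param.exists_prime_equation (φ : Param d) (hd : d ≠ 0) :
    ∃ (e : ℕ) (F : MvPolynomial (Fin 3) ℂ), F.IsHomogeneous e ∧ Prime F ∧ aeval φ.f F = 0 := by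
  obtain ⟨G, hG, hG0⟩ : ∃ G ∈ φ.K (2 * d), G ≠ 0 := by
    refine Submodule.exists_mem_ne_zero_of_ne_bot fun h => ?_
    have h1 := φ.finrank_R_add_finrank_K (2 * d)
    have h2 := φ.finrank_R_le (2 * d)
    have h3 := two_mul_finrank_homogeneousSubmodule_three (2 * d)
    rw [h, finrank_bot, add_zero] at h1
    rw [← h1] at h3
    have := Nat.pos_of_ne_zero hd
    nlinarith
  obtain ⟨s, hs, hs'⟩ := UniqueFactorizationMonoid.exists_prime_factors G hG0
  obtain ⟨F, hFs, hF0⟩ : ∃ F ∈ s, aeval φ.f F = 0 := by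
    have h1 : aeval φ.f s.prod = 0 := by
      obtain ⟨u, hu⟩ := hs'
      have := hG.2
      rw [← hu] at this
      exact (mul_eq_zero.mp ((map_mul (aeval φ.f) _ _).symm.trans this)).resolve_right
        (u.isUnit.map (aeval φ.f)).ne_zero
    rw [map_multiset_prod, Multiset.prod_eq_zero_iff, Multiset.mem_map] at h1
    exact h1
  obtain ⟨b, rfl⟩ : F ∣ G := (Multiset.dvd_prod hFs).trans hs'.dvd
  obtain ⟨e, he⟩ := exists_isHomogeneous_of_mul hG.1 hG0
  exact ⟨e, F, he, hs F hFs, hF0⟩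

/-- If two coprime forms lie in the ideal of the curve, then its coordinate ring has bounded Hilbert
function. -/
theorem Param.finrank_R_le_of_not_dvd (φ : Param d) {e e' : ℕ} {F G : MvPolynomial (Fin 3) ℂ}
    (hF : F.IsHomogeneous e) (hFp : Prime F) (hF0 : aeval φ.f F = 0)
    (hG : G.IsHomogeneous e') (hG0 : aeval φ.f G = 0) (hFG : ¬ F ∣ G) (N : ℕ) :
    Module.finrank ℂ (φ.R (N + e + e')) ≤ e * e' := by
  let Φ : (homogeneousSubmodule (Fin 3) ℂ (N + e') ×
      homogeneousSubmodule (Fin 3) ℂ (N + e)) →ₗ[ℂ] MvPolynomial (Fin 3) ℂ :=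
    ((LinearMap.mulLeft ℂ F).comp (homogeneousSubmodule (Fin 3) ℂ (N + e')).subtype).coprod
      ((LinearMap.mulLeft ℂ G).comp (homogeneousSubmodule (Fin 3) ℂ (N + e)).subtype)
  have hΦ : ∀ p, Φ p = F * (p.1 : MvPolynomial (Fin 3) ℂ) + G * (p.2 : MvPolynomial (Fin 3) ℂ) :=
    fun p => rfl
  have h1 := LinearMap.finrank_range_add_finrank_ker Φ
  rw [Module.finrank_prod] at h1
  have h2 : LinearMap.range Φ ≤ φ.K (N + e + e') := by
    rintro _ ⟨p, rfl⟩
    rw [hΦ, φ.mem_K]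
    refine ⟨IsHomogeneous.add ?_ ?_, by
      rw [map_add, map_mul, map_mul, hF0, hG0, zero_mul, zero_mul, add_zero]⟩
    · convert hF.mul p.1.2 using 1; ring
    · convert hG.mul p.2.2 using 1; ring
  -- the syzygies of `F` and `G` are the multiples of `(-G, F)`
  have h3 : Module.finrank ℂ (LinearMap.ker Φ)
      ≤ Module.finrank ℂ (homogeneousSubmodule (Fin 3) ℂ N) := by
    let π : LinearMap.ker Φ →ₗ[ℂ] MvPolynomial (Fin 3) ℂ :=
      (homogeneousSubmodule (Fin 3) ℂ (N + e)).subtype.comp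
        ((LinearMap.snd ℂ _ _).comp (LinearMap.ker Φ).subtype)
    have hπ : Function.Injective π := by
      rintro ⟨⟨a, b⟩, hab⟩ ⟨⟨a', b'⟩, hab'⟩ h
      obtain rfl : b = b' := Subtype.ext h
      rw [LinearMap.mem_ker, hΦ] at hab hab'
      obtain rfl : a = a' :=
        Subtype.ext (mul_left_cancel₀ hFp.ne_zero (add_right_cancel (hab.trans hab'.symm)))
      rfl
    have hr : LinearMap.range π
        ≤ (homogeneousSubmodule (Fin 3) ℂ N).map (LinearMap.mulLeft ℂ F) := by
      rintro _ ⟨⟨⟨a, b⟩, hab⟩, rfl⟩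
      rw [LinearMap.mem_ker, hΦ] at hab
      have hdvd : F ∣ (b : MvPolynomial (Fin 3) ℂ) := by
        refine (hFp.dvd_or_dvd (a := G) ?_).resolve_left hFG
        refine ⟨-(a : MvPolynomial (Fin 3) ℂ), ?_⟩
        linear_combination hab
      obtain ⟨c, hc⟩ := hdvd
      refine ⟨c, ?_, hc.symm⟩
      have := isHomogeneous_of_mul_left hF hFp.ne_zero (hc ▸ b.2)
      rwa [Nat.add_sub_cancel] at this
    have := Submodule.finrank_mono hr
    rwa [finrank_map_mulLeft hFp.ne_zero, LinearMap.finrank_range_of_inj hπ] at this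
  have h4 := Submodule.finrank_mono h2
  have h5 := φ.finrank_R_add_finrank_K (N + e + e')
  have t0 := two_mul_finrank_homogeneousSubmodule_three N
  have t1 := two_mul_finrank_homogeneousSubmodule_three (N + e)
  have t2 := two_mul_finrank_homogeneousSubmodule_three (N + e')
  have t3 := two_mul_finrank_homogeneousSubmodule_three (N + e + e')
  nlinarith

/-- The coordinate ring has the Hilbert function of a plane curve of degree `d`.  Its ideal is
principal; the degree of a generator is `d` because the Hilbert function differs from `d n + 1`,
the dimension of the space of forms of degree `d n`, by a bounded amount. -/
theorem Param.finrank_R (φ : Param d) (hd : 3 ≤ d) (hφ : φ.IsGenericallyInjective) :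
    ∃ N, ∀ n, N ≤ n →
      2 * Module.finrank ℂ (φ.R n) + (d - 1) * (d - 2) = 2 * (d * n + 1) := by
  obtain ⟨v, hv, hgood⟩ := φ.exists_isGood (by omega) hφ
  obtain ⟨m, H, -, hH0, hcond⟩ := hgood.exists_conductor hv (by omega)
  have hH0' : aeval φ.f H ≠ 0 := fun h => hH0 (by rw [← φ.eval_aeval, h, map_zero])
  have hlow := φ.le_finrank_R hH0' hcond
  obtain ⟨e, F, hF, hFp, hF0⟩ := φ.exists_prime_equation (by omega)
  -- by the lower bound for `dim R n`, the ideal of the curve is generated by `F`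
  have hdvd : ∀ {e' : ℕ} {G : MvPolynomial (Fin 3) ℂ}, G.IsHomogeneous e' → aeval φ.f G = 0 →
      F ∣ G := by
    intro e' G hG hG0
    by_contra hFG
    have h1 := φ.finrank_R_le_of_not_dvd hF hFp hF0 hG hG0 hFG (m + e * e')
    have h2 := hlow (e * e' + e + e')
    rw [show m + (e * e' + e + e') = m + e * e' + e + e' by ring] at h2
    nlinarith
  have hK : ∀ N, φ.K (e + N) = (homogeneousSubmodule (Fin 3) ℂ N).map (LinearMap.mulLeft ℂ F) := by
    intro N
    apply le_antisymm
    · rintro G ⟨hG, hG0⟩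
      obtain ⟨c, rfl⟩ := hdvd hG hG0
      refine ⟨c, ?_, rfl⟩
      have := isHomogeneous_of_mul_left hF hFp.ne_zero hG
      rwa [Nat.add_sub_cancel_left] at this
    · rintro _ ⟨c, hc, rfl⟩
      rw [φ.mem_K]
      exact ⟨hF.mul hc, by rw [LinearMap.mulLeft_apply, map_mul, hF0, zero_mul]⟩
  have hR : ∀ N, 2 * Module.finrank ℂ (φ.R (e + N)) + (N + 1) * (N + 2)
      = (e + N + 1) * (e + N + 2) := by
    intro N
    have h1 := φ.finrank_R_add_finrank_K (e + N)
    rw [hK, finrank_map_mulLeft hFp.ne_zero] at h1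
    have t0 := two_mul_finrank_homogeneousSubmodule_three N
    have t1 := two_mul_finrank_homogeneousSubmodule_three (e + N)
    linarith
  -- `hR` gives `dim R n = e n + const`, to be compared with `d n + const`
  obtain rfl : e = d := by
    rcases lt_trichotomy e d with h | h | h
    · exfalso
      obtain ⟨k, rfl⟩ := Nat.exists_eq_add_of_lt h
      have h1 := hR (m + (e + m * (e + k + 1)+ e * e + 3 * e))
      have h2 := hlow (e + (e + m * (e + k + 1)+ e * e + 3 * e))
      rw [show m + (e + (e + m * (e + k + 1)+ e * e + 3 * e))
        = e + (m + (e + m * (e + k + 1)+ e * e + 3 * e)) by ring] at h2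
      set q := e + m * (e + k + 1)+ e * e + 3 * e with hq
      nlinarith
    · exact h
    · exfalso
      obtain ⟨k, rfl⟩ := Nat.exists_eq_add_of_lt h
      have h1 := hR (d * (d + k + 1))
      have h2 := φ.finrank_R_le (d + k + 1 + d * (d + k + 1))
      nlinarith
  refine ⟨e, fun n hn => ?_⟩
  obtain ⟨N, rfl⟩ := Nat.exists_eq_add_of_le hn
  obtain ⟨k, rfl⟩ := Nat.exists_eq_add_of_le hd
  have := hR N
  rw [show 3 + k - 1 = k + 2 by omega, show 3 + k - 2 = k + 1 by omega]
  nlinarith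

end HilbertFunction

/-! ### The normalization of a domain inside a larger field -/

section GenericNormalization

variable {O K : Type*} [CommRing O] [IsDomain O] [Field K] [Algebra O K]

/-- The embedding of the fraction field of a domain `O` in a field containing `O`. -/
def fracEmb (hO : Function.Injective (algebraMap O K)) : FractionRing O →ₐ[O] K :=
  IsFractionRing.liftAlgHom (g := Algebra.ofId O K) hO

theorem fracEmb_injective (hO : Function.Injective (algebraMap O K)) :
    Function.Injective (fracEmb hO) :=
  RingHom.injective (fracEmb hO).toRingHom

/-- The embedding of the normalization of a domain `O` in a field containing `O`. -/
def normEmb (hO : Function.Injective (algebraMap O K)) : Normalization O →+* K :=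
  ((fracEmb hO).comp (integralClosure O (FractionRing O)).val).toRingHom

theorem normEmb_apply (hO : Function.Injective (algebraMap O K)) (y : Normalization O) :
    normEmb hO y = fracEmb hO (y : FractionRing O) := rfl

theorem normEmb_injective (hO : Function.Injective (algebraMap O K)) :
    Function.Injective (normEmb hO) :=
  (fracEmb_injective hO).comp Subtype.val_injective

theorem normEmb_algebraMap (hO : Function.Injective (algebraMap O K)) (o : O) :
    normEmb hO (algebraMap O (Normalization O) o) = algebraMap O K o :=
  (fracEmb hO).commutes o

/-- The normalization of `O`, embedded in a field `K` containing `O`, consists of the quotients of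
elements of `O` in `K` that are integral over `O`. -/
theorem exists_normEmb_eq_iff (hO : Function.Injective (algebraMap O K)) (x : K) :
    (∃ y, normEmb hO y = x) ↔ IsIntegral O x ∧
      ∃ p q : O, q ≠ 0 ∧ x * algebraMap O K q = algebraMap O K p := by
  have hne : ∀ {q : O}, q ≠ 0 → algebraMap O K q ≠ 0 := fun h =>
    (map_ne_zero_iff (algebraMap O K) hO).mpr h
  constructor
  · rintro ⟨y, rfl⟩
    rw [normEmb_apply]
    refine ⟨((mem_integralClosure_iff _ _).mp y.2).map _, ?_⟩
    obtain ⟨p, q, hq, hy⟩ := IsFractionRing.div_surjective (A := O) (y : FractionRing O)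
    have hq0 := nonZeroDivisors.ne_zero hq
    refine ⟨p, q, hq0, ?_⟩
    rw [← hy, map_div₀, AlgHom.commutes, AlgHom.commutes]
    exact div_mul_cancel₀ _ (hne hq0)
  · rintro ⟨hint, p, q, hq, hxq⟩
    let y : FractionRing O := algebraMap _ _ p / algebraMap _ _ q
    have hyx : fracEmb hO y = x := by
      rw [map_div₀, AlgHom.commutes, AlgHom.commutes]
      exact (eq_div_of_mul_eq (hne hq) hxq).symm
    have hyint : IsIntegral O y := by
      refine (isIntegral_algHom_iff (fracEmb hO) (fracEmb_injective hO)).mp ?_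
      rw [hyx]; exact hint
    exact ⟨⟨y, hyint⟩, hyx⟩

variable [Algebra ℂ O] [Algebra ℂ K]

/-- The normalization of `O`, realized as a subalgebra of a field containing `O`. -/
def normEquiv (hO : Function.Injective (algebraMap O K)) (N : Subalgebra ℂ K)
    (hN : ∀ x, (∃ y, normEmb hO y = x) ↔ x ∈ N) : Normalization O ≃+* N :=
  RingEquiv.ofBijective ((normEmb hO).codRestrict N fun y => (hN _).mp ⟨y, rfl⟩)
    ⟨fun _ _ h => normEmb_injective hO (congrArg Subtype.val h),
      fun x => by
        obtain ⟨y, hy⟩ := (hN x).mpr x.2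
        exact ⟨y, Subtype.ext hy⟩⟩

/-- The delta invariant can be computed from a copy `N` of the normalization inside a field
containing `O`. -/
theorem deltaInvariant_eq [IsScalarTower ℂ O K] (hO : Function.Injective (algebraMap O K))
    (N : Subalgebra ℂ K) (hN : ∀ x, (∃ y, normEmb hO y = x) ↔ x ∈ N) (S : Submodule ℂ N)
    (hS : ∀ x : N, x ∈ S ↔ ∃ o : O, algebraMap O K o = x) :
    deltaInvariant O = Module.finrank ℂ (N ⧸ S) := by
  let E : Normalization O ≃ₗ[ℂ] N :=
    { normEquiv hO N hN with
      map_smul' := by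
        intro c y
        refine Subtype.ext ?_
        change normEmb hO (c • y) = c • normEmb hO y
        have h1 : c • y = algebraMap O (Normalization O) (algebraMap ℂ O c) * y := by
          rw [← Algebra.smul_def, algebraMap_smul]
        rw [h1, map_mul, normEmb_algebraMap, ← IsScalarTower.algebraMap_apply, Algebra.smul_def] }
  refine (Submodule.Quotient.equiv _ _ E ?_).finrank_eq
  ext x
  rw [Submodule.mem_map, hS]
  constructor
  · rintro ⟨_, ⟨o, rfl⟩, rfl⟩
    exact ⟨o, (normEmb_algebraMap hO o).symm⟩
  · rintro ⟨o, ho⟩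
    exact ⟨_, ⟨o, rfl⟩, Subtype.ext ((normEmb_algebraMap hO o).trans ho)⟩

/-- At a nonsingular point the normalization changes nothing, so the curve is unibranch there. -/
theorem isLocalRing_normalization (O : Type*) [CommRing O] [IsDomain O]
    [IsDiscreteValuationRing O] :
    IsLocalRing (Normalization O) := by
  refine IsLocalRing.of_surjective' (algebraMap O (Normalization O)) ?_
  intro y
  obtain ⟨o, ho⟩ := (IsIntegrallyClosed.isIntegral_iff (R := O)).mp
    ((mem_integralClosure_iff _ _).mp y.2)
  exact ⟨o, Subtype.ext ho⟩

end GenericNormalization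

/-! ### Normalization of the local rings -/

section NormalizationOfLocalRings

variable {d : ℕ}

/-- The field `ℂ(s, t)`. -/
abbrev FF : Type := FractionRing (MvPolynomial (Fin 2) ℂ)

/-- The inclusion of `ℂ[s, t]` in `ℂ(s, t)`. -/
abbrev frac : MvPolynomial (Fin 2) ℂ →+* FF := algebraMap (MvPolynomial (Fin 2) ℂ) FF

theorem frac_injective : Function.Injective frac := IsFractionRing.injective _ _

theorem frac_ne_zero {a : MvPolynomial (Fin 2) ℂ} (h : a ≠ 0) : frac a ≠ 0 :=
  (map_ne_zero_iff frac frac_injective).mpr h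

theorem exists_rep_eq_smul_pt (φ : Param d) {P : ℙ ℂ (Fin 3 → ℂ)} {Q : ℙ ℂ (Fin 2 → ℂ)}
    (hQ : φ.map Q = P) : ∃ a : ℂ, a ≠ 0 ∧ φ.pt Q.rep = a • P.rep := by
  refine exists_smul_of_mk_eq_mk (hp := φ.pt_ne_zero Q.rep_nonzero) (hq := P.rep_nonzero) ?_
  rw [φ.mk_pt_rep, hQ, Projectivization.mk_rep]

theorem Param.eval_rep_ne_zero_iff (φ : Param d) {P : ℙ ℂ (Fin 3 → ℂ)} {Q : ℙ ℂ (Fin 2 → ℂ)}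
    (hQ : φ.map Q = P) {n : ℕ} {h : MvPolynomial (Fin 3) ℂ} (hh : h.IsHomogeneous n) :
    eval Q.rep (aeval φ.f h) ≠ 0 ↔ eval P.rep h ≠ 0 := by
  obtain ⟨a, ha0, ha⟩ := exists_rep_eq_smul_pt φ hQ
  rw [φ.eval_aeval, ha, eval_smul_of_isHomogeneous hh]
  simp [ha0]

theorem Param.aeval_ne_zero (φ : Param d) {P : ℙ ℂ (Fin 3 → ℂ)} (hP : P ∈ φ.curve) {n : ℕ}
    {h : MvPolynomial (Fin 3) ℂ} (hh : h.IsHomogeneous n) (h0 : eval P.rep h ≠ 0) :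
    aeval φ.f h ≠ 0 := by
  obtain ⟨Q, hQ⟩ := hP
  intro h1
  exact (φ.eval_rep_ne_zero_iff hQ hh).mpr h0 (by rw [h1, map_zero])

/-- The ring of quotients `a / h(f₀, f₁, f₂)` of degree `0`, with `a` an arbitrary form in `s, t`
and `h(P) ≠ 0`; it is the normalization of the local ring at `P`. -/
def Param.normRing (φ : Param d) (P : ℙ ℂ (Fin 3 → ℂ)) : Subalgebra ℂ FF where
  carrier := {x | ∃ (n : ℕ) (a : MvPolynomial (Fin 2) ℂ) (h : MvPolynomial (Fin 3) ℂ),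
    a.IsHomogeneous (d * n) ∧ h.IsHomogeneous n ∧ eval P.rep h ≠ 0 ∧
      x * frac (aeval φ.f h) = frac a}
  mul_mem' := by
    rintro x y ⟨n, a, h, ha, hh, h0, hx⟩ ⟨m, a', h', ha', hh', h0', hy⟩
    refine ⟨n + m, a * a', h * h', by rw [mul_add]; exact ha.mul ha', hh.mul hh',
      by simp [h0, h0'], ?_⟩
    simp only [map_mul]
    rw [← hx, ← hy]
    ring
  add_mem' := by
    rintro x y ⟨n, a, h, ha, hh, h0, hx⟩ ⟨m, a', h', ha', hh', h0', hy⟩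
    refine ⟨n + m, a * aeval φ.f h' + aeval φ.f h * a', h * h', ?_, hh.mul hh',
      by simp [h0, h0'], ?_⟩
    · rw [mul_add]
      exact (ha.mul (φ.aeval_isHomogeneous hh')).add ((φ.aeval_isHomogeneous hh).mul ha')
    · simp only [map_mul, map_add]
      rw [← hx, ← hy]
      ring
  algebraMap_mem' c := by
    refine ⟨0, C c, 1, isHomogeneous_C _ _, isHomogeneous_one _ _, by simp, ?_⟩
    simp only [map_one, mul_one]
    exact IsScalarTower.algebraMap_apply ℂ (MvPolynomial (Fin 2) ℂ) _ c

/-- The local ring of `ℙ¹` at a point. -/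
def pointRing (v : Fin 2 → ℂ) : Subring FF where
  carrier := {x | ∃ (n : ℕ) (a b : MvPolynomial (Fin 2) ℂ),
    a.IsHomogeneous n ∧ b.IsHomogeneous n ∧ eval v b ≠ 0 ∧ x * frac b = frac a}
  mul_mem' := by
    rintro x y ⟨n, a, h, ha, hh, h0, hx⟩ ⟨m, a', h', ha', hh', h0', hy⟩
    refine ⟨n + m, a * a', h * h', ha.mul ha', hh.mul hh', by simp [h0, h0'], ?_⟩
    simp only [map_mul]
    rw [← hx, ← hy]
    ring
  add_mem' := by
    rintro x y ⟨n, a, h, ha, hh, h0, hx⟩ ⟨m, a', h', ha', hh', h0', hy⟩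
    refine ⟨n + m, a * h' + h * a', h * h', (ha.mul hh').add (hh.mul ha'), hh.mul hh',
      by simp [h0, h0'], ?_⟩
    simp only [map_mul, map_add]
    rw [← hx, ← hy]
    ring
  zero_mem' := ⟨0, 0, 1, isHomogeneous_zero _ _ _, isHomogeneous_one _ _, by simp, by simp⟩
  one_mem' := ⟨0, 1, 1, isHomogeneous_one _ _, isHomogeneous_one _ _, by simp, by simp⟩
  neg_mem' := by
    rintro x ⟨n, a, h, ha, hh, h0, hx⟩
    exact ⟨n, -a, h, ha.neg, hh, h0, by rw [neg_mul, hx, map_neg]⟩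

/-- A form not vanishing on the fibre of `P` divides a form in `f₀, f₁, f₂` not vanishing at `P`:
each of its linear factors divides a linear form in the `fⱼ`. -/
theorem Param.exists_multiple (φ : Param d) {P : ℙ ℂ (Fin 3 → ℂ)} {n : ℕ}
    {B : MvPolynomial (Fin 2) ℂ} (hB : B.IsHomogeneous n) (hB0 : B ≠ 0)
    (h : ∀ Q, φ.map Q = P → eval Q.rep B ≠ 0) :
    ∃ (c : MvPolynomial (Fin 2) ℂ) (G : MvPolynomial (Fin 3) ℂ), G.IsHomogeneous n ∧
      c.IsHomogeneous (d * n - n) ∧ eval P.rep G ≠ 0 ∧ aeval φ.f G = B * c := by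
  suffices H : ∃ (c : MvPolynomial (Fin 2) ℂ) (G : MvPolynomial (Fin 3) ℂ), G.IsHomogeneous n ∧
      eval P.rep G ≠ 0 ∧ aeval φ.f G = B * c by
    obtain ⟨c, G, hG, hG0, hc⟩ := H
    exact ⟨c, G, hG, isHomogeneous_of_mul_left hB hB0 (hc ▸ φ.aeval_isHomogeneous hG), hG0, hc⟩
  induction n generalizing B with
  | zero =>
    obtain ⟨c, rfl⟩ := eq_C_of_isHomogeneous_zero hB
    have hc : c ≠ 0 := fun h => hB0 (by rw [h, C_0])
    refine ⟨C c⁻¹, 1, isHomogeneous_one _ _, by simp, ?_⟩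
    rw [← C_mul, mul_inv_cancel₀ hc]; simp
  | succ n ih =>
    obtain ⟨v, hv, hv0⟩ := exists_eval_eq_zero hB (Nat.succ_ne_zero n)
    obtain ⟨B', hB', rfl⟩ := exists_eq_lin_mul hB hv hv0
    obtain ⟨c, G, hG, hG0, hc⟩ := ih hB' (right_ne_zero_of_mul hB0)
      fun Q hQ h0 => h Q hQ (by rw [map_mul, h0, mul_zero])
    have hvP : Projectivization.mk ℂ (φ.pt v) (φ.pt_ne_zero hv)
        ≠ Projectivization.mk ℂ P.rep P.rep_nonzero := by
      intro h1
      rw [φ.mk_pt hv, Projectivization.mk_rep] at h1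
      refine h _ h1 ?_
      have : eval (Projectivization.mk ℂ v hv).rep (lin v) = 0 := by
        rw [eval_lin_eq_zero_iff hv (Projectivization.rep_nonzero _), Projectivization.mk_rep]
      rw [map_mul, this, zero_mul]
    obtain ⟨i, j, hij⟩ : ∃ i j, eval P.rep (minorForm (φ.pt v) i j) ≠ 0 := by
      by_contra! h1
      refine hvP (mk_eq_mk_of_minors _ _ fun i j => ?_)
      have := h1 i j
      rw [eval_minorForm] at this
      linear_combination this
    obtain ⟨c', -, hc'⟩ := exists_eq_lin_mul
      (φ.aeval_isHomogeneous (minorForm_isHomogeneous (φ.pt v) i j)) hv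
      (by rw [φ.eval_aeval, eval_minorForm]; ring)
    refine ⟨c' * c, minorForm (φ.pt v) i j * G, ?_, ?_, ?_⟩
    · rw [add_comm]; exact (minorForm_isHomogeneous _ _ _).mul hG
    · rw [map_mul]; exact mul_ne_zero hij hG0
    · rw [map_mul, hc', hc]; ring

/-- A homogeneous fraction of degree `0` without pole on the fibre of `P` lies in the normalization
of the local ring at `P`. -/
theorem Param.mem_normRing_of_no_pole (φ : Param d) (hd : d ≠ 0) {P : ℙ ℂ (Fin 3 → ℂ)} {n : ℕ}
    {A B : MvPolynomial (Fin 2) ℂ} (hA : A.IsHomogeneous n) (hB : B.IsHomogeneous n) (hB0 : B ≠ 0)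
    (h : ∀ Q, φ.map Q = P → eval Q.rep B ≠ 0) {x : FF} (hx : x * frac B = frac A) :
    x ∈ φ.normRing P := by
  obtain ⟨c, G, hG, hc, hG0, hGc⟩ := φ.exists_multiple hB hB0 h
  refine ⟨n, A * c, G, ?_, hG, hG0, ?_⟩
  · have := hA.mul hc
    rwa [Nat.add_sub_cancel' (Nat.le_mul_of_pos_left n (Nat.pos_of_ne_zero hd))] at this
  · rw [hGc, map_mul, map_mul, ← hx]; ring

/-- An element integral over the local ring of `ℙ¹` at `v` is not a fraction with a pole at `v`. -/
theorem eval_ne_zero_of_integral {v : Fin 2 → ℂ} {n : ℕ} {A B : MvPolynomial (Fin 2) ℂ}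
    (hA : A.IsHomogeneous n) (hB : B.IsHomogeneous n) (hAv : eval v A ≠ 0)
    {x : FF} (hx : x * frac B = frac A) {p : Polynomial FF} (hp : p.Monic)
    (hpc : ∀ i, p.coeff i ∈ pointRing v) (hpx : p.eval x = 0) : eval v B ≠ 0 := by
  intro hBv
  have hA0 : A ≠ 0 := fun h => hAv (by rw [h, map_zero])
  have hx0 : x ≠ 0 := fun h => by
    rw [h, zero_mul] at hx
    exact frac_ne_zero hA0 hx.symm
  have hxinv : x⁻¹ * frac A = frac B := by
    rw [← hx, inv_mul_cancel_left₀ hx0]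
  -- divide the equation by the highest power of `x`
  have h1 : p.reverse.eval x⁻¹ = 0 := by
    let := invertibleOfNonzero hx0
    have := Polynomial.eval₂_reverse_mul_pow (RingHom.id FF) x p
    rw [Polynomial.eval₂_id, Polynomial.eval₂_id, hpx, invOf_eq_inv] at this
    exact (mul_eq_zero.mp this).resolve_right (pow_ne_zero _ hx0)
  rw [← Polynomial.divX_mul_X_add p.reverse, Polynomial.coeff_zero_reverse, hp.leadingCoeff,
    Polynomial.eval_add, Polynomial.eval_mul, Polynomial.eval_X, Polynomial.eval_C] at h1
  have h2 : p.reverse.divX.eval x⁻¹ ∈ pointRing v := by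
    rw [Polynomial.eval_eq_sum_range]
    refine Subring.sum_mem _ fun i _ => Subring.mul_mem _ ?_ (Subring.pow_mem _ ?_ _)
    · rw [Polynomial.coeff_divX, Polynomial.coeff_reverse]
      exact hpc _
    · exact ⟨n, B, A, hB, hA, hAv, hxinv⟩
  obtain ⟨m, a, b, -, -, hb0, hab⟩ := h2
  have h3 : frac (a * B + b * A) = 0 := by
    rw [map_add, map_mul, map_mul, ← hab, ← hxinv]
    linear_combination frac A * frac b * h1
  have h4 := congrArg (eval v) ((map_eq_zero_iff frac frac_injective).mp h3)
  rw [map_add, map_mul, map_mul, hBv, mul_zero, zero_add, map_zero] at h4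
  exact mul_ne_zero hb0 hAv h4

theorem Param.localRing_le_pointRing (φ : Param d) {P : ℙ ℂ (Fin 3 → ℂ)} {Q : ℙ ℂ (Fin 2 → ℂ)}
    (hQ : φ.map Q = P) {x : FF} (hx : x ∈ φ.localRing P) : x ∈ pointRing Q.rep := by
  obtain ⟨n, g, h, hg, hh, h0, hx⟩ := hx
  exact ⟨d * n, _, _, φ.aeval_isHomogeneous hg, φ.aeval_isHomogeneous hh,
    (φ.eval_rep_ne_zero_iff hQ hh).mpr h0, hx⟩

/-- A homogeneous fraction of degree `0` that is integral over the local ring at `P` has no pole on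
the fibre of `P`: choose the denominator of least degree. -/
theorem Param.mem_normRing_of_isIntegral (φ : Param d) (hd : d ≠ 0) {P : ℙ ℂ (Fin 3 → ℂ)} {x : FF}
    (hx : IsIntegral (φ.localRing P) x)
    (hfrac : ∃ (n : ℕ) (A B : MvPolynomial (Fin 2) ℂ), A.IsHomogeneous n ∧ B.IsHomogeneous n ∧
      B ≠ 0 ∧ x * frac B = frac A) : x ∈ φ.normRing P := by
  classical
  obtain ⟨A, B, hA, hB, hB0, hAB⟩ := Nat.find_spec hfrac
  refine φ.mem_normRing_of_no_pole hd hA hB hB0 (fun Q hQ hBQ => ?_) hAB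
  by_cases hAQ : eval Q.rep A = 0
  · obtain ⟨A', hA', rfl⟩ := exists_eq_lin_mul hA Q.rep_nonzero hAQ
    obtain ⟨B', hB', rfl⟩ := exists_eq_lin_mul hB Q.rep_nonzero hBQ
    have hpos : Nat.find hfrac ≠ 0 := by
      intro h0
      rw [h0] at hB
      obtain ⟨c, hc⟩ := eq_C_of_isHomogeneous_zero hB
      rw [hc, eval_C] at hBQ
      rw [hc, hBQ, C_0] at hB0
      exact hB0 rfl
    refine Nat.find_min hfrac (Nat.sub_one_lt hpos) ⟨A', B', hA', hB', right_ne_zero_of_mul hB0, ?_⟩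
    rw [map_mul, map_mul, mul_left_comm] at hAB
    exact mul_left_cancel₀ (frac_ne_zero (lin_ne_zero Q.rep_nonzero)) hAB
  · obtain ⟨p, hp, hpx⟩ := hx
    refine eval_ne_zero_of_integral hA hB hAQ hAB (hp.map (algebraMap (φ.localRing P) FF))
      (fun i => ?_) ?_ hBQ
    · rw [Polynomial.coeff_map]
      exact φ.localRing_le_pointRing hQ (p.coeff i).2
    · rw [Polynomial.eval_map]; exact hpx

/-- Forms of degree `d (n + 1)` are combinations of forms of degree `d`, with forms of degree `n` in
the `fⱼ` as coefficients. -/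
theorem Param.exists_eq_sum_basis (φ : Param d) (hd : d ≠ 0) (hφ : φ.IsGenericallyInjective)
    (n : ℕ) {a : MvPolynomial (Fin 2) ℂ} (ha : a.IsHomogeneous (d * (n + 1))) :
    ∃ r : Fin (Module.finrank ℂ (homogeneousSubmodule (Fin 2) ℂ d)) → MvPolynomial (Fin 3) ℂ,
      (∀ k, (r k).IsHomogeneous n) ∧ a = ∑ k, aeval φ.f (r k) *
        (Module.finBasis ℂ (homogeneousSubmodule (Fin 2) ℂ d) k : MvPolynomial (Fin 2) ℂ) := by
  obtain ⟨v, hv, h⟩ := φ.exists_isGood hd hφ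
  obtain ⟨x, y, g₀, g₁, hxh, hyh, hx0, hy0, hg₀, hg₁, hx, hy, hg⟩ := h.exists_pair hv
  obtain ⟨z, hz, hz0⟩ := exists_linear_eval_ne_zero (φ.pt_ne_zero hv)
  let e := Module.finBasis ℂ (homogeneousSubmodule (Fin 2) ℂ d)
  have hexp : ∀ b : homogeneousSubmodule (Fin 2) ℂ d, (b : MvPolynomial (Fin 2) ℂ)
      = ∑ j, C (e.repr b j) * (e j : MvPolynomial (Fin 2) ℂ) := by
    intro b
    have := congrArg (Submodule.subtype _) (e.sum_repr b)
    simp only [map_sum, map_smul, Submodule.subtype_apply, smul_eq_C_mul] at this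
    exact this.symm
  induction n generalizing a with
  | zero =>
    rw [zero_add, mul_one] at ha
    refine ⟨fun k => C (e.repr ⟨a, ha⟩ k), fun k => isHomogeneous_C _ _, ?_⟩
    refine (hexp ⟨a, ha⟩).trans (Finset.sum_congr rfl fun k _ => ?_)
    rw [aeval_C]; rfl
  | succ n ih =>
    obtain ⟨κ, b₀, b₁, hb₀, hb₁, heq⟩ := exists_eq_add_of_good hv hd hz hz0 hg₀ hg₁ hx hy hg n ha
    obtain ⟨r₀, hr₀, hr₀'⟩ := ih hb₀
    obtain ⟨r₁, hr₁, hr₁'⟩ := ih hb₁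
    have hzf : (aeval φ.f z).IsHomogeneous d := by simpa using φ.aeval_isHomogeneous hz
    obtain ⟨q, hq⟩ : ∃ q : _ → ℂ, aeval φ.f z = ∑ j, C (q j) * (e j : MvPolynomial (Fin 2) ℂ) :=
      ⟨_, hexp ⟨aeval φ.f z, hzf⟩⟩
    refine ⟨fun k => z ^ (n + 1) * C (κ * q k) + x * r₀ k + y * r₁ k,
      fun k => IsHomogeneous.add (IsHomogeneous.add ?_ ?_) ?_, ?_⟩
    · simpa using (hz.pow (n + 1)).mul (isHomogeneous_C (Fin 3) (κ * q k))
    · rw [add_comm n]; exact hxh.mul (hr₀ k)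
    · rw [add_comm n]; exact hyh.mul (hr₁ k)
    · rw [heq, hr₀', hr₁']
      have h1 : aeval φ.f (C κ * z ^ (n + 2)) = ∑ k, aeval φ.f
          (z ^ (n + 1) * C (κ * q k)) * (e k : MvPolynomial (Fin 2) ℂ) := by
        rw [pow_succ, map_mul, map_mul, hq, Finset.mul_sum, Finset.mul_sum]
        refine Finset.sum_congr rfl fun k _ => ?_
        rw [map_mul, aeval_C, aeval_C, algebraMap_eq, C_mul]
        ring
      rw [h1, Finset.mul_sum, Finset.mul_sum, ← Finset.sum_add_distrib, ← Finset.sum_add_distrib]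
      refine Finset.sum_congr rfl fun k _ => ?_
      rw [map_add, map_add, map_mul _ x, map_mul _ y]
      ring

/-- Elements of the normalization are integral over the local ring: they preserve the finite module
generated by the forms of degree `d`. -/
theorem Param.isIntegral_of_mem_normRing (φ : Param d) (hd : d ≠ 0)
    (hφ : φ.IsGenericallyInjective) {P : ℙ ℂ (Fin 3 → ℂ)} (hP : P ∈ φ.curve) {x : FF}
    (hx : x ∈ φ.normRing P) : IsIntegral (φ.localRing P) x := by
  obtain ⟨n, a, h, ha, hh, h0, hxh⟩ := hx
  have hfh := frac_ne_zero (φ.aeval_ne_zero hP hh h0)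
  let e := Module.finBasis ℂ (homogeneousSubmodule (Fin 2) ℂ d)
  let w : Fin (Module.finrank ℂ (homogeneousSubmodule (Fin 2) ℂ d)) → FF := fun k => frac (e k)
  refine isIntegral_of_smul_mem_submodule (Submodule.span (φ.localRing P) (Set.range w)) ?_
    (Submodule.fg_span (Set.finite_range w)) x fun y hy => ?_
  · have hpos : 0 < Module.finrank ℂ (homogeneousSubmodule (Fin 2) ℂ d) := by
      rw [finrank_homogeneousSubmodule_two]; omega
    intro h
    have h1 : w ⟨0, hpos⟩ ∈ Submodule.span (φ.localRing P) (Set.range w) :=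
      Submodule.subset_span ⟨_, rfl⟩
    rw [h, Submodule.mem_bot] at h1
    have h2 := (map_eq_zero_iff frac frac_injective).mp h1
    exact e.ne_zero ⟨0, hpos⟩ (Subtype.ext h2)
  · induction hy using Submodule.span_induction with
    | mem y hy =>
      obtain ⟨k, rfl⟩ := hy
      have hak : (a * (e k : MvPolynomial (Fin 2) ℂ)).IsHomogeneous (d * (n + 1)) := by
        rw [mul_add, mul_one]; exact ha.mul (e k).2
      obtain ⟨r, hr, hreq⟩ := φ.exists_eq_sum_basis hd hφ n hak
      have h1 : x • w k = ∑ l, (frac (aeval φ.f (r l)) / frac (aeval φ.f h)) * w l := by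
        rw [smul_eq_mul, eq_div_of_mul_eq hfh hxh, div_mul_eq_mul_div, ← map_mul, hreq, map_sum,
          Finset.sum_div]
        refine Finset.sum_congr rfl fun l _ => ?_
        rw [map_mul, div_mul_eq_mul_div]
      rw [h1]
      refine Submodule.sum_mem _ fun l _ => ?_
      have h2 : frac (aeval φ.f (r l)) / frac (aeval φ.f h) ∈ φ.localRing P :=
        ⟨n, r l, h, hr l, hh, h0, div_mul_cancel₀ _ hfh⟩
      exact Submodule.smul_mem _ (⟨_, h2⟩ : φ.localRing P) (Submodule.subset_span ⟨l, rfl⟩)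
    | zero => rw [smul_zero]; exact Submodule.zero_mem _
    | add y z _ _ hy hz => rw [smul_add]; exact Submodule.add_mem _ hy hz
    | smul r y _ hy => rw [smul_comm]; exact Submodule.smul_mem _ r hy

/-- Elements of the normalization are quotients of elements of the local ring. -/
theorem Param.exists_eq_div_of_mem_normRing (φ : Param d) (hd : d ≠ 0)
    (hφ : φ.IsGenericallyInjective) {P : ℙ ℂ (Fin 3 → ℂ)} (hP : P ∈ φ.curve) {x : FF}
    (hx : x ∈ φ.normRing P) : ∃ p q : φ.localRing P, (q : FF) ≠ 0 ∧ x * (q : FF) = p := by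
  obtain ⟨n, a, h, ha, hh, h0, hxh⟩ := hx
  obtain ⟨v, hv, hgood⟩ := φ.exists_isGood hd hφ
  obtain ⟨m, H, hH, hH0, hcond⟩ := hgood.exists_conductor hv hd
  obtain ⟨z, hz, hz0⟩ := exists_linear_eval_ne_zero P.rep_nonzero
  obtain ⟨g, hg, hgeq⟩ := hcond n a ha
  have hfh := frac_ne_zero (φ.aeval_ne_zero hP hh h0)
  have hfH : frac (aeval φ.f H) ≠ 0 :=
    frac_ne_zero fun h => hH0 (by rw [← φ.eval_aeval, h, map_zero])
  have hzp : (z ^ (m + n)).IsHomogeneous (m + n) := by simpa using hz.pow (m + n)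
  have hzp0 : eval P.rep (z ^ (m + n)) ≠ 0 := by rw [map_pow]; exact pow_ne_zero _ hz0
  have hfz := frac_ne_zero (φ.aeval_ne_zero hP hzp hzp0)
  refine ⟨⟨frac (aeval φ.f g) / frac (aeval φ.f (z ^ (m + n))),
      m + n, g, z ^ (m + n), hg, hzp, hzp0, div_mul_cancel₀ _ hfz⟩,
    ⟨frac (aeval φ.f (H * h)) / frac (aeval φ.f (z ^ (m + n))),
      m + n, H * h, z ^ (m + n), hH.mul hh, hzp, hzp0, div_mul_cancel₀ _ hfz⟩, ?_, ?_⟩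
  · refine div_ne_zero ?_ hfz
    rw [map_mul, map_mul]; exact mul_ne_zero hfH hfh
  · dsimp only
    rw [mul_div_assoc', hgeq, map_mul, map_mul, map_mul, ← hxh]
    ring_nf

theorem Param.algebraMap_localRing_injective (φ : Param d) (P : ℙ ℂ (Fin 3 → ℂ)) :
    Function.Injective (algebraMap (φ.localRing P) FF) := Subtype.val_injective

/-- The normalization of the local ring at `P` consists of the homogeneous fractions of degree `0`
without pole on the fibre of `P`. -/
theorem Param.exists_normEmb_eq_iff_mem_normRing (φ : Param d) (hd : d ≠ 0)
    (hφ : φ.IsGenericallyInjective) {P : ℙ ℂ (Fin 3 → ℂ)} (hP : P ∈ φ.curve) (x : FF) :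
    (∃ y, normEmb (φ.algebraMap_localRing_injective P) y = x) ↔ x ∈ φ.normRing P := by
  rw [exists_normEmb_eq_iff]
  constructor
  · rintro ⟨hint, p, q, hq, hxq⟩
    have hq0 : (q : FF) ≠ 0 := fun h => hq (Subtype.ext h)
    refine φ.mem_normRing_of_isIntegral hd hint ?_
    obtain ⟨n, g, h, hg, hh, h0, hp'⟩ := p.2
    obtain ⟨n', g', h', hg', hh', h0', hq'⟩ := q.2
    have hfh := φ.aeval_ne_zero hP hh h0
    have hfh' := φ.aeval_ne_zero hP hh' h0'
    have hg'0 : aeval φ.f g' ≠ 0 := fun h1 => by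
      rw [h1, map_zero, mul_eq_zero] at hq'
      exact hq'.elim hq0 (frac_ne_zero hfh')
    refine ⟨d * (n + n'), aeval φ.f (g * h'), aeval φ.f (h * g'),
      φ.aeval_isHomogeneous (hg.mul hh'), φ.aeval_isHomogeneous (hh.mul hg'), ?_, ?_⟩
    · rw [map_mul]; exact mul_ne_zero hfh hg'0
    · simp only [map_mul]
      rw [← hp', ← hq']
      have hxq' : x * (q : FF) = p := hxq
      rw [← hxq']; ring
  · intro hx
    obtain ⟨p, q, hq, hxq⟩ := φ.exists_eq_div_of_mem_normRing hd hφ hP hx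
    exact ⟨φ.isIntegral_of_mem_normRing hd hφ hP hx, p, q, fun h => hq (by rw [h]; rfl), hxq⟩

/-- The local ring, as a subspace of its normalization. -/
def Param.localSub (φ : Param d) (P : ℙ ℂ (Fin 3 → ℂ)) : Submodule ℂ (φ.normRing P) :=
  (Subalgebra.toSubmodule (φ.localRing P)).comap (φ.normRing P).val.toLinearMap

theorem Param.mem_localSub (φ : Param d) {P : ℙ ℂ (Fin 3 → ℂ)} {x : φ.normRing P} :
    x ∈ φ.localSub P ↔ (x : FF) ∈ φ.localRing P := Iff.rfl

theorem Param.deltaAt_eq (φ : Param d) (hd : d ≠ 0) (hφ : φ.IsGenericallyInjective)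
    {P : ℙ ℂ (Fin 3 → ℂ)} (hP : P ∈ φ.curve) :
    φ.deltaAt P = Module.finrank ℂ (φ.normRing P ⧸ φ.localSub P) :=
  deltaInvariant_eq _ _ (φ.exists_normEmb_eq_iff_mem_normRing hd hφ hP) (φ.localSub P) fun x =>
    ⟨fun h => ⟨⟨x, h⟩, rfl⟩, fun ⟨o, ho⟩ => (φ.mem_localSub).mpr (ho ▸ o.2)⟩

/-- The curve is unibranch at `P` if and only if `P` has only one preimage. -/
theorem Param.isUnibranchAt_iff (φ : Param d) (hd : d ≠ 0) (hφ : φ.IsGenericallyInjective)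
    {P : ℙ ℂ (Fin 3 → ℂ)} (hP : P ∈ φ.curve) :
    φ.IsUnibranchAt P ↔ ∀ Q Q', φ.map Q = P → φ.map Q' = P → Q = Q' := by
  have e := normEquiv _ _ (φ.exists_normEmb_eq_iff_mem_normRing hd hφ hP)
  have hiff : φ.IsUnibranchAt P ↔ IsLocalRing (φ.normRing P) :=
    ⟨fun h => by
      have : IsLocalRing (Normalization (φ.localRing P)) := h
      exact e.isLocalRing, fun _ => by
      have : IsLocalRing (Normalization (φ.localRing P)) := e.symm.isLocalRing
      exact this⟩
  rw [hiff]
  -- a unit of the normalization has no zero on the fibre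
  have hunit : ∀ (Q : ℙ ℂ (Fin 2 → ℂ)), φ.map Q = P → ∀ (x : φ.normRing P) (n : ℕ)
      (a : MvPolynomial (Fin 2) ℂ) (h : MvPolynomial (Fin 3) ℂ), h.IsHomogeneous n →
      eval P.rep h ≠ 0 → (x : FF) * frac (aeval φ.f h) = frac a → IsUnit x →
      eval Q.rep a ≠ 0 := by
    intro Q hQ x n a h hh h0 hx hu haQ
    obtain ⟨y, hxy⟩ := hu.exists_right_inv
    obtain ⟨n', a', h', -, hh', h0', hy⟩ := y.2
    have hxy' : (x : FF) * (y : FF) = 1 := congrArg Subtype.val hxy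
    have h1 : frac (a * a') = frac (aeval φ.f h * aeval φ.f h') := by
      rw [map_mul, map_mul, ← hx, ← hy]
      linear_combination frac (aeval φ.f h) * frac (aeval φ.f h') * hxy'
    have h2 := congrArg (eval Q.rep) (frac_injective h1)
    rw [map_mul, haQ, zero_mul, map_mul] at h2
    exact mul_ne_zero ((φ.eval_rep_ne_zero_iff hQ hh).mpr h0)
      ((φ.eval_rep_ne_zero_iff hQ hh').mpr h0') h2.symm
  constructor
  · intro hloc Q Q' hQ hQ'
    by_contra hne
    -- a function with value `0` at `Q` and `1` at `Q'`
    obtain ⟨z, hz, hz0⟩ := exists_linear_eval_ne_zero P.rep_nonzero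
    have hzh : (aeval φ.f z).IsHomogeneous d := by simpa using φ.aeval_isHomogeneous hz
    have hl : eval Q'.rep (lin Q.rep) ≠ 0 := by
      rw [Ne, eval_lin_eq_zero_iff Q.rep_nonzero Q'.rep_nonzero, Projectivization.mk_rep,
        Projectivization.mk_rep]
      exact hne
    set c := eval Q'.rep (aeval φ.f z) / eval Q'.rep (lin Q.rep) ^ d
    have hah : (C c * lin Q.rep ^ d).IsHomogeneous d := by
      simpa using ((lin_isHomogeneous Q.rep).pow d).C_mul c
    have hfz := frac_ne_zero (φ.aeval_ne_zero hP hz hz0)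
    let x : φ.normRing P := ⟨frac (C c * lin Q.rep ^ d) / frac (aeval φ.f z),
      1, _, z, by rwa [mul_one], hz, hz0, div_mul_cancel₀ _ hfz⟩
    rcases IsLocalRing.isUnit_or_isUnit_one_sub_self x with hu | hu
    · refine hunit Q hQ x 1 _ z hz hz0 (div_mul_cancel₀ _ hfz) hu ?_
      rw [map_mul, map_pow, eval_lin_self, zero_pow hd, mul_zero]
    · refine hunit Q' hQ' (1 - x) 1 (aeval φ.f z - C c * lin Q.rep ^ d) z hz hz0 ?_ hu ?_
      · change (1 - frac (C c * lin Q.rep ^ d) / frac (aeval φ.f z)) * _ = _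
        rw [sub_mul, one_mul, div_mul_cancel₀ _ hfz, map_sub]
      · rw [map_sub, map_mul, map_pow, eval_C, div_mul_cancel₀ _ (pow_ne_zero _ hl), sub_self]
  · intro huniq
    obtain ⟨Q, hQ⟩ := hP
    have hP : P ∈ φ.curve := ⟨Q, hQ⟩
    have hu : ∀ (x : φ.normRing P) (n : ℕ) (a : MvPolynomial (Fin 2) ℂ)
        (h : MvPolynomial (Fin 3) ℂ), a.IsHomogeneous (d * n) → h.IsHomogeneous n →
        eval P.rep h ≠ 0 → (x : FF) * frac (aeval φ.f h) = frac a → eval Q.rep a ≠ 0 →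
        IsUnit x := by
      intro x n a h ha hh h0 hx haQ
      have ha0 : a ≠ 0 := fun h => haQ (by rw [h, map_zero])
      have hfh := frac_ne_zero (φ.aeval_ne_zero hP hh h0)
      have hfa := frac_ne_zero ha0
      have hinv : frac (aeval φ.f h) / frac a ∈ φ.normRing P :=
        φ.mem_normRing_of_no_pole hd (φ.aeval_isHomogeneous hh) ha ha0
          (fun Q' hQ' => by rwa [huniq Q' Q hQ' hQ]) (div_mul_cancel₀ _ hfa)
      refine IsUnit.of_mul_eq_one ⟨_, hinv⟩ (Subtype.ext ?_)
      change (x : FF) * (frac (aeval φ.f h) / frac a) = 1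
      rw [mul_div_assoc', hx, div_self hfa]
    refine IsLocalRing.of_isUnit_or_isUnit_one_sub_self fun x => ?_
    obtain ⟨n, a, h, ha, hh, h0, hx⟩ := x.2
    by_cases haQ : eval Q.rep a = 0
    · right
      refine hu (1 - x) n (aeval φ.f h - a) h ((φ.aeval_isHomogeneous hh).sub ha) hh h0 ?_ ?_
      · change (1 - (x : FF)) * _ = _
        rw [sub_mul, one_mul, hx, map_sub]
      · rw [map_sub, haQ, sub_zero]
        exact (φ.eval_rep_ne_zero_iff hQ hh).mpr h0
    · exact Or.inl (hu x n a h ha hh h0 hx haQ)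

/-- The curve is cuspidal if and only if the parametrization is injective. -/
theorem Param.isCuspidal_iff (φ : Param d) (hd : d ≠ 0) (hφ : φ.IsGenericallyInjective) :
    φ.IsCuspidal ↔ Function.Injective φ.map := by
  constructor
  · intro h Q Q' hQQ'
    have hP : φ.map Q' ∈ φ.curve := ⟨Q', rfl⟩
    refine (φ.isUnibranchAt_iff hd hφ hP).mp ?_ Q Q' hQQ' rfl
    by_cases hs : IsDiscreteValuationRing (φ.localRing (φ.map Q'))
    · exact isLocalRing_normalization _
    · exact h _ ⟨hP, hs⟩
  · intro h P hP
    exact (φ.isUnibranchAt_iff hd hφ hP.1).mpr fun Q Q' hQ hQ' => h (hQ.trans hQ'.symm)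

end NormalizationOfLocalRings

/-! ### The total delta invariant -/

section Delta

variable {d : ℕ}

theorem Param.eval_ne_zero_iff (φ : Param d) {P : ℙ ℂ (Fin 3 → ℂ)} {w : Fin 2 → ℂ} (hw : w ≠ 0)
    (hP : φ.map (Projectivization.mk ℂ w hw) = P) {n : ℕ} {h : MvPolynomial (Fin 3) ℂ}
    (hh : h.IsHomogeneous n) : eval w (aeval φ.f h) ≠ 0 ↔ eval P.rep h ≠ 0 := by
  have h1 : Projectivization.mk ℂ (φ.pt w) (φ.pt_ne_zero hw)
      = Projectivization.mk ℂ P.rep P.rep_nonzero := by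
    rw [φ.mk_pt hw, hP, Projectivization.mk_rep]
  obtain ⟨a, ha0, ha⟩ := exists_smul_of_mk_eq_mk h1
  rw [φ.eval_aeval, ha, eval_smul_of_isHomogeneous hh]
  simp [ha0]

/-- A nonzero form in `f₀, f₁, f₂` that multiplies every form in `s, t` of degree divisible by `d`
into the homogeneous coordinate ring `ℂ[f₀, f₁, f₂]` of the curve. -/
structure Param.IsConductor (φ : Param d) (m : ℕ) (H : MvPolynomial (Fin 3) ℂ) : Prop where
  isHomogeneous : H.IsHomogeneous m
  ne_zero : aeval φ.f H ≠ 0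
  mul_mem : ∀ (n : ℕ) (a : MvPolynomial (Fin 2) ℂ), a.IsHomogeneous (d * n) →
    aeval φ.f H * a ∈ φ.R (m + n)

theorem Param.exists_isConductor (φ : Param d) (hd : d ≠ 0) (hφ : φ.IsGenericallyInjective) :
    ∃ m H, φ.IsConductor m H := by
  obtain ⟨v, hv, hgood⟩ := φ.exists_isGood hd hφ
  obtain ⟨m, H, hH, hH0, hcond⟩ := hgood.exists_conductor hv hd
  exact ⟨m, H, hH, fun h => hH0 (by rw [← φ.eval_aeval, h, map_zero]), hcond⟩

/-- A homogeneous fraction lies in the local ring at `P` if a form not vanishing at `P` multiplies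
its numerator into the coordinate ring. -/
theorem Param.mem_localRing_of_mul_mem (φ : Param d) {P : ℙ ℂ (Fin 3 → ℂ)} {x : FF} {n k l : ℕ}
    {a : MvPolynomial (Fin 2) ℂ} {h h' : MvPolynomial (Fin 3) ℂ} (hh : h.IsHomogeneous n)
    (h0 : eval P.rep h ≠ 0) (hx : x * frac (aeval φ.f h) = frac a) (hh' : h'.IsHomogeneous k)
    (h0' : eval P.rep h' ≠ 0) (hmem : aeval φ.f h' * a ∈ φ.R l) (hl : l = k + n) :
    x ∈ φ.localRing P := by
  obtain ⟨g, hg, hgeq⟩ := φ.mem_R.mp hmem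
  refine ⟨k + n, g, h' * h, hl ▸ hg, hh'.mul hh, by rw [map_mul]; exact mul_ne_zero h0' h0, ?_⟩
  rw [hgeq, map_mul, map_mul, map_mul, ← hx]; ring

theorem Param.IsConductor.normRing_le {φ : Param d} {m : ℕ} {H : MvPolynomial (Fin 3) ℂ}
    (hH : φ.IsConductor m H) {P : ℙ ℂ (Fin 3 → ℂ)} (h0 : eval P.rep H ≠ 0) :
    φ.normRing P ≤ φ.localRing P := by
  rintro x ⟨n, a, h, ha, hh, hh0, hx⟩
  exact φ.mem_localRing_of_mul_mem hh hh0 hx hH.isHomogeneous h0 (hH.mul_mem n a ha) rfl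

theorem Param.IsConductor.deltaAt_eq_zero {φ : Param d} {m : ℕ} {H : MvPolynomial (Fin 3) ℂ}
    (hH : φ.IsConductor m H) (hd : d ≠ 0) (hφ : φ.IsGenericallyInjective)
    {P : ℙ ℂ (Fin 3 → ℂ)} (hP : P ∈ φ.curve) (h0 : eval P.rep H ≠ 0) : φ.deltaAt P = 0 := by
  rw [φ.deltaAt_eq hd hφ hP]
  have : φ.localSub P = ⊤ := by
    rw [eq_top_iff]
    intro x _
    exact hH.normRing_le h0 x.2
  rw [this]
  exact Module.finrank_zero_of_subsingleton

theorem Param.finite_conductor_zeros (φ : Param d) {m : ℕ} {H : MvPolynomial (Fin 3) ℂ}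
    (hH : φ.IsConductor m H) : {P ∈ φ.curve | eval P.rep H = 0}.Finite := by
  refine ((finite_zeros (φ.aeval_isHomogeneous hH.isHomogeneous) hH.ne_zero).image φ.map).subset ?_
  rintro _ ⟨⟨Q, rfl⟩, h0⟩
  refine ⟨Q, ?_, rfl⟩
  by_contra hne
  exact (φ.eval_rep_ne_zero_iff rfl hH.isHomogeneous).mp hne h0

/-- A high power of a form vanishing at all points of the curve where `H` vanishes multiplies the
forms in `s, t` of degree divisible by `d` into the coordinate ring. -/
theorem Param.IsConductor.pow_mul_mem {φ : Param d} {m : ℕ} {H : MvPolynomial (Fin 3) ℂ}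
    (hH : φ.IsConductor m H) (hd : d ≠ 0) {k : ℕ} {B : MvPolynomial (Fin 3) ℂ}
    (hB : B.IsHomogeneous k) (h : ∀ P ∈ φ.curve, eval P.rep H = 0 → eval P.rep B = 0) {n : ℕ}
    {a : MvPolynomial (Fin 2) ℂ} (ha : a.IsHomogeneous (d * n)) :
    aeval φ.f (B ^ (d * m + 1)) * a ∈ φ.R (k * (d * m + 1) + n) := by
  have hBp := hB.pow (d * m + 1)
  obtain ⟨σ, hσ⟩ : aeval φ.f H ∣ aeval φ.f (B ^ (d * m + 1)) := by
    rw [map_pow, pow_succ]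
    refine Dvd.dvd.mul_right (dvd_pow_of_zeros (φ.aeval_isHomogeneous hH.isHomogeneous) hH.ne_zero
      (φ.aeval_isHomogeneous hB) fun w hw hw0 => ?_) _
    by_contra hne
    have h1 := (φ.eval_ne_zero_iff hw rfl hB).mp hne
    refine h1 (h _ ⟨_, rfl⟩ ?_)
    by_contra h2
    exact (φ.eval_ne_zero_iff hw rfl hH.isHomogeneous).mpr h2 hw0
  have hσh : σ.IsHomogeneous (d * (k * (d * m + 1) - m)) := by
    have := isHomogeneous_of_mul_left (φ.aeval_isHomogeneous hH.isHomogeneous) hH.ne_zero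
      (hσ ▸ φ.aeval_isHomogeneous hBp)
    rwa [← Nat.mul_sub] at this
  refine φ.exists_isHomogeneous_of_mem_range hd ?_ ?_
  · rw [mul_add]; exact (φ.aeval_isHomogeneous hBp).mul ha
  · obtain ⟨g, -, hg⟩ := hH.mul_mem (k * (d * m + 1) - m + n) (σ * a)
      (by rw [mul_add]; exact hσh.mul ha)
    refine ⟨g, ?_⟩
    rw [hσ, mul_assoc]; exact hg

/-- A linear form that does not vanish at any point of a finite set. -/
theorem exists_linear_forall_ne_zero (Z : Finset (ℙ ℂ (Fin 3 → ℂ))) :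
    ∃ z : MvPolynomial (Fin 3) ℂ, z.IsHomogeneous 1 ∧ ∀ P ∈ Z, eval P.rep z ≠ 0 := by
  let p : ℙ ℂ (Fin 3 → ℂ) → Polynomial ℂ := fun P => Polynomial.C (P.rep 0)
    + Polynomial.C (P.rep 1) * Polynomial.X + Polynomial.C (P.rep 2) * Polynomial.X ^ 2
  have hp : ∀ P, p P ≠ 0 := by
    intro P h
    refine P.rep_nonzero (funext fun i => ?_)
    have h0 := congrArg (Polynomial.coeff · 0) h
    have h1 := congrArg (Polynomial.coeff · 1) h
    have h2 := congrArg (Polynomial.coeff · 2) h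
    simp [p, Polynomial.coeff_X, Polynomial.coeff_X_pow] at h0 h1 h2
    fin_cases i <;> simp [h0, h1, h2]
  have hprod : ∏ P ∈ Z, p P ≠ 0 := Finset.prod_ne_zero_iff.mpr fun P _ => hp P
  obtain ⟨x, hx⟩ : ∃ x, (∏ P ∈ Z, p P).eval x ≠ 0 := by
    by_contra! h
    exact hprod (Polynomial.funext fun x => by rw [h, Polynomial.eval_zero])
  rw [Polynomial.eval_prod, Finset.prod_ne_zero_iff] at hx
  refine ⟨lform ![1, x, x ^ 2], lform_isHomogeneous _, fun P hP => ?_⟩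
  have := hx P hP
  rw [eval_lform, Fin.sum_univ_three]
  simp [p] at this ⊢
  intro h
  exact this (by linear_combination h)

/-- A linear form vanishing at one of two distinct points but not at the other. -/
theorem exists_linear_separating {P P' : ℙ ℂ (Fin 3 → ℂ)} (h : P ≠ P') :
    ∃ z : MvPolynomial (Fin 3) ℂ, z.IsHomogeneous 1 ∧ eval P.rep z = 0 ∧ eval P'.rep z ≠ 0 := by
  obtain ⟨i, j, hij⟩ : ∃ i j, eval P'.rep (minorForm P.rep i j) ≠ 0 := by
    by_contra! h1
    refine h ?_
    rw [← P.mk_rep, ← P'.mk_rep]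
    refine mk_eq_mk_of_minors _ _ fun i j => ?_
    have := h1 i j
    rw [eval_minorForm] at this
    linear_combination this
  exact ⟨_, minorForm_isHomogeneous _ _ _, by rw [eval_minorForm]; ring, hij⟩

/-- A form of degree `d n` that belongs to the coordinate ring locally at all zeros of `H` belongs
to it after multiplication by a power of the linear form `z`. -/
theorem Param.IsConductor.exists_pow_mul_mem {φ : Param d} {m : ℕ} {H : MvPolynomial (Fin 3) ℂ}
    (hH : φ.IsConductor m H) (hd : d ≠ 0) {Z : Finset (ℙ ℂ (Fin 3 → ℂ))}
    (hZ : ∀ P ∈ φ.curve, eval P.rep H = 0 → P ∈ Z) {z : MvPolynomial (Fin 3) ℂ}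
    (hz : z.IsHomogeneous 1) {n : ℕ} {a : MvPolynomial (Fin 2) ℂ}
    (ha : a.IsHomogeneous (d * n))
    (hloc : ∀ P ∈ Z, ∃ (k : ℕ) (h : MvPolynomial (Fin 3) ℂ), h.IsHomogeneous k ∧
      eval P.rep h ≠ 0 ∧ aeval φ.f h * a ∈ φ.R (k + n)) :
    ∃ N, aeval φ.f (z ^ N) * a ∈ φ.R (N + n) := by
  classical
  choose! k h hh h0 hmem using hloc
  let 𝔞 : Ideal (MvPolynomial (Fin 3) ℂ) :=
    { carrier := {g | aeval φ.f g * a ∈ (aeval φ.f : MvPolynomial (Fin 3) ℂ →ₐ[ℂ] _).range}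
      add_mem' := fun {x y} hx hy => by
        rw [Set.mem_ofPred_eq, map_add, add_mul]; exact Subalgebra.add_mem _ hx hy
      zero_mem' := by rw [Set.mem_ofPred_eq, map_zero, zero_mul]; exact Subalgebra.zero_mem _
      smul_mem' := fun c x hx => by
        rw [Set.mem_ofPred_eq, smul_eq_mul, map_mul, mul_assoc]
        exact Subalgebra.mul_mem _ ⟨c, rfl⟩ hx }
  have h𝔞 : ∀ g, g ∈ 𝔞 ↔
      aeval φ.f g * a ∈ (aeval φ.f : MvPolynomial (Fin 3) ℂ →ₐ[ℂ] _).range := fun _ => Iff.rfl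
  -- `B P` vanishes at `P`, and is a multiple of a power of `z` modulo the annihilator of `a`
  let B : ℙ ℂ (Fin 3 → ℂ) → MvPolynomial (Fin 3) ℂ := fun P =>
    C (eval P.rep (h P)) * z ^ k P - C (eval P.rep z ^ k P) * h P
  have hBh : ∀ P ∈ Z, (B P).IsHomogeneous (k P) := by
    intro P hP
    refine IsHomogeneous.sub ?_ ((hh P hP).C_mul _)
    simpa using (hz.pow (k P)).C_mul _
  have hB0 : ∀ P ∈ Z, eval P.rep (B P) = 0 := by
    intro P _
    simp only [B, map_sub, map_mul, eval_C, map_pow]; ring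
  have hprod : (∏ P ∈ Z, B P).IsHomogeneous (∑ P ∈ Z, k P) := IsHomogeneous.prod _ _ _ hBh
  have h1 : (∏ P ∈ Z, B P) ^ (d * m + 1) ∈ 𝔞 := by
    obtain ⟨g, -, hg⟩ := hH.pow_mul_mem hd hprod (fun P hP hP0 => by
      rw [map_prod]; exact Finset.prod_eq_zero (hZ P hP hP0) (hB0 P (hZ P hP hP0))) ha
    exact ⟨g, hg⟩
  have h2 : Ideal.Quotient.mk 𝔞 ((∏ P ∈ Z, B P) ^ (d * m + 1))
      = Ideal.Quotient.mk 𝔞 ((∏ P ∈ Z, C (eval P.rep (h P)) * z ^ k P) ^ (d * m + 1)) := by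
    rw [map_pow, map_pow, map_prod, map_prod]
    congr 1
    refine Finset.prod_congr rfl fun P hP => ?_
    rw [Ideal.Quotient.eq]
    simp only [B]
    rw [sub_sub_cancel_left, neg_mem_iff]
    obtain ⟨g, -, hg⟩ := hmem P hP
    exact Ideal.mul_mem_left _ _ ((h𝔞 _).mpr ⟨g, hg⟩)
  rw [(Ideal.Quotient.eq_zero_iff_mem).mpr h1, eq_comm, Ideal.Quotient.eq_zero_iff_mem,
    Finset.prod_mul_distrib, ← map_prod, Finset.prod_pow_eq_pow_sum, mul_pow, ← map_pow,
    ← pow_mul] at h2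
  set c := (∏ P ∈ Z, eval P.rep (h P)) ^ (d * m + 1)
  set N := (∑ P ∈ Z, k P) * (d * m + 1)
  have hc : c ≠ 0 := pow_ne_zero _ (Finset.prod_ne_zero_iff.mpr h0)
  have h3 : z ^ N ∈ 𝔞 := by
    have := Ideal.mul_mem_left 𝔞 (C c⁻¹) h2
    rwa [← mul_assoc, ← C_mul, inv_mul_cancel₀ hc, C_1, one_mul] at this
  refine ⟨N, φ.exists_isHomogeneous_of_mem_range hd ?_ h3⟩
  rw [mul_add]
  refine (φ.aeval_isHomogeneous ?_).mul ha
  simpa using hz.pow N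

theorem Param.IsConductor.eval_ne_zero_or {φ : Param d} {m : ℕ} {H : MvPolynomial (Fin 3) ℂ}
    (hH : φ.IsConductor m H) {z : MvPolynomial (Fin 3) ℂ} (hz : z.IsHomogeneous 1)
    (hz0 : ∀ P ∈ φ.curve, eval P.rep H = 0 → eval P.rep z ≠ 0) (w : Fin 2 → ℂ) (hw : w ≠ 0) :
    eval w (aeval φ.f H) ≠ 0 ∨ eval w (aeval φ.f z) ≠ 0 := by
  by_contra! h
  have h1 : eval (φ.map (Projectivization.mk ℂ w hw)).rep H = 0 := by
    by_contra h1
    exact (φ.eval_ne_zero_iff hw rfl hH.isHomogeneous).mpr h1 h.1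
  exact (φ.eval_ne_zero_iff hw rfl hz).mpr (hz0 _ ⟨_, rfl⟩ h1) h.2

/-- A linear form that vanishes at no zero of `H` on the curve does not vanish identically on the
curve, because `H` has such zeros: otherwise `R n = S n`, while the codimension is positive for `d ≥
3`. -/
theorem Param.IsConductor.aeval_linear_ne_zero {φ : Param d} {m : ℕ}
    {H : MvPolynomial (Fin 3) ℂ} (hH : φ.IsConductor m H) (hd : 3 ≤ d)
    (hφ : φ.IsGenericallyInjective) {z : MvPolynomial (Fin 3) ℂ} (hz : z.IsHomogeneous 1)
    (hz0 : ∀ P ∈ φ.curve, eval P.rep H = 0 → eval P.rep z ≠ 0) : aeval φ.f z ≠ 0 := by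
  intro h
  obtain ⟨N, hN⟩ := φ.finrank_R hd hφ
  have h1 : m = 0 := by
    by_contra h1
    obtain ⟨v, hv, hv0⟩ := exists_eval_eq_zero (φ.aeval_isHomogeneous hH.isHomogeneous)
      (mul_ne_zero (by omega : d ≠ 0) h1)
    rcases hH.eval_ne_zero_or hz hz0 v hv with h2 | h2
    · exact h2 hv0
    · exact h2 (by rw [h, map_zero])
  -- for `m = 0` the form `H` is a constant, so that `R n = S n`
  subst h1
  have h3 := hN N le_rfl
  have h4 := φ.le_finrank_R hH.ne_zero hH.mul_mem N
  rw [zero_add] at h4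
  have h5 : 0 < (d - 1) * (d - 2) := Nat.mul_pos (by omega) (by omega)
  omega

/-- Since `H` and `z` have no common zero on the curve, `S (n + 1) = z S n + R (n + 1)` for large
`n`. -/
theorem Param.IsConductor.map_mulLeft_sup {φ : Param d} {m : ℕ}
    {H : MvPolynomial (Fin 3) ℂ} (hH : φ.IsConductor m H)
    {z : MvPolynomial (Fin 3) ℂ} (hz : z.IsHomogeneous 1)
    (hz0 : ∀ P ∈ φ.curve, eval P.rep H = 0 → eval P.rep z ≠ 0) {n : ℕ} (hn : m ≤ n) :
    (homogeneousSubmodule (Fin 2) ℂ (d * n)).map (LinearMap.mulLeft ℂ (aeval φ.f z)) ⊔ φ.R (n + 1)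
      = homogeneousSubmodule (Fin 2) ℂ (d * (n + 1)) := by
  have hzh : (aeval φ.f z).IsHomogeneous d := by simpa using φ.aeval_isHomogeneous hz
  apply le_antisymm
  · refine sup_le ?_ (φ.R_le _)
    rintro _ ⟨b, hb, rfl⟩
    rw [mul_add, mul_one, add_comm]; exact hzh.mul hb
  · intro F hF
    have hle : d * m ≤ d * n := Nat.mul_le_mul_left _ hn
    have hF' : F.IsHomogeneous (d * n + d) := by rw [← Nat.mul_succ]; exact hF
    have hdeg : d * m + d ≤ d * n + d + 1 := by omega
    obtain ⟨α, β, hα, hβ, hαβ⟩ := exists_eq_mul_add_mul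
      (φ.aeval_isHomogeneous hH.isHomogeneous) hzh (hH.eval_ne_zero_or hz hz0) hdeg hF'
    rw [hαβ, add_comm (α * _)]
    refine Submodule.add_mem_sup (Submodule.mem_map.mpr ⟨β, ?_, mul_comm _ _⟩) ?_
    · rw [Nat.add_sub_cancel] at hβ
      exact hβ
    · have e : d * n + d - d * m = d * (n + 1 - m) := by
        rw [Nat.mul_sub, Nat.mul_succ]
      rw [e] at hα
      have := hH.mul_mem _ α hα
      rw [mul_comm]
      rwa [show m + (n + 1 - m) = n + 1 by omega] at this

/-- Multiplication by `z` is injective on the quotients `S n / R n` for large `n`: it is surjective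
there, because `H` and `z` have no common zero on the curve, and the dimensions agree. -/
theorem Param.IsConductor.exists_mem_of_mul_mem {φ : Param d} {m : ℕ}
    {H : MvPolynomial (Fin 3) ℂ} (hH : φ.IsConductor m H) (hd : 3 ≤ d)
    (hφ : φ.IsGenericallyInjective) {z : MvPolynomial (Fin 3) ℂ} (hz : z.IsHomogeneous 1)
    (hz0 : ∀ P ∈ φ.curve, eval P.rep H = 0 → eval P.rep z ≠ 0) :
    ∃ N₀, ∀ n, N₀ ≤ n → ∀ a : MvPolynomial (Fin 2) ℂ, a.IsHomogeneous (d * n) →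
      aeval φ.f z * a ∈ φ.R (n + 1) → a ∈ φ.R n := by
  obtain ⟨N, hN⟩ := φ.finrank_R hd hφ
  refine ⟨N + m, fun n hn a ha hza => ?_⟩
  have hzne := hH.aeval_linear_ne_zero hd hφ hz hz0
  obtain ⟨V, hVdef⟩ : ∃ V, V =
    (homogeneousSubmodule (Fin 2) ℂ (d * n)).map (LinearMap.mulLeft ℂ (aeval φ.f z)) := ⟨_, rfl⟩
  have hsup := hH.map_mulLeft_sup hz hz0 (n := n) (by omega)
  rw [← hVdef] at hsup
  have hV : Module.finrank ℂ V = d * n + 1 := by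
    rw [hVdef, finrank_map_mulLeft hzne, finrank_homogeneousSubmodule_two]
  have : Module.Finite ℂ V :=
    Submodule.finiteDimensional_of_le (le_sup_left.trans hsup.le)
  have hdim := Submodule.finrank_sup_add_finrank_inf_eq V (φ.R (n + 1))
  rw [hsup, hV, finrank_homogeneousSubmodule_two] at hdim
  have h1 := hN n (by omega)
  have h2 := hN (n + 1) (by omega)
  have hsub : (φ.R n).map (LinearMap.mulLeft ℂ (aeval φ.f z)) ≤ V ⊓ φ.R (n + 1) := by
    refine le_inf (hVdef ▸ Submodule.map_mono (φ.R_le n)) ?_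
    rintro _ ⟨_, ⟨g, hg, rfl⟩, rfl⟩
    refine ⟨z * g, ?_, ?_⟩
    · rw [add_comm]; exact hz.mul hg
    · exact map_mul (aeval φ.f) z g
  have : Module.Finite ℂ (V ⊓ φ.R (n + 1) : Submodule ℂ (MvPolynomial (Fin 2) ℂ)) :=
    Submodule.finiteDimensional_of_le inf_le_left
  have hrank : Module.finrank ℂ ((φ.R n).map (LinearMap.mulLeft ℂ (aeval φ.f z)))
      = Module.finrank ℂ (φ.R n) := finrank_map_mulLeft hzne _
  have heq := Submodule.eq_of_le_of_finrank_eq hsub (by omega)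
  have hmem : aeval φ.f z * a ∈ V ⊓ φ.R (n + 1) := ⟨hVdef ▸ ⟨a, ha, rfl⟩, hza⟩
  rw [← heq] at hmem
  obtain ⟨b, hb, hbeq⟩ := hmem
  rwa [← mul_left_cancel₀ hzne hbeq]

/-- Every element of the normalization at a point `P₀ ∈ Z` is, modulo the local ring at `P₀`, a form
divided by a power of `z`, where the form can be chosen to belong to the coordinate ring locally at
the other points of `Z`. -/
theorem Param.IsConductor.exists_approximation {φ : Param d} {m : ℕ} {H : MvPolynomial (Fin 3) ℂ}
    (hH : φ.IsConductor m H) (hd : d ≠ 0) {Z : Finset (ℙ ℂ (Fin 3 → ℂ))}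
    (hZ : ∀ P ∈ φ.curve, eval P.rep H = 0 → P ∈ Z) (hZC : ∀ P ∈ Z, P ∈ φ.curve)
    {z : MvPolynomial (Fin 3) ℂ} (hz : z.IsHomogeneous 1) (hz0 : ∀ P ∈ Z, eval P.rep z ≠ 0)
    {P₀ : ℙ ℂ (Fin 3 → ℂ)} (hP₀ : P₀ ∈ Z) {x : FF} (hx : x ∈ φ.normRing P₀) :
    ∃ (N : ℕ) (y : MvPolynomial (Fin 2) ℂ), y.IsHomogeneous (d * N) ∧
      frac y / frac (aeval φ.f (z ^ N)) - x ∈ φ.localRing P₀ ∧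
      ∀ P ∈ Z, P ≠ P₀ → frac y / frac (aeval φ.f (z ^ N)) ∈ φ.localRing P := by
  classical
  obtain ⟨k, a, h, ha, hh, h0, hxa⟩ := hx
  set r := d * m + 1 with hr
  have hlam : ∀ P : ℙ ℂ (Fin 3 → ℂ), ∃ l : MvPolynomial (Fin 3) ℂ, l.IsHomogeneous 1 ∧
      (P ≠ P₀ → eval P.rep l = 0 ∧ eval P₀.rep l ≠ 0) := by
    intro P
    by_cases hP : P = P₀
    · exact ⟨X 0, isHomogeneous_X _ _, fun h => absurd hP h⟩
    · obtain ⟨l, hl, h⟩ := exists_linear_separating hP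
      exact ⟨l, hl, fun _ => h⟩
  choose l hl hl0 using hlam
  -- `E` vanishes at all points of `Z` except `P₀`
  set E := ∏ P ∈ Z.erase P₀, l P with hEdef
  set e := ∑ P ∈ Z.erase P₀, 1
  have hE : E.IsHomogeneous e := IsHomogeneous.prod _ _ _ fun P _ => hl P
  have hE0 : eval P₀.rep E ≠ 0 := by
    rw [hEdef, map_prod]
    exact Finset.prod_ne_zero_iff.mpr fun P hP => (hl0 P (Finset.ne_of_mem_erase hP)).2
  have hEP : ∀ P ∈ Z, P ≠ P₀ → eval P.rep E = 0 := fun P hP hne => by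
    rw [hEdef, map_prod]
    exact Finset.prod_eq_zero (Finset.mem_erase.mpr ⟨hne, hP⟩) (hl0 P hne).1
  have hEr : (E ^ r).IsHomogeneous (e * r) := hE.pow r
  have hh'' := hh.mul hEr
  set k' := k + e * r with hk'
  set c := eval P₀.rep (h * E ^ r) with hcdef
  have hc : c ≠ 0 := by
    rw [hcdef, map_mul, map_pow]; exact mul_ne_zero h0 (pow_ne_zero _ hE0)
  set c' := eval P₀.rep z ^ k' with hc'def
  have hc' : c' ≠ 0 := pow_ne_zero _ (hz0 P₀ hP₀)
  set B := C c * z ^ k' - C c' * (h * E ^ r) with hBdef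
  have hzp : ∀ j, (z ^ j).IsHomogeneous j := fun j => by simpa using hz.pow j
  have hB : B.IsHomogeneous k' := ((hzp k').C_mul c).sub (hh''.C_mul c')
  have hB0 : eval P₀.rep B = 0 := by
    rw [hBdef, map_sub, map_mul, map_mul, eval_C, eval_C, ← hcdef, map_pow, ← hc'def]; ring
  -- invert `h Eʳ` modulo `B ^ r` by a geometric series
  obtain ⟨s', hs'⟩ : (C c * z ^ k' - B) ∣ (C c * z ^ k') ^ r - B ^ r := sub_dvd_pow_sub_pow _ _ r
  obtain ⟨s, hsdef⟩ : ∃ s, s = C (c' / c ^ r) * s' := ⟨_, rfl⟩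
  have hs : h * E ^ r * s = z ^ (k' * r) - C ((c ^ r)⁻¹) * B ^ r := by
    have e1 : C c * z ^ k' - B = C c' * (h * E ^ r) := by rw [hBdef]; ring
    rw [e1] at hs'
    have e2 : z ^ (k' * r) = C ((c ^ r)⁻¹) * (C c * z ^ k') ^ r := by
      rw [mul_pow, ← C_pow, ← mul_assoc, ← C_mul, inv_mul_cancel₀ (pow_ne_zero _ hc), C_1, one_mul,
        pow_mul]
    rw [e2, ← mul_sub, hs', hsdef, div_eq_mul_inv, C_mul]; ring
  have hh''0 : h * E ^ r ≠ 0 := fun h1 => hc (by rw [hcdef, h1, map_zero])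
  have hsh : s.IsHomogeneous (k' * r - k') := by
    refine isHomogeneous_of_mul_left hh'' hh''0 ?_
    rw [hs]
    exact (hzp _).sub ((hB.pow r).C_mul _)
  have hkr : k' ≤ k' * r := Nat.le_mul_of_pos_right _ (Nat.succ_pos _)
  have hzne := φ.aeval_ne_zero (hZC P₀ hP₀) hz (hz0 P₀ hP₀)
  have hzN : frac (aeval φ.f (z ^ (k' * r))) ≠ 0 := by
    refine frac_ne_zero ?_
    rw [map_pow]; exact pow_ne_zero _ hzne
  have hsa : (aeval φ.f s * a).IsHomogeneous (d * (k' * r - k' + k)) := by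
    rw [mul_add]; exact (φ.aeval_isHomogeneous hsh).mul ha
  refine ⟨k' * r, aeval φ.f (E ^ r) * (aeval φ.f s * a), ?_, ?_, ?_⟩
  · have := (φ.aeval_isHomogeneous hEr).mul hsa
    rw [← mul_add] at this
    convert this using 2
    omega
  · have hEB : (aeval φ.f ((E * B) ^ r) * a) ∈ φ.R ((e + k') * r + k) := by
      refine hH.pow_mul_mem hd (hE.mul hB) (fun P hP hP0 => ?_) ha
      rw [map_mul]
      by_cases hne : P = P₀
      · rw [hne, hB0, mul_zero]
      · rw [hEP P (hZ P hP hP0) hne, zero_mul]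
    refine φ.mem_localRing_of_mul_mem (a := aeval φ.f (C (-(c ^ r)⁻¹) * B ^ r) * a)
      (h := h * z ^ (k' * r)) (h' := E ^ r) (hh.mul (hzp _)) ?_ ?_ hEr ?_ (l := (e + k') * r + k)
      ?_ ?_
    · rw [map_mul, map_pow]; exact mul_ne_zero h0 (pow_ne_zero _ (hz0 P₀ hP₀))
    · have e1 : aeval φ.f (C (-(c ^ r)⁻¹) * B ^ r)
          = aeval φ.f h * aeval φ.f (E ^ r) * aeval φ.f s - aeval φ.f (z ^ (k' * r)) := by
        rw [← map_mul, ← map_mul, ← map_sub, hs, C_neg]; congr 1; ring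
      rw [e1]
      simp only [map_mul, map_sub] at hxa ⊢
      rw [← hxa, sub_mul, div_mul_eq_mul_div, sub_eq_iff_eq_add, div_eq_iff hzN]
      ring
    · rw [map_pow]; exact pow_ne_zero _ hE0
    · have : aeval φ.f (E ^ r) * (aeval φ.f (C (-(c ^ r)⁻¹) * B ^ r) * a)
          = (-(c ^ r)⁻¹) • (aeval φ.f ((E * B) ^ r) * a) := by
        rw [smul_eq_C_mul, map_mul, aeval_C, algebraMap_eq, mul_pow, map_mul]; ring
      rw [this]
      exact Submodule.smul_mem _ _ hEB
    · ring
  · intro P hP hne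
    obtain ⟨t, ht, ht0, htP⟩ := exists_linear_separating (Ne.symm hne)
    have hEt : aeval φ.f ((t * E) ^ r) * (aeval φ.f s * a)
        ∈ φ.R ((1 + e) * r + (k' * r - k' + k)) := by
      refine hH.pow_mul_mem hd (ht.mul hE) (fun P' hP' hP0' => ?_) hsa
      rw [map_mul]
      by_cases hne : P' = P₀
      · rw [hne, ht0, zero_mul]
      · rw [hEP P' (hZ P' hP' hP0') hne, mul_zero]
    refine φ.mem_localRing_of_mul_mem (h := z ^ (k' * r)) (h' := t ^ r) (hzp _) ?_
      (div_mul_cancel₀ _ hzN) (ht.pow r) ?_ (l := (1 + e) * r + (k' * r - k' + k)) ?_ ?_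
    · rw [map_pow]; exact pow_ne_zero _ (hz0 P hP)
    · rw [map_pow]; exact pow_ne_zero _ htP
    · rw [← mul_assoc, ← map_mul, ← mul_pow]; exact hEt
    · rw [add_mul]; omega

end Delta

/-! ### The genus formula -/

section Genus

variable {d : ℕ}

/-- Suppose that maps `D n : S n → ∏ Q i` with kernels `T n` have increasing images, that `T n` has
codimension `g / 2` in `S n` for large `n`, and that every element of a factor `Q i` is in the image
of some `D n`.  Then `D n` is onto for large `n`, so that `∏ Q i` has dimension `g / 2`. -/
theorem two_mul_sum_finrank_of_filtration {ι E : Type*} [Fintype ι] [DecidableEq ι] [AddCommGroup E]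
    [Module ℂ E] {Q : ι → Type*} [∀ i, AddCommGroup (Q i)] [∀ i, Module ℂ (Q i)]
    (S T : ℕ → Submodule ℂ E) [∀ n, Module.Finite ℂ (S n)] (D : ∀ n, S n →ₗ[ℂ] ∀ i, Q i)
    (hmono : Monotone fun n => LinearMap.range (D n)) {n₀ g : ℕ}
    (hker : ∀ n, n₀ ≤ n → LinearMap.ker (D n) = (T n).comap (S n).subtype)
    (hT : ∀ n, T n ≤ S n)
    (hrank : ∀ n, n₀ ≤ n → 2 * Module.finrank ℂ (T n) + g = 2 * Module.finrank ℂ (S n))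
    (hsingle : ∀ (i : ι) (q : Q i), ∃ n, Pi.single i q ∈ LinearMap.range (D n)) :
    2 * ∑ i, Module.finrank ℂ (Q i) = g := by
  have hr : ∀ n, n₀ ≤ n → 2 * Module.finrank ℂ (LinearMap.range (D n)) = g := by
    intro n hn
    have h1 := LinearMap.finrank_range_add_finrank_ker (D n)
    have h2 := hrank n hn
    rw [hker n hn, (Submodule.comapSubtypeEquivOfLe (hT n)).finrank_eq] at h1
    omega
  have hconst : ∀ n, LinearMap.range (D n) ≤ LinearMap.range (D n₀) := by
    intro n
    have h1 := hr n₀ le_rfl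
    have h2 := hr (max n n₀) (le_max_right _ _)
    have h3 : LinearMap.range (D n₀) ≤ LinearMap.range (D (max n n₀)) := hmono (le_max_right n n₀)
    rw [Submodule.eq_of_le_of_finrank_eq h3 (by omega)]
    exact hmono (le_max_left n n₀)
  have htop : LinearMap.range (D n₀) = ⊤ := by
    rw [eq_top_iff]
    intro w _
    rw [← Finset.univ_sum_single w]
    refine Submodule.sum_mem _ fun i _ => ?_
    obtain ⟨n, hn⟩ := hsingle i (w i)
    exact hconst n hn
  have hfin : Module.Finite ℂ (∀ i, Q i) :=
    Module.Finite.of_surjective (D n₀) (LinearMap.range_eq_top.mp htop)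
  have : ∀ i, Module.Finite ℂ (Q i) := fun i =>
    Module.Finite.of_surjective (LinearMap.proj i) (LinearMap.proj_surjective i)
  have h1 := hr n₀ le_rfl
  rwa [htop, finrank_top, Module.finrank_pi_fintype] at h1

/-- The map `a ↦ a / zⁿ` from forms of degree `d n` to the normalization at `P`. -/
def Param.quotAt (φ : Param d) {P : ℙ ℂ (Fin 3 → ℂ)} (hP : P ∈ φ.curve)
    {z : MvPolynomial (Fin 3) ℂ} (hz : z.IsHomogeneous 1) (hz0 : eval P.rep z ≠ 0) (n : ℕ) :
    homogeneousSubmodule (Fin 2) ℂ (d * n) →ₗ[ℂ] φ.normRing P where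
  toFun a := ⟨frac (a : MvPolynomial (Fin 2) ℂ) / frac (aeval φ.f (z ^ n)),
    n, a, z ^ n, a.2, by simpa using hz.pow n, by rw [map_pow]; exact pow_ne_zero _ hz0,
    div_mul_cancel₀ _ (frac_ne_zero (by
      rw [map_pow]; exact pow_ne_zero _ (φ.aeval_ne_zero hP hz hz0)))⟩
  map_add' a b := Subtype.ext (by
    simp only [Submodule.coe_add, map_add, add_div]; rfl)
  map_smul' c a := Subtype.ext (by
    change frac (c • (a : MvPolynomial (Fin 2) ℂ)) / _ = c • (_ / _)
    rw [smul_eq_C_mul, map_mul, mul_div_assoc, Algebra.smul_def,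
      IsScalarTower.algebraMap_apply ℂ (MvPolynomial (Fin 2) ℂ) FF]
    rfl)

theorem Param.coe_quotAt (φ : Param d) {P : ℙ ℂ (Fin 3 → ℂ)} (hP : P ∈ φ.curve)
    {z : MvPolynomial (Fin 3) ℂ} (hz : z.IsHomogeneous 1) (hz0 : eval P.rep z ≠ 0) (n : ℕ)
    (a : homogeneousSubmodule (Fin 2) ℂ (d * n)) : (φ.quotAt hP hz hz0 n a : FF)
      = frac (a : MvPolynomial (Fin 2) ℂ) / frac (aeval φ.f (z ^ n)) := rfl

/-- The quotient of the normalization at `P` by the local ring at `P`. -/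
def Param.Gap (φ : Param d) (P : ℙ ℂ (Fin 3 → ℂ)) : Type := φ.normRing P ⧸ φ.localSub P

instance (φ : Param d) (P : ℙ ℂ (Fin 3 → ℂ)) : AddCommGroup (φ.Gap P) :=
  inferInstanceAs (AddCommGroup (φ.normRing P ⧸ φ.localSub P))

instance (φ : Param d) (P : ℙ ℂ (Fin 3 → ℂ)) : Module ℂ (φ.Gap P) :=
  inferInstanceAs (Module ℂ (φ.normRing P ⧸ φ.localSub P))

/-- The projection of the normalization at `P` to its quotient by the local ring. -/
def Param.gapMk (φ : Param d) (P : ℙ ℂ (Fin 3 → ℂ)) : φ.normRing P →ₗ[ℂ] φ.Gap P :=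
  (φ.localSub P).mkQ

theorem Param.gapMk_surjective (φ : Param d) (P : ℙ ℂ (Fin 3 → ℂ)) :
    Function.Surjective (φ.gapMk P) := (φ.localSub P).mkQ_surjective

theorem Param.gapMk_eq_zero_iff (φ : Param d) {P : ℙ ℂ (Fin 3 → ℂ)} {x : φ.normRing P} :
    φ.gapMk P x = 0 ↔ (x : FF) ∈ φ.localRing P :=
  (Submodule.Quotient.mk_eq_zero _).trans φ.mem_localSub

theorem Param.deltaAt_eq_finrank_gap (φ : Param d) (hd : d ≠ 0) (hφ : φ.IsGenericallyInjective)
    {P : ℙ ℂ (Fin 3 → ℂ)} (hP : P ∈ φ.curve) : φ.deltaAt P = Module.finrank ℂ (φ.Gap P) :=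
  φ.deltaAt_eq hd hφ hP

/-- The class of `a / zⁿ` in the quotient of the normalization at `P` by the local ring at `P`. -/
def Param.classAt (φ : Param d) {P : ℙ ℂ (Fin 3 → ℂ)} (hP : P ∈ φ.curve)
    {z : MvPolynomial (Fin 3) ℂ} (hz : z.IsHomogeneous 1) (hz0 : eval P.rep z ≠ 0) (n : ℕ) :
    homogeneousSubmodule (Fin 2) ℂ (d * n) →ₗ[ℂ] φ.Gap P :=
  (φ.gapMk P).comp (φ.quotAt hP hz hz0 n)

theorem Param.classAt_apply (φ : Param d) {P : ℙ ℂ (Fin 3 → ℂ)} (hP : P ∈ φ.curve)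
    {z : MvPolynomial (Fin 3) ℂ} (hz : z.IsHomogeneous 1) (hz0 : eval P.rep z ≠ 0) (n : ℕ)
    (a : homogeneousSubmodule (Fin 2) ℂ (d * n)) :
    φ.classAt hP hz hz0 n a = φ.gapMk P (φ.quotAt hP hz hz0 n a) := rfl

theorem Param.classAt_eq_iff (φ : Param d) {P : ℙ ℂ (Fin 3 → ℂ)} (hP : P ∈ φ.curve)
    {z : MvPolynomial (Fin 3) ℂ} (hz : z.IsHomogeneous 1) (hz0 : eval P.rep z ≠ 0) (n : ℕ)
    (a : homogeneousSubmodule (Fin 2) ℂ (d * n)) (x : φ.normRing P) :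
    φ.classAt hP hz hz0 n a = φ.gapMk P x ↔
      frac (a : MvPolynomial (Fin 2) ℂ) / frac (aeval φ.f (z ^ n)) - x ∈ φ.localRing P := by
  rw [classAt_apply, ← sub_eq_zero, ← map_sub, gapMk_eq_zero_iff, AddSubgroupClass.coe_sub,
    coe_quotAt]

theorem Param.classAt_eq_zero_iff (φ : Param d) {P : ℙ ℂ (Fin 3 → ℂ)} (hP : P ∈ φ.curve)
    {z : MvPolynomial (Fin 3) ℂ} (hz : z.IsHomogeneous 1) (hz0 : eval P.rep z ≠ 0) (n : ℕ)
    (a : homogeneousSubmodule (Fin 2) ℂ (d * n)) :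
    φ.classAt hP hz hz0 n a = 0 ↔
      frac (a : MvPolynomial (Fin 2) ℂ) / frac (aeval φ.f (z ^ n)) ∈ φ.localRing P := by
  rw [classAt_apply, gapMk_eq_zero_iff, coe_quotAt]

/-- The classes of `a / zⁿ` at all points of a finite set. -/
def Param.classMap (φ : Param d) {Z : Finset (ℙ ℂ (Fin 3 → ℂ))} (hZ : ∀ P ∈ Z, P ∈ φ.curve)
    {z : MvPolynomial (Fin 3) ℂ} (hz : z.IsHomogeneous 1) (hz0 : ∀ P ∈ Z, eval P.rep z ≠ 0)
    (n : ℕ) :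
    homogeneousSubmodule (Fin 2) ℂ (d * n) →ₗ[ℂ] (P : Z) → φ.Gap P :=
  LinearMap.pi fun P => φ.classAt (hZ P P.2) hz (hz0 P P.2) n

theorem Param.classMap_mul (φ : Param d) {Z : Finset (ℙ ℂ (Fin 3 → ℂ))}
    (hZ : ∀ P ∈ Z, P ∈ φ.curve) {z : MvPolynomial (Fin 3) ℂ} (hz : z.IsHomogeneous 1)
    (hz0 : ∀ P ∈ Z, eval P.rep z ≠ 0) (n : ℕ) (a : homogeneousSubmodule (Fin 2) ℂ (d * n))
    (b : homogeneousSubmodule (Fin 2) ℂ (d * (n + 1))) (hb : (b : MvPolynomial (Fin 2) ℂ)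
      = aeval φ.f z * a) : φ.classMap hZ hz hz0 (n + 1) b = φ.classMap hZ hz hz0 n a := by
  funext P
  change φ.classAt (hZ P P.2) hz (hz0 P P.2) (n + 1) b = φ.classAt (hZ P P.2) hz (hz0 P P.2) n a
  rw [classAt_apply, classAt_apply]
  refine congrArg _ (Subtype.ext ?_)
  have hzne : frac (aeval φ.f z) ≠ 0 := frac_ne_zero (φ.aeval_ne_zero (hZ P P.2) hz (hz0 P P.2))
  rw [coe_quotAt, coe_quotAt, hb, pow_succ', map_mul, map_mul, map_mul, mul_div_mul_left _ _ hzne]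

theorem Param.range_classMap_mono (φ : Param d) {Z : Finset (ℙ ℂ (Fin 3 → ℂ))}
    (hZ : ∀ P ∈ Z, P ∈ φ.curve) {z : MvPolynomial (Fin 3) ℂ} (hz : z.IsHomogeneous 1)
    (hz0 : ∀ P ∈ Z, eval P.rep z ≠ 0) :
    Monotone fun n => LinearMap.range (φ.classMap hZ hz hz0 n) := by
  refine monotone_nat_of_le_succ fun n => ?_
  rintro _ ⟨a, rfl⟩
  refine ⟨⟨aeval φ.f z * a, ?_⟩, φ.classMap_mul hZ hz hz0 n a _ rfl⟩
  have := (φ.aeval_isHomogeneous hz).mul a.2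
  rwa [← mul_add, add_comm 1 n] at this

/-- For large `n`, a form `a` of degree `d n` such that `a / zⁿ` belongs to the local rings of the
curve at all zeros of `H` belongs to the homogeneous coordinate ring. -/
theorem Param.IsConductor.exists_ker_classMap {φ : Param d} {m : ℕ}
    {H : MvPolynomial (Fin 3) ℂ} (hH : φ.IsConductor m H) (hd : 3 ≤ d)
    (hφ : φ.IsGenericallyInjective) {Z : Finset (ℙ ℂ (Fin 3 → ℂ))}
    (hZH : ∀ P ∈ φ.curve, eval P.rep H = 0 → P ∈ Z) (hZ : ∀ P ∈ Z, P ∈ φ.curve)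
    {z : MvPolynomial (Fin 3) ℂ} (hz : z.IsHomogeneous 1) (hz0 : ∀ P ∈ Z, eval P.rep z ≠ 0) :
    ∃ N₀, ∀ n, N₀ ≤ n → LinearMap.ker (φ.classMap hZ hz hz0 n)
      = (φ.R n).comap (homogeneousSubmodule (Fin 2) ℂ (d * n)).subtype := by
  obtain ⟨N₀, hN₀⟩ := hH.exists_mem_of_mul_mem hd hφ hz fun P hP h => hz0 P (hZH P hP h)
  refine ⟨N₀, fun n hn => ?_⟩
  have hker : ∀ a, a ∈ LinearMap.ker (φ.classMap hZ hz hz0 n) ↔ ∀ P ∈ Z,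
      frac (a : MvPolynomial (Fin 2) ℂ) / frac (aeval φ.f (z ^ n)) ∈ φ.localRing P := by
    intro a
    rw [LinearMap.mem_ker, funext_iff, Subtype.forall]
    refine forall₂_congr fun P hP => ?_
    exact φ.classAt_eq_zero_iff (hZ P hP) hz (hz0 P hP) n a
  have hzn : ∀ j, (z ^ j).IsHomogeneous j := fun j => by simpa using hz.pow j
  have hzP : ∀ P ∈ Z, frac (aeval φ.f (z ^ n)) ≠ 0 := fun P hP => frac_ne_zero (by
    rw [map_pow]; exact pow_ne_zero _ (φ.aeval_ne_zero (hZ P hP) hz (hz0 P hP)))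
  ext ⟨a, ha⟩
  rw [hker, Submodule.mem_comap, Submodule.subtype_apply]
  constructor
  · intro h
    obtain ⟨N, hN⟩ := hH.exists_pow_mul_mem (by omega) hZH hz ha fun P hP => by
      obtain ⟨k, g, h, hg, hh, h0, hx⟩ := h P hP
      refine ⟨k, h, hh, h0, g * z ^ n, hg.mul (hzn n), ?_⟩
      apply frac_injective
      rw [div_mul_eq_mul_div, div_eq_iff (hzP P hP)] at hx
      simp only [AlgHom.toLinearMap_apply, map_mul] at hx ⊢
      rw [← hx, mul_comm]
    -- cancel the factors `z` one at a time
    have key : ∀ N n, N₀ ≤ n → ∀ a : MvPolynomial (Fin 2) ℂ, a.IsHomogeneous (d * n) →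
        aeval φ.f (z ^ N) * a ∈ φ.R (N + n) → a ∈ φ.R n := by
      intro N
      induction N with
      | zero => intro n _ a _ h; simpa using h
      | succ N ih =>
        intro n hn a ha h
        refine hN₀ n hn a ha (ih (n + 1) (by omega) _ ?_ ?_)
        · rw [mul_add, mul_one, add_comm]
          have := (φ.aeval_isHomogeneous hz).mul ha
          rwa [mul_one] at this
        · rw [← mul_assoc, ← map_mul, ← pow_succ, show N + (n + 1) = N + 1 + n by ring]
          exact h
    exact key N n hn a ha hN
  · rintro ⟨g, hg, rfl⟩ P hP
    exact ⟨n, g, z ^ n, hg, hzn n, by rw [map_pow]; exact pow_ne_zero _ (hz0 P hP),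
      div_mul_cancel₀ _ (hzP P hP)⟩

/-- The total delta invariant is the codimension of the homogeneous coordinate ring of the curve in
the ring of all forms of degree `d n` for large `n`, that is, the arithmetic genus of a plane curve
of degree `d`. -/
theorem Param.two_mul_delta (φ : Param d) (hd : 3 ≤ d) (hφ : φ.IsGenericallyInjective) :
    2 * φ.delta = (d - 1) * (d - 2) := by
  classical
  obtain ⟨m, H, hH⟩ := φ.exists_isConductor (by omega) hφ
  let Z := (φ.finite_conductor_zeros hH).toFinset
  have hmem : ∀ P, P ∈ Z ↔ P ∈ φ.curve ∧ eval P.rep H = 0 := fun P => by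
    simp only [Z, Set.Finite.mem_toFinset]; rfl
  have hZH : ∀ P ∈ φ.curve, eval P.rep H = 0 → P ∈ Z := fun P h h' => (hmem P).mpr ⟨h, h'⟩
  have hZ : ∀ P ∈ Z, P ∈ φ.curve := fun P h => ((hmem P).mp h).1
  clear_value Z
  obtain ⟨z, hz, hz0⟩ := exists_linear_forall_ne_zero Z
  obtain ⟨N₁, hN₁⟩ := hH.exists_ker_classMap hd hφ hZH hZ hz hz0
  obtain ⟨N₂, hN₂⟩ := φ.finrank_R hd hφ
  have key : 2 * ∑ P : Z, Module.finrank ℂ (φ.Gap P) = (d - 1) * (d - 2) := by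
    refine two_mul_sum_finrank_of_filtration (fun n => homogeneousSubmodule (Fin 2) ℂ (d * n)) φ.R
      (φ.classMap hZ hz hz0) (φ.range_classMap_mono hZ hz hz0) (n₀ := N₁ + N₂)
      (fun n hn => hN₁ n (by omega)) φ.R_le (fun n hn => ?_) fun P₀ q => ?_
    · rw [finrank_homogeneousSubmodule_two]
      exact hN₂ n (by omega)
    · obtain ⟨x, hx⟩ := φ.gapMk_surjective P₀ q
      obtain ⟨N, y, hy, h0, hP⟩ := hH.exists_approximation (by omega) hZH hZ hz hz0 P₀.2 x.2
      refine ⟨N, ⟨y, hy⟩, funext fun P => ?_⟩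
      change φ.classAt (hZ P P.2) hz (hz0 P P.2) N ⟨y, hy⟩ = _
      by_cases hne : P = P₀
      · subst hne
        rw [Pi.single_eq_same, ← hx]
        exact (φ.classAt_eq_iff _ _ _ _ _ _).mpr h0
      · rw [Pi.single_eq_of_ne hne]
        exact (φ.classAt_eq_zero_iff _ _ _ _ _).mpr (hP P P.2 fun h => hne (Subtype.ext h))
  rw [← key]
  congr 1
  rw [Param.delta, finsum_mem_inter_support_eq φ.deltaAt φ.curve (Z : Set _), finsum_mem_coe_finset,
    ← Finset.sum_coe_sort]
  · exact Finset.sum_congr rfl fun P _ => φ.deltaAt_eq_finrank_gap (by omega) hφ (hZ P P.2)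
  · ext P
    simp only [Set.mem_inter_iff, Function.mem_support, Finset.mem_coe]
    refine and_congr_left fun h => ⟨fun hP => ?_, hZ P⟩
    refine hZH P hP ?_
    by_contra h0
    exact h (hH.deltaAt_eq_zero (by omega) hφ hP h0)

end Genus

/-! ### The Hilbert–Burch theorem -/

section HilbertBurch

variable {R : Type*} [CommRing R] {m : ℕ}

/-- The maximal minor of an `m × (m + 1)` matrix obtained by deleting the column `c`, with sign
`(-1)ᶜ`. -/
def signedMinor (N : Matrix (Fin m) (Fin (m + 1)) R) (c : Fin (m + 1)) : R :=
  (-1) ^ (c : ℕ) * (N.submatrix id c.succAbove).det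

/-- Laplace expansion along an additional first row `v`. -/
theorem sum_mul_signedMinor (N : Matrix (Fin m) (Fin (m + 1)) R) (v : Fin (m + 1) → R) :
    ∑ c, v c * signedMinor N c
      = (Matrix.of (Fin.cons v N) : Matrix (Fin (m + 1)) (Fin (m + 1)) R).det := by
  rw [Matrix.det_succ_row_zero]
  refine Finset.sum_congr rfl fun c _ => ?_
  rw [signedMinor]
  have : (Matrix.of (Fin.cons v N : Fin (m + 1) → Fin (m + 1) → R)).submatrix Fin.succ c.succAbove
      = N.submatrix id c.succAbove := rfl
  rw [this]
  change v c * _ = _ * v c * _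
  ring

theorem sum_row_mul_signedMinor (N : Matrix (Fin m) (Fin (m + 1)) R) (i : Fin m) :
    ∑ c, N i c * signedMinor N c = 0 := by
  rw [sum_mul_signedMinor N (N i)]
  exact Matrix.det_zero_of_row_eq (Fin.succ_ne_zero i) rfl

/-- In a factorial ring, `x ∣ Δ_k y` for all `k` implies `x ∣ y` if the `Δ_k` have no common
irreducible factor. -/
theorem dvd_of_forall_dvd_mul {R ι : Type*} [CommRing R] [IsDomain R]
    [UniqueFactorizationMonoid R] {Δ : ι → R} (h : ∀ p, Irreducible p → ∃ k, ¬ p ∣ Δ k) (x : R) :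
    x ≠ 0 → ∀ y, (∀ k, x ∣ Δ k * y) → x ∣ y := by
  induction x using UniqueFactorizationMonoid.induction_on_prime with
  | h₁ => intro h0; exact absurd rfl h0
  | h₂ x hx => intro _ y _; exact hx.dvd
  | h₃ a p ha hp ih =>
    intro _ y hy
    obtain ⟨k, hk⟩ := h p hp.irreducible
    obtain ⟨y', rfl⟩ := (hp.dvd_or_dvd (dvd_of_mul_right_dvd (hy k))).resolve_left hk
    refine mul_dvd_mul_left p (ih ha y' fun j => ?_)
    have := hy j
    rwa [mul_left_comm, mul_dvd_mul_iff_left hp.ne_zero] at this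

variable [IsDomain R]

theorem eq_zero_of_vecMul_eq_zero {N : Matrix (Fin m) (Fin (m + 1)) R} {k : Fin (m + 1)}
    (hk : signedMinor N k ≠ 0) {w : Fin m → R} (hw : ∀ c, ∑ i, w i * N i c = 0) : w = 0 := by
  have hdet : (N.submatrix id k.succAbove).det ≠ 0 := right_ne_zero_of_mul hk
  refine Matrix.eq_zero_of_vecMul_eq_zero hdet (funext fun c => ?_)
  exact hw (k.succAbove c)

/-- Exactness of the Hilbert–Burch complex: a relation between the maximal minors is a combination
of the rows of the matrix. -/
theorem exists_eq_sum_mul_of_sum_mul_signedMinor [UniqueFactorizationMonoid R]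
    {N : Matrix (Fin m) (Fin (m + 1)) R} (hN : ∀ p, Irreducible p → ∃ k, ¬ p ∣ signedMinor N k)
    {k : Fin (m + 1)} (hk : signedMinor N k ≠ 0) {v : Fin (m + 1) → R}
    (hv : ∑ c, v c * signedMinor N c = 0) : ∃ w : Fin m → R, ∀ c, v c = ∑ i, w i * N i c := by
  rw [sum_mul_signedMinor, ← Matrix.exists_vecMul_eq_zero_iff] at hv
  obtain ⟨x, hx, hx0⟩ := hv
  have hrel : ∀ c, x 0 * v c + ∑ i, x (Fin.succ i) * N i c = 0 := by
    intro c
    have := congrFun hx0 c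
    rw [Matrix.vecMul, dotProduct, Fin.sum_univ_succ] at this
    exact this
  have hx00 : x 0 ≠ 0 := by
    intro h
    refine hx (funext fun i => ?_)
    refine Fin.cases h (fun i => ?_) i
    exact congrFun (eq_zero_of_vecMul_eq_zero hk (w := fun i => x (Fin.succ i)) fun c => by
      have := hrel c
      rwa [h, zero_mul, zero_add] at this) i
  have hdvd : ∀ i : Fin m, x 0 ∣ x (Fin.succ i) := by
    intro i
    refine dvd_of_forall_dvd_mul hN _ hx00 _ fun c => ?_
    -- Cramer's rule for the square matrix obtained by deleting the column `c`
    let B := N.submatrix id c.succAbove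
    have h1 : Matrix.vecMul (fun i => x (Fin.succ i)) B = fun j => - (x 0 * v (c.succAbove j)) := by
      funext j
      exact eq_neg_of_add_eq_zero_right (hrel (c.succAbove j))
    have h2 : Matrix.vecMul (Matrix.vecMul (fun i => x (Fin.succ i)) B) B.adjugate i
        = B.det * x (Fin.succ i) := by
      rw [Matrix.vecMul_vecMul, Matrix.mul_adjugate, Matrix.vecMul_smul, Matrix.vecMul_one,
        Pi.smul_apply, smul_eq_mul]
    rw [signedMinor, mul_assoc]
    refine Dvd.dvd.mul_left ?_ _
    rw [← h2, h1, Matrix.vecMul, dotProduct]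
    refine Finset.dvd_sum fun j _ => ?_
    exact Dvd.dvd.mul_right (Dvd.dvd.neg_right (Dvd.intro _ rfl)) _
  choose w hw using hdvd
  refine ⟨fun i => - w i, fun c => ?_⟩
  apply mul_left_cancel₀ hx00
  rw [eq_neg_of_add_eq_zero_left (hrel c), Finset.mul_sum, ← Finset.sum_neg_distrib]
  refine Finset.sum_congr rfl fun i _ => ?_
  rw [hw i]; ring

end HilbertBurch

section GradedHilbertBurch

variable {m : ℕ}

theorem det_isHomogeneous {σ ι : Type*} [Fintype ι] [DecidableEq ι]
    {B : Matrix ι ι (MvPolynomial σ ℂ)} {wt : ι → ℕ} (h : ∀ i j, (B i j).IsHomogeneous (wt j)) :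
    B.det.IsHomogeneous (∑ j, wt j) := by
  rw [Matrix.det_apply]
  refine Submodule.sum_mem (homogeneousSubmodule σ ℂ _) fun σ _ => ?_
  rw [Units.smul_def]
  exact zsmul_mem (IsHomogeneous.prod _ _ _ fun i _ => h _ _) _

theorem signedMinor_isHomogeneous {N : Matrix (Fin m) (Fin (m + 1)) (MvPolynomial (Fin 3) ℂ)}
    {wt : Fin (m + 1) → ℕ} (h : ∀ i c, (N i c).IsHomogeneous (wt c)) (c : Fin (m + 1)) :
    (signedMinor N c).IsHomogeneous (∑ j, wt (c.succAbove j)) := by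
  have h1 : ((-1 : MvPolynomial (Fin 3) ℂ) ^ (c : ℕ)).IsHomogeneous 0 := by
    have := ((isHomogeneous_one (Fin 3) ℂ).neg).pow (c : ℕ)
    rwa [zero_mul] at this
  have h2 : ((N.submatrix id c.succAbove).det).IsHomogeneous (∑ j, wt (c.succAbove j)) :=
    det_isHomogeneous fun i j => h _ _
  have := h1.mul h2
  rwa [zero_add] at this

theorem isHomogeneous_mul_signedMinor {N : Matrix (Fin m) (Fin (m + 1)) (MvPolynomial (Fin 3) ℂ)}
    {wt : Fin (m + 1) → ℕ} (h : ∀ i c, (N i c).IsHomogeneous (wt c)) (c : Fin (m + 1)) {q : ℕ}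
    {v : MvPolynomial (Fin 3) ℂ} (hv : v.IsHomogeneous (q + wt c)) :
    (v * signedMinor N c).IsHomogeneous (q + ∑ c, wt c) := by
  have := hv.mul (signedMinor_isHomogeneous h c)
  rwa [add_assoc, ← Fin.sum_univ_succAbove wt c] at this

/-- The part of degree `q + ∑ wt` of the ideal of maximal minors consists of the combinations of the
minors with homogeneous coefficients. -/
theorem homogeneousSubmodule_inf_span_signedMinor
    {N : Matrix (Fin m) (Fin (m + 1)) (MvPolynomial (Fin 3) ℂ)}
    {wt : Fin (m + 1) → ℕ} (h : ∀ i c, (N i c).IsHomogeneous (wt c)) (q : ℕ)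
    {x : MvPolynomial (Fin 3) ℂ} (hx : x.IsHomogeneous (q + ∑ c, wt c))
    (hxI : x ∈ Ideal.span (Set.range (signedMinor N))) :
    ∃ v : Fin (m + 1) → MvPolynomial (Fin 3) ℂ, (∀ c, (v c).IsHomogeneous (q + wt c)) ∧
      x = ∑ c, v c * signedMinor N c := by
  obtain ⟨v, hv⟩ := (Submodule.mem_span_range_iff_exists_fun _).mp hxI
  refine ⟨fun c => homogeneousComponent (q + wt c) (v c),
    fun c => homogeneousComponent_isHomogeneous _ _, ?_⟩
  rw [← homogeneousComponent_of_mem hx |>.trans (if_pos rfl), ← hv, map_sum]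
  refine Finset.sum_congr rfl fun c _ => ?_
  have hdeg : q + ∑ c, wt c = ∑ j, wt (c.succAbove j) + (q + wt c) := by
    rw [Fin.sum_univ_succAbove wt c]; ring
  rw [hdeg, smul_eq_mul, mul_comm,
    homogeneousComponent_mul_of_isHomogeneous (signedMinor_isHomogeneous h c), mul_comm]

/-- The Hilbert function of the ideal of maximal minors, without subtraction: counting dimensions in
the Hilbert–Burch resolution `0 → A^m → A^(m+1) → I → 0` by free modules over `A = ℂ[u₀, u₁, u₂]`.
-/
theorem hilbertFunction_span_signedMinor
    {N : Matrix (Fin m) (Fin (m + 1)) (MvPolynomial (Fin 3) ℂ)}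
    {wt : Fin (m + 1) → ℕ} (h : ∀ i c, (N i c).IsHomogeneous (wt c))
    (hN : ∀ p, Irreducible p → ∃ k, ¬ p ∣ signedMinor N k) (q : ℕ) :
    hilbertFunction (Ideal.span (Set.range (signedMinor N))) (q + ∑ c, wt c)
      + ∑ c, Module.finrank ℂ (homogeneousSubmodule (Fin 3) ℂ (q + wt c))
      = Module.finrank ℂ (homogeneousSubmodule (Fin 3) ℂ (q + ∑ c, wt c))
        + m * Module.finrank ℂ (homogeneousSubmodule (Fin 3) ℂ q) := by
  obtain ⟨k, hk⟩ : ∃ k, signedMinor N k ≠ 0 := by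
    obtain ⟨k, hk⟩ := hN (X 0) X_prime.irreducible
    exact ⟨k, fun h0 => hk (h0 ▸ dvd_zero _)⟩
  let Φ : ((c : Fin (m + 1)) → homogeneousSubmodule (Fin 3) ℂ (q + wt c)) →ₗ[ℂ]
      MvPolynomial (Fin 3) ℂ :=
    ∑ c, (LinearMap.mulRight ℂ (signedMinor N c)).comp
      ((homogeneousSubmodule (Fin 3) ℂ (q + wt c)).subtype.comp (LinearMap.proj c))
  have hΦ : ∀ v, Φ v = ∑ c, (v c : MvPolynomial (Fin 3) ℂ) * signedMinor N c := fun v => by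
    simp only [Φ, LinearMap.sum_apply]; rfl
  let Ψ : (Fin m → homogeneousSubmodule (Fin 3) ℂ q) →ₗ[ℂ]
      ((c : Fin (m + 1)) → homogeneousSubmodule (Fin 3) ℂ (q + wt c)) :=
    { toFun := fun w c => ⟨∑ i, (w i : MvPolynomial (Fin 3) ℂ) * N i c,
        Submodule.sum_mem _ fun i _ => (w i).2.mul (h i c)⟩
      map_add' := fun w w' => funext fun c => Subtype.ext (by
        simp [add_mul, Finset.sum_add_distrib])
      map_smul' := fun a w => funext fun c => Subtype.ext (by
        simp [Finset.smul_sum]) }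
  have hΨ : ∀ w c, (Ψ w c : MvPolynomial (Fin 3) ℂ)
      = ∑ i, (w i : MvPolynomial (Fin 3) ℂ) * N i c := fun _ _ => rfl
  have hinj : Function.Injective Ψ := by
    rw [← LinearMap.ker_eq_bot, LinearMap.ker_eq_bot']
    intro w hw
    have := eq_zero_of_vecMul_eq_zero hk (w := fun i => (w i : MvPolynomial (Fin 3) ℂ)) fun c => by
      rw [← hΨ, hw]; rfl
    exact funext fun i => Subtype.ext (congrFun this i)
  have hker : LinearMap.ker Φ = LinearMap.range Ψ := by
    apply le_antisymm
    · intro v hv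
      rw [LinearMap.mem_ker, hΦ] at hv
      obtain ⟨w, hw⟩ := exists_eq_sum_mul_of_sum_mul_signedMinor hN hk hv
      refine ⟨fun i => ⟨homogeneousComponent q (w i), homogeneousComponent_isHomogeneous _ _⟩,
        funext fun c => Subtype.ext ?_⟩
      rw [hΨ, ← homogeneousComponent_of_mem (v c).2 |>.trans (if_pos rfl), hw c, map_sum]
      refine Finset.sum_congr rfl fun i _ => ?_
      rw [add_comm q, mul_comm (w i), homogeneousComponent_mul_of_isHomogeneous (h i c), mul_comm]
    · rintro _ ⟨w, rfl⟩
      rw [LinearMap.mem_ker, hΦ]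
      simp only [hΨ, Finset.sum_mul]
      rw [Finset.sum_comm]
      refine Finset.sum_eq_zero fun i _ => ?_
      simp only [mul_assoc, ← Finset.mul_sum, sum_row_mul_signedMinor, mul_zero]
  have hrange : LinearMap.range Φ = homogeneousSubmodule (Fin 3) ℂ (q + ∑ c, wt c) ⊓ LinearMap.ker
      (Ideal.Quotient.mkₐ ℂ (Ideal.span (Set.range (signedMinor N)))).toLinearMap := by
    have hmem : ∀ x, x ∈ LinearMap.ker
        (Ideal.Quotient.mkₐ ℂ (Ideal.span (Set.range (signedMinor N)))).toLinearMap
          ↔ x ∈ Ideal.span (Set.range (signedMinor N)) := fun x => Ideal.Quotient.eq_zero_iff_mem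
    ext x
    rw [Submodule.mem_inf, hmem]
    constructor
    · rintro ⟨v, rfl⟩
      rw [hΦ]
      exact ⟨Submodule.sum_mem _ fun c _ => isHomogeneous_mul_signedMinor h c (v c).2,
        Submodule.sum_mem _ fun c _ => Ideal.mul_mem_left _ _ (Ideal.subset_span ⟨c, rfl⟩)⟩
    · rintro ⟨hx, hxI⟩
      obtain ⟨v, hv, rfl⟩ := homogeneousSubmodule_inf_span_signedMinor h q hx hxI
      exact ⟨fun c => ⟨v c, hv c⟩, hΦ _⟩
  have h1 := finrank_map_add_finrank_inf_ker
    (Ideal.Quotient.mkₐ ℂ (Ideal.span (Set.range (signedMinor N)))).toLinearMap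
    (homogeneousSubmodule (Fin 3) ℂ (q + ∑ c, wt c))
  have h2 := LinearMap.finrank_range_add_finrank_ker Φ
  have h3 := LinearMap.finrank_range_of_inj hinj
  rw [← hrange] at h1
  have h4 : Module.finrank ℂ (Fin m → homogeneousSubmodule (Fin 3) ℂ q)
      = m * Module.finrank ℂ (homogeneousSubmodule (Fin 3) ℂ q) := by
    rw [Module.finrank_pi_fintype, Finset.sum_const, Finset.card_univ, Fintype.card_fin,
      smul_eq_mul]
  rw [hker, h3, h4, Module.finrank_pi_fintype] at h2
  change Module.finrank ℂ ((homogeneousSubmodule (Fin 3) ℂ (q + ∑ c, wt c)).map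
    (Ideal.Quotient.mkₐ ℂ (Ideal.span (Set.range (signedMinor N)))).toLinearMap) + _ = _
  omega

end GradedHilbertBurch

/-! ### The specializations of the matrix `M_2` -/

section Quadrics

/-- The exponent of the monomial `s ^ (n - i) t ^ i`. -/
def expo (n i : ℕ) : Fin 2 →₀ ℕ := Finsupp.single 0 (n - i) + Finsupp.single 1 i

@[simp]
theorem expo_zero (n i : ℕ) : expo n i 0 = n - i := by simp [expo]

@[simp]
theorem expo_one (n i : ℕ) : expo n i 1 = i := by simp [expo]

theorem expo_injective (n : ℕ) : Function.Injective (expo n) := fun i j h => by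
  simpa using DFunLike.congr_fun h 1

theorem expo_add_expo {n m i j : ℕ} (hi : i ≤ n) (hj : j ≤ m) :
    expo n i + expo m j = expo (n + m) (i + j) := by
  ext k
  fin_cases k
  · simp only [Fin.zero_eta, Finsupp.add_apply, expo_zero]; omega
  · simp

theorem eval_monomial_expo (n i : ℕ) (c : ℂ) (v : Fin 2 → ℂ) :
    eval v (monomial (expo n i) c) = c * (v 0 ^ (n - i) * v 1 ^ i) := by
  rw [eval_monomial, Finsupp.prod_fintype _ _ (by simp), Fin.prod_univ_two, expo_zero, expo_one]

theorem monomial_expo_isHomogeneous {n i : ℕ} (hi : i ≤ n) (c : ℂ) :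
    (monomial (expo n i) c).IsHomogeneous n := by
  refine isHomogeneous_monomial c ?_
  rw [Finsupp.degree_eq_sum, Fin.sum_univ_two, expo_zero, expo_one]
  omega

theorem eq_sum_monomial_of_isHomogeneous {n : ℕ} {F : MvPolynomial (Fin 2) ℂ}
    (hF : F.IsHomogeneous n) :
    F = ∑ i : Fin (n + 1), monomial (expo n i) (coeff (expo n i) F) := by
  ext e
  rw [coeff_sum]
  by_cases he : e 0 + e 1 = n
  · have h1 : e = expo n (e 1) := by
      ext k
      fin_cases k
      · simp only [Fin.zero_eta, expo_zero]; omega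
      · simp
    rw [Finset.sum_eq_single (⟨e 1, by omega⟩ : Fin (n + 1))]
    · rw [← h1, coeff_monomial, if_pos rfl]
    · intro i _ hi
      rw [coeff_monomial, if_neg]
      intro h2
      exact hi (Fin.ext (by simp [← h2]))
    · intro h; exact absurd (Finset.mem_univ _) h
  · rw [hF.coeff_eq_zero (by rwa [Finsupp.degree_eq_sum, Fin.sum_univ_two])]
    symm
    refine Finset.sum_eq_zero fun i _ => ?_
    rw [coeff_monomial, if_neg]
    rintro rfl
    refine he ?_
    rw [expo_zero, expo_one]
    omega

/-- The coefficient vector of a binary form of degree `n`. -/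
def coeffVec (n : ℕ) : MvPolynomial (Fin 2) ℂ →ₗ[ℂ] (Fin (n + 1) → ℂ) :=
  LinearMap.pi fun i => lcoeff ℂ (expo n i)

theorem coeffVec_apply (n : ℕ) (F : MvPolynomial (Fin 2) ℂ) (i : Fin (n + 1)) :
    coeffVec n F i = coeff (expo n i) F := rfl

theorem exists_form_coeffVec_eq {n : ℕ} (y : Fin (n + 1) → ℂ) :
    ∃ F : MvPolynomial (Fin 2) ℂ, F.IsHomogeneous n ∧ coeffVec n F = y := by
  refine ⟨∑ i : Fin (n + 1), monomial (expo n i) (y i), IsHomogeneous.sum _ _ _ fun i _ =>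
    monomial_expo_isHomogeneous (by omega) _, ?_⟩
  funext i
  rw [coeffVec_apply, coeff_sum, Finset.sum_eq_single i]
  · rw [coeff_monomial, if_pos rfl]
  · intro j _ hj
    rw [coeff_monomial, if_neg]
    exact fun h => hj (Fin.ext (expo_injective n h))
  · intro h; exact absurd (Finset.mem_univ _) h

theorem eval_eq_sum_coeffVec {n : ℕ} {F : MvPolynomial (Fin 2) ℂ} (hF : F.IsHomogeneous n)
    (v : Fin 2 → ℂ) :
    eval v F = ∑ i : Fin (n + 1), coeffVec n F i * (v 0 ^ (n - (i : ℕ)) * v 1 ^ (i : ℕ)) := by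
  conv_lhs => rw [eq_sum_monomial_of_isHomogeneous hF]
  rw [map_sum]
  exact Finset.sum_congr rfl fun i _ => eval_monomial_expo _ _ _ _

/-- The binary quadric with coefficients `u`. -/
def quadric (u : Fin 3 → ℂ) : MvPolynomial (Fin 2) ℂ := ∑ l : Fin 3, monomial (expo 2 l) (u l)

theorem quadric_isHomogeneous (u : Fin 3 → ℂ) : (quadric u).IsHomogeneous 2 :=
  IsHomogeneous.sum _ _ _ fun l _ => monomial_expo_isHomogeneous (by omega) _

theorem coeffVec_quadric (u : Fin 3 → ℂ) : coeffVec 2 (quadric u) = u := by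
  funext i
  rw [coeffVec_apply, quadric, coeff_sum, Finset.sum_eq_single i]
  · rw [coeff_monomial, if_pos rfl]
  · intro j _ hj
    rw [coeff_monomial, if_neg]
    exact fun h => hj (Fin.ext (expo_injective 2 h))
  · intro h; exact absurd (Finset.mem_univ _) h

theorem quadric_eq (u : Fin 3 → ℂ) :
    quadric u = C (u 0) * X 0 ^ 2 + C (u 1) * (X 0 * X 1) + C (u 2) * X 1 ^ 2 := by
  have h : ∀ (n i : ℕ) (c : ℂ), monomial (expo n i) c = C c * (X 0 ^ (n - i) * X 1 ^ i) := by
    intro n i c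
    rw [monomial_eq, Finsupp.prod_fintype _ _ (by simp), Fin.prod_univ_two, expo_zero, expo_one]
  rw [quadric, Fin.sum_univ_three, h, h, h]
  simp

/-- The coefficients of the product of the linear forms `lin v` and `lin w`. -/
def rootCoeff (v w : Fin 2 → ℂ) : Fin 3 → ℂ :=
  ![v 1 * w 1, -(v 1 * w 0 + v 0 * w 1), v 0 * w 0]

theorem quadric_rootCoeff (v w : Fin 2 → ℂ) : quadric (rootCoeff v w) = lin v * lin w := by
  rw [quadric_eq]
  simp only [rootCoeff, lin, Matrix.cons_val_zero, Matrix.cons_val_one, Matrix.cons_val, C_neg,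
    C_add, C_mul]
  ring

theorem discrim_rootCoeff (v w : Fin 2 → ℂ) :
    rootCoeff v w 1 ^ 2 - 4 * rootCoeff v w 0 * rootCoeff v w 2 = eval w (lin v) ^ 2 := by
  simp only [rootCoeff, eval_lin, Matrix.cons_val_zero, Matrix.cons_val_one, Matrix.cons_val]
  ring

theorem exists_eq_rootCoeff {u : Fin 3 → ℂ} (hu : u ≠ 0) :
    ∃ v w, v ≠ 0 ∧ w ≠ 0 ∧ u = rootCoeff v w := by
  obtain ⟨v, hv, h0⟩ := exists_eval_eq_zero (quadric_isHomogeneous u) two_ne_zero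
  obtain ⟨L, hL, hq⟩ := exists_eq_lin_mul (quadric_isHomogeneous u) hv h0
  obtain ⟨w, rfl⟩ : ∃ w, L = lin w := by
    refine ⟨![- coeffVec 1 L 1, coeffVec 1 L 0], ?_⟩
    conv_lhs => rw [eq_sum_monomial_of_isHomogeneous hL]
    rw [Fin.sum_univ_two, monomial_eq, monomial_eq, Finsupp.prod_fintype _ _ (by simp),
      Finsupp.prod_fintype _ _ (by simp)]
    simp [lin, coeffVec_apply]
  have hur : u = rootCoeff v w := by
    rw [← coeffVec_quadric u, hq, ← quadric_rootCoeff, coeffVec_quadric]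
  refine ⟨v, w, hv, ?_, hur⟩
  rintro rfl
  refine hu (hur.trans (funext fun i => ?_))
  fin_cases i <;> simp [rootCoeff]

variable {d : ℕ}

theorem Param.eval_M_inl (φ : Param d) (hd : 2 ≤ d) (u : Fin 3 → ℂ) (j : Fin (d - 2 + 1)) :
    (fun i => eval u (φ.M 2 i (.inl j)))
      = coeffVec d (monomial (expo (d - 2) j) 1 * quadric u) := by
  funext i
  have hj : (j : ℕ) ≤ d - 2 := by omega
  rw [coeffVec_apply, quadric, Finset.mul_sum, coeff_sum]
  have hterm : ∀ l : Fin 3,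
      coeff (expo d i) (monomial (expo (d - 2) j) 1 * monomial (expo 2 l) (u l))
      = if (i : ℕ) = j + l then u l else 0 := by
    intro l
    rw [monomial_mul, one_mul, expo_add_expo hj (by omega), Nat.sub_add_cancel hd, coeff_monomial]
    refine if_congr ⟨fun h => (expo_injective d h).symm, fun h => by rw [h]⟩ rfl rfl
  simp only [hterm, Param.M]
  split_ifs with h
  · rw [eval_X, Finset.sum_eq_single (⟨i - j, h.2⟩ : Fin 3)]
    · rw [if_pos]; simp only; omega
    · intro l _ hl
      rw [if_neg]
      intro h1
      exact hl (Fin.ext (by simp only; omega))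
    · intro h; exact absurd (Finset.mem_univ _) h
  · rw [map_zero]
    symm
    refine Finset.sum_eq_zero fun l _ => if_neg fun h1 => h ?_
    omega

theorem Param.eval_M_inr (φ : Param d) (u : Fin 3 → ℂ) (j : Fin 3) :
    (fun i => eval u (φ.M 2 i (.inr j))) = coeffVec d (φ.f j) := by
  funext i
  simp only [Param.M, eval_C]
  rfl

theorem det_submatrix_eq_mul {m n A : Type*} [CommRing A] [Fintype m] [DecidableEq m]
    (M : Matrix m n A) (a : m → m) (b : m → n) : (M.submatrix a b).det
      = ((1 : Matrix m m A).submatrix a id).det * (M.submatrix id b).det := by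
  rw [← Matrix.det_mul, ← Matrix.submatrix_mul _ _ _ _ _ Function.bijective_id, Matrix.one_mul]

theorem minorsIdeal_le_iff {m : ℕ} {n A : Type*} [CommRing A] {r : ℕ} (hr : r = m)
    (M : Matrix (Fin m) n A) (J : Ideal A) :
    minorsIdeal r M ≤ J ↔ ∀ b : Fin m → n, (M.submatrix id b).det ∈ J := by
  subst hr
  rw [minorsIdeal, Ideal.span_le]
  constructor
  · exact fun h b => h ⟨id, b, rfl⟩
  · rintro h _ ⟨a, b, rfl⟩
    rw [det_submatrix_eq_mul]
    exact Ideal.mul_mem_left _ _ (h b)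

theorem Param.idealX_le_iff (φ : Param d) (hd : 2 ≤ d) (J : Ideal (MvPolynomial (Fin 3) ℂ)) :
    φ.idealX 2 ≤ J ↔ ∀ b, ((φ.M 2).submatrix id b).det ∈ J :=
  minorsIdeal_le_iff (by omega) _ _

/-- All maximal minors vanish where the rows of the matrix are linearly dependent. -/
theorem Param.eval_eq_zero_of_relation (φ : Param d) (hd : 2 ≤ d) {u : Fin 3 → ℂ}
    {x : Fin (d + 1) → ℂ} (hx : x ≠ 0) (h : ∀ c, ∑ i, x i * eval u (φ.M 2 i c) = 0)
    {g : MvPolynomial (Fin 3) ℂ} (hg : g ∈ φ.idealX 2) : eval u g = 0 := by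
  have : φ.idealX 2 ≤ RingHom.ker (eval u) := by
    rw [φ.idealX_le_iff hd]
    intro b
    rw [RingHom.mem_ker, RingHom.map_det, ← Matrix.exists_vecMul_eq_zero_iff]
    exact ⟨x, hx, funext fun j => h (b j)⟩
  exact this hg

/-- Not all maximal minors vanish at `u` if the forms of degree `d` are the combinations of `P_u`
and `f₀, f₁, f₂`. -/
theorem Param.exists_eval_ne_zero_of_forall_eq (φ : Param d) (hd : 2 ≤ d) {u : Fin 3 → ℂ}
    (h : ∀ F : MvPolynomial (Fin 2) ℂ, F.IsHomogeneous d →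
      ∃ (G : MvPolynomial (Fin 2) ℂ) (c : Fin 3 → ℂ), G.IsHomogeneous (d - 2) ∧
        F = G * quadric u + aeval φ.f (lform c)) :
    ∃ g ∈ φ.idealX 2, eval u g ≠ 0 := by
  let col : Fin (d - 2 + 1) ⊕ Fin 3 → Fin (d + 1) → ℂ := fun c i => eval u (φ.M 2 i c)
  have hspan : Submodule.span ℂ (Set.range col) = ⊤ := by
    rw [eq_top_iff]
    intro y _
    obtain ⟨F, hF, rfl⟩ := exists_form_coeffVec_eq y
    obtain ⟨G, c, hG, rfl⟩ := h F hF
    rw [map_add, eq_sum_monomial_of_isHomogeneous hG, Finset.sum_mul, map_sum, φ.aeval_lform,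
      map_sum]
    refine Submodule.add_mem _ (Submodule.sum_mem _ fun j _ => ?_)
      (Submodule.sum_mem _ fun j _ => ?_)
    · have h1 : monomial (expo (d - 2) j) (coeff (expo (d - 2) j) G)
          = coeff (expo (d - 2) j) G • monomial (expo (d - 2) j) (1 : ℂ) := by
        rw [smul_monomial, smul_eq_mul, mul_one]
      rw [h1, smul_mul_assoc, map_smul, ← φ.eval_M_inl hd]
      exact Submodule.smul_mem _ _ (Submodule.subset_span ⟨.inl j, rfl⟩)
    · rw [← smul_eq_C_mul, map_smul, ← φ.eval_M_inr u]
      exact Submodule.smul_mem _ _ (Submodule.subset_span ⟨.inr j, rfl⟩)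
  -- a basis of the column space among the columns gives a maximal minor that does not vanish at `u`
  obtain ⟨f, hf, -, hli⟩ := Submodule.exists_fun_fin_finrank_span_eq ℂ (Set.range col)
  have hfin : Module.finrank ℂ (Submodule.span ℂ (Set.range col)) = d + 1 := by
    rw [hspan, finrank_top, Module.finrank_fin_fun]
  choose b hb using hf
  let b' : Fin (d + 1) → Fin (d - 2 + 1) ⊕ Fin 3 := fun i => b (finCongr hfin.symm i)
  by_contra! hg
  have h1 := (φ.idealX_le_iff hd (RingHom.ker (eval u))).mp (fun g hgI => hg g hgI) b'
  rw [RingHom.mem_ker, RingHom.map_det] at h1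
  have h2 : IsUnit ((eval u).mapMatrix ((φ.M 2).submatrix id b')) := by
    rw [← Matrix.linearIndependent_cols_iff_isUnit]
    have h3 : ((eval u).mapMatrix ((φ.M 2).submatrix id b')).col = f ∘ finCongr hfin.symm :=
      funext fun j => hb (finCongr hfin.symm j)
    rw [h3]
    exact hli.comp _ (finCongr hfin.symm).injective
  rw [Matrix.isUnit_iff_isUnit_det, h1] at h2
  exact not_isUnit_zero h2

/-- If some linear form through `φ(v)` pulls back to the linear form of `v` times a form `g` that
does not vanish at `w`, then not all maximal minors vanish at the quadric with roots `v` and `w`. -/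
theorem Param.exists_eval_rootCoeff_ne_zero (φ : Param d) (hd : 2 ≤ d) {v w : Fin 2 → ℂ}
    (hv : v ≠ 0) (hw : w ≠ 0) {c : Fin 3 → ℂ} {g : MvPolynomial (Fin 2) ℂ}
    (hg : g.IsHomogeneous (d - 1)) (hc : aeval φ.f (lform c) = lin v * g) (hgw : eval w g ≠ 0) :
    ∃ g ∈ φ.idealX 2, eval (rootCoeff v w) g ≠ 0 := by
  refine φ.exists_eval_ne_zero_of_forall_eq hd fun F hF => ?_
  obtain ⟨j, hj⟩ : ∃ j, eval v (φ.f j) ≠ 0 := by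
    by_contra! h
    exact φ.no_common_zero v hv (funext h)
  -- subtract a multiple of `f j` to get a zero at `v`, then a multiple of `lin v * g` for `w`
  set α := eval v F / eval v (φ.f j)
  obtain ⟨F', hF', hFF'⟩ := exists_eq_lin_mul (hF.sub ((φ.homogeneous j).C_mul α)) hv (by
    rw [map_sub, map_mul, eval_C, div_mul_cancel₀ _ hj, sub_self])
  set β := eval w F' / eval w g
  obtain ⟨G, hG, hG'⟩ := exists_eq_lin_mul (hF'.sub (hg.C_mul β)) hw (by
    rw [map_sub, map_mul, eval_C, div_mul_cancel₀ _ hgw, sub_self])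
  have hlf : aeval φ.f (lform (Pi.single j α)) = C α * φ.f j := by
    rw [φ.aeval_lform, Finset.sum_eq_single j]
    · rw [Pi.single_eq_same]
    · intro k _ hk
      rw [Pi.single_eq_of_ne hk, C_0, zero_mul]
    · intro h; exact absurd (Finset.mem_univ _) h
  have hadd : aeval φ.f (lform (Pi.single j α + β • c)) = C α * φ.f j + C β * (lin v * g) := by
    rw [← hlf, ← hc, φ.aeval_lform, φ.aeval_lform, φ.aeval_lform, Finset.mul_sum,
      ← Finset.sum_add_distrib]
    refine Finset.sum_congr rfl fun k _ => ?_
    rw [Pi.add_apply, Pi.smul_apply, smul_eq_mul, C_add, C_mul]; ring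
  refine ⟨G, Pi.single j α + β • c, hG, ?_⟩
  rw [hadd, quadric_rootCoeff]
  linear_combination hFF' + lin v * hG'

theorem Param.M_isHomogeneous (φ : Param d) (i : Fin (d + 1)) (c : Fin (d - 2 + 1) ⊕ Fin 3) :
    (φ.M 2 i c).IsHomogeneous (c.elim (fun _ => 1) (fun _ => 0)) := by
  unfold Param.M
  cases c with
  | inl j =>
    dsimp only [Sum.elim_inl]
    split_ifs
    · exact isHomogeneous_X _ _
    · exact isHomogeneous_zero _ _ _
  | inr j => exact isHomogeneous_C _ _

/-- The maximal minors have no common factor: a zero of such a factor on the line of quadrics with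
a good root `v` would be a common zero of the minors. -/
theorem Param.exists_not_dvd_det (φ : Param d) (hd : 2 ≤ d)
    (hφ : φ.IsGenericallyInjective) {p : MvPolynomial (Fin 3) ℂ} (hp : Irreducible p) :
    ∃ b, ¬ p ∣ ((φ.M 2).submatrix id b).det := by
  by_contra! hdvd
  obtain ⟨v, hv, hgood⟩ := φ.exists_isGood (by omega) hφ
  -- `p` does not vanish at any quadric with root `v`
  have hne : ∀ w, w ≠ 0 → eval (rootCoeff v w) p ≠ 0 := by
    intro w hw h0
    obtain ⟨c, g, hg, hc, hgw⟩ := hgood w hw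
    obtain ⟨x, hx, hx0⟩ := φ.exists_eval_rootCoeff_ne_zero hd hv hw hg hc hgw
    have hle := (φ.idealX_le_iff hd (Ideal.span {p})).mpr fun b =>
      Ideal.mem_span_singleton.mpr (hdvd b)
    obtain ⟨y, rfl⟩ := Ideal.mem_span_singleton.mp (hle hx)
    exact hx0 (by rw [map_mul, h0, zero_mul])
  have hpd : ∃ k, p.IsHomogeneous k := by
    obtain ⟨c, g, hg, hc, hgw⟩ := hgood v hv
    obtain ⟨x, hx, hx0⟩ := φ.exists_eval_rootCoeff_ne_zero hd hv hv hg hc hgw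
    obtain ⟨b, hb⟩ : ∃ b, ((φ.M 2).submatrix id b).det ≠ 0 := by
      by_contra! h
      have hle := (φ.idealX_le_iff hd ⊥).mpr h
      exact hx0 (by rw [hle hx, map_zero])
    obtain ⟨y, hy⟩ := hdvd b
    have hhom : ((φ.M 2).submatrix id b).det.IsHomogeneous
        (∑ j, (b j).elim (fun _ => 1) (fun _ => 0)) := by
      refine det_isHomogeneous fun i j => ?_
      rw [Matrix.submatrix_apply]
      exact φ.M_isHomogeneous _ _
    rw [hy] at hhom hb
    exact exists_isHomogeneous_of_mul hhom hb
  obtain ⟨k, hk⟩ := hpd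
  have hk0 : k ≠ 0 := by
    rintro rfl
    obtain ⟨a, rfl⟩ := eq_C_of_isHomogeneous_zero hk
    by_cases ha : a = 0
    · exact hp.ne_zero (by rw [ha, C_0])
    · exact hp.not_isUnit ((Ne.isUnit ha).map C)
  -- restrict `p` to the line of quadrics with root `v`
  have hhom := hk.aeval (n := 1)
    (![C (v 1) * X 1, -(C (v 1) * X 0 + C (v 0) * X 1), C (v 0) * X 0] :
      Fin 3 → MvPolynomial (Fin 2) ℂ) (fun i => by
    fin_cases i
    · exact isHomogeneous_C_mul_X _ _
    · exact ((isHomogeneous_C_mul_X _ _).add (isHomogeneous_C_mul_X _ _)).neg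
    · exact isHomogeneous_C_mul_X _ _)
  obtain ⟨w, hw, h0⟩ := exists_eval_eq_zero hhom (by omega)
  refine hne w hw ?_
  rw [← h0]
  refine congrArg (fun ψ : MvPolynomial (Fin 3) ℂ →+* ℂ => ψ p) (a₁ := eval (rootCoeff v w))
    (a₂ := (eval w).comp (aeval _).toRingHom) (ringHom_ext (fun r => ?_) fun i => ?_)
  · simp
  · fin_cases i <;> simp [rootCoeff]

end Quadrics

/-! ### The degree and the support of `X_2` -/

section DegreeAndSupport

variable {d : ℕ}

/-- The numbering of the columns of `M_2`. -/
def colEquiv (hd : 2 ≤ d) : Fin (d + 1 + 1) ≃ Fin (d - 2 + 1) ⊕ Fin 3 :=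
  (finCongr (by omega)).trans finSumFinEquiv.symm

/-- The ideal of `X_2` is generated by the `d + 2` minors obtained by deleting one column; the other
determinants in its definition repeat rows or columns, or permute them. -/
theorem Param.idealX_eq_span_signedMinor (φ : Param d) (hd : 2 ≤ d) :
    φ.idealX 2 = Ideal.span (Set.range (signedMinor ((φ.M 2).submatrix id (colEquiv hd)))) := by
  apply le_antisymm
  · rw [φ.idealX_le_iff hd]
    intro b
    obtain ⟨c, hc⟩ : ∃ c, ∀ j, (colEquiv hd).symm (b j) ≠ c := by
      by_contra! h
      have := Fintype.card_le_of_surjective _ h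
      simp at this
    choose b' hb' using fun j => Fin.exists_succAbove_eq (hc j)
    have h1 : (φ.M 2).submatrix id b
        = (((φ.M 2).submatrix id (colEquiv hd)).submatrix id c.succAbove)
          * (1 : Matrix (Fin (d + 1)) (Fin (d + 1)) (MvPolynomial (Fin 3) ℂ)).submatrix id b' := by
      have h2 : b = fun j => colEquiv hd (c.succAbove (b' j)) :=
        funext fun j => by rw [hb', Equiv.apply_symm_apply]
      conv_lhs => rw [h2]
      rw [← Matrix.submatrix_id_id (((φ.M 2).submatrix id (colEquiv hd)).submatrix id c.succAbove),
        ← Matrix.submatrix_mul _ _ _ _ _ Function.bijective_id, Matrix.mul_one]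
      rfl
    have h2 : (((φ.M 2).submatrix id (colEquiv hd)).submatrix id c.succAbove).det
        = (-1) ^ (c : ℕ) * signedMinor ((φ.M 2).submatrix id (colEquiv hd)) c := by
      rw [signedMinor, ← mul_assoc, ← pow_add, Even.neg_one_pow ⟨_, rfl⟩, one_mul]
    rw [h1, Matrix.det_mul, h2]
    exact Ideal.mul_mem_right _ _ (Ideal.mul_mem_left _ _ (Ideal.subset_span ⟨c, rfl⟩))
  · rw [Ideal.span_le]
    rintro _ ⟨c, rfl⟩
    exact Ideal.mul_mem_left _ _ ((φ.idealX_le_iff hd _).mp le_rfl (colEquiv hd ∘ c.succAbove))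

/-- The Hilbert function of `X_2` is constant from degree `d - 1` on. The columns of `P_2` have
weight `1` and the columns of `f₀, f₁, f₂` have weight `0` in the Hilbert–Burch resolution. -/
theorem Param.two_mul_hilbertFunction_idealX (φ : Param d) (hd : 3 ≤ d)
    (hφ : φ.IsGenericallyInjective) {n : ℕ} (hn : d - 1 ≤ n) :
    2 * hilbertFunction (φ.idealX 2) n = (d - 1) * (d - 2) := by
  have hd2 : 2 ≤ d := by omega
  have hN : ∀ p, Irreducible p →
      ∃ k, ¬ p ∣ signedMinor ((φ.M 2).submatrix id (colEquiv hd2)) k := by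
    intro p hp
    by_contra! h
    obtain ⟨b, hb⟩ := φ.exists_not_dvd_det hd2 hφ hp
    refine hb (Ideal.mem_span_singleton.mp ((φ.idealX_le_iff hd2 _).mp ?_ b))
    rw [φ.idealX_eq_span_signedMinor hd2, Ideal.span_le]
    rintro _ ⟨k, rfl⟩
    exact Ideal.mem_span_singleton.mpr (h k)
  have key := hilbertFunction_span_signedMinor (N := (φ.M 2).submatrix id (colEquiv hd2))
    (wt := fun c => (colEquiv hd2 c).elim (fun _ => 1) (fun _ => 0))
    (fun i c => φ.M_isHomogeneous i (colEquiv hd2 c)) hN (n - (d - 1))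
  have hsum : ∀ g : Fin (d - 2 + 1) ⊕ Fin 3 → ℕ, ∑ c, g (colEquiv hd2 c)
      = ∑ j, g (.inl j) + ∑ j, g (.inr j) := fun g => by
    rw [Equiv.sum_comp (colEquiv hd2) g, Fintype.sum_sum_type]
  have hwt : ∑ c, (colEquiv hd2 c).elim (fun _ => 1) (fun _ => 0) = d - 1 := by
    rw [hsum fun c => c.elim (fun _ => 1) (fun _ => 0)]
    simp only [Sum.elim_inl, Sum.elim_inr, Finset.sum_const, Finset.card_univ, Fintype.card_fin,
      smul_eq_mul]
    omega
  have hrank : ∀ q, ∑ c, Module.finrank ℂ (homogeneousSubmodule (Fin 3) ℂ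
      (q + (colEquiv hd2 c).elim (fun _ => 1) (fun _ => 0)))
      = (d - 2 + 1) * Module.finrank ℂ (homogeneousSubmodule (Fin 3) ℂ (q + 1))
        + 3 * Module.finrank ℂ (homogeneousSubmodule (Fin 3) ℂ q) := by
    intro q
    refine (hsum fun c => Module.finrank ℂ (homogeneousSubmodule (Fin 3) ℂ
      (q + c.elim (fun _ => 1) (fun _ => 0)))).trans ?_
    change ∑ _j : Fin (d - 2 + 1), Module.finrank ℂ (homogeneousSubmodule (Fin 3) ℂ (q + 1))
      + ∑ _j : Fin 3, Module.finrank ℂ (homogeneousSubmodule (Fin 3) ℂ q) = _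
    simp only [Finset.sum_const, Finset.card_univ, Fintype.card_fin, smul_eq_mul]
  rw [hwt, ← φ.idealX_eq_span_signedMinor hd2, Nat.sub_add_cancel hn, hrank] at key
  clear hrank hwt hsum hN
  obtain ⟨q, rfl⟩ := Nat.exists_eq_add_of_le hn
  obtain ⟨e, rfl⟩ := Nat.exists_eq_add_of_le hd2
  have e1 : 2 + e - 1 + q - (2 + e - 1) = q := by omega
  rw [e1] at key
  have h0 := two_mul_finrank_homogeneousSubmodule_three q
  have h1 := two_mul_finrank_homogeneousSubmodule_three (q + 1)
  have h2 := two_mul_finrank_homogeneousSubmodule_three (2 + e - 1 + q)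
  have e2 : 2 + e - 1 = e + 1 := by omega
  have e3 : 2 + e - 2 = e := by omega
  rw [e2] at key h2 ⊢
  rw [e3] at key ⊢
  generalize Module.finrank ℂ (homogeneousSubmodule (Fin 3) ℂ q) = a0 at *
  generalize Module.finrank ℂ (homogeneousSubmodule (Fin 3) ℂ (q + 1)) = a1 at *
  generalize Module.finrank ℂ (homogeneousSubmodule (Fin 3) ℂ (e + 1 + q)) = a2 at *
  generalize hilbertFunction ((φ.idealX 2)) (e + 1 + q) = x at *
  zify at *
  linear_combination 2 * key - (e + 1) * h1 + e * h0 + h2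

attribute [local instance] MvPolynomial.gradedAlgebra

/-- The support of a homogeneous ideal `I` is contained in the hypersurface `G = 0` if and only if
`G` vanishes at all zeros of `I` in affine space. -/
theorem projSupport_subset_iff {I : Ideal (MvPolynomial (Fin 3) ℂ)}
    (hI : I.IsHomogeneous (homogeneousSubmodule (Fin 3) ℂ)) {n : ℕ} {G : MvPolynomial (Fin 3) ℂ}
    (hG : G.IsHomogeneous n) (hn : n ≠ 0) :
    projSupport (k := 2) I ⊆ projSupport (k := 2) (Ideal.span {G}) ↔
      ∀ u : Fin 3 → ℂ, (∀ g ∈ I, eval u g = 0) → eval u G = 0 := by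
  constructor
  · intro h u hu
    by_contra hGu
    -- the homogeneous prime ideal of the point `u`
    have hprime : (RingHom.ker (eval u : MvPolynomial (Fin 3) ℂ →+* ℂ)).IsPrime :=
      RingHom.ker_isPrime _
    obtain ⟨i, hi⟩ : ∃ i, u i ≠ 0 := by
      by_contra! h0
      have : u = (0 : ℂ) • u := by rw [zero_smul]; exact funext h0
      refine hGu ?_
      rw [this, eval_smul_of_isHomogeneous hG, zero_pow hn, zero_mul]
    let x : ProjectiveSpectrum (homogeneousSubmodule (Fin 3) ℂ) :=
      ⟨(RingHom.ker (eval u : MvPolynomial (Fin 3) ℂ →+* ℂ)).homogeneousCore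
        (homogeneousSubmodule (Fin 3) ℂ), hprime.homogeneousCore, fun hle => by
          have h1 : (X i : MvPolynomial (Fin 3) ℂ)
              ∈ HomogeneousIdeal.irrelevant (homogeneousSubmodule (Fin 3) ℂ) := by
            exact HomogeneousIdeal.mem_irrelevant_of_mem _ one_pos (isHomogeneous_X ℂ i)
          have h2 := Ideal.toIdeal_homogeneousCore_le _ _ (hle h1)
          rw [RingHom.mem_ker, eval_X] at h2
          exact hi h2⟩
    have hx : x ∈ projSupport (k := 2) I := by
      intro g hg
      have hle := Ideal.homogeneousCore_mono (homogeneousSubmodule (Fin 3) ℂ)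
        (show I ≤ RingHom.ker (eval u : MvPolynomial (Fin 3) ℂ →+* ℂ) from hu)
      refine hle ?_
      change g ∈ (I.homogeneousCore (homogeneousSubmodule (Fin 3) ℂ)).toIdeal
      rw [hI.toIdeal_homogeneousCore_eq_self]
      exact hg
    have h3 : G ∈ x.asHomogeneousIdeal.toIdeal := h hx (Ideal.mem_span_singleton_self G)
    exact hGu (Ideal.toIdeal_homogeneousCore_le _ _ h3)
  · intro h x hx
    have hrad : G ∈ I.radical := by
      rw [← vanishingIdeal_zeroLocus_eq_radical (K := ℂ), mem_vanishingIdeal_iff]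
      intro u hu
      rw [aeval_eq_eval]
      exact h u fun g hg => by
        have := hu g hg
        rwa [aeval_eq_eval] at this
    obtain ⟨k, hk⟩ := hrad
    have h1 : G ∈ x.asHomogeneousIdeal.toIdeal := x.isPrime.mem_of_pow_mem k (hx hk)
    intro g hg
    exact (Ideal.span_singleton_le_iff_mem _).mpr h1 hg

/-- If `v` and `w` are different points with the same image, the maximal minors vanish at the
quadric with roots `v` and `w`: evaluation at the two points gives a relation between the rows. -/
theorem Param.eval_rootCoeff_eq_zero (φ : Param d) (hd : 2 ≤ d) {v w : Fin 2 → ℂ} (hv : v ≠ 0)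
    (hw : w ≠ 0) (hvw : eval w (lin v) ≠ 0)
    (h : φ.map (Projectivization.mk ℂ v hv) = φ.map (Projectivization.mk ℂ w hw))
    {g : MvPolynomial (Fin 3) ℂ} (hg : g ∈ φ.idealX 2) : eval (rootCoeff v w) g = 0 := by
  rw [← φ.mk_pt hv, ← φ.mk_pt hw] at h
  obtain ⟨a, -, ha⟩ := exists_smul_of_mk_eq_mk h
  let x : Fin (d + 1) → ℂ := fun i =>
    v 0 ^ (d - (i : ℕ)) * v 1 ^ (i : ℕ) - a * (w 0 ^ (d - (i : ℕ)) * w 1 ^ (i : ℕ))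
  have hx : ∀ F : MvPolynomial (Fin 2) ℂ, F.IsHomogeneous d →
      ∑ i, x i * coeffVec d F i = eval v F - a * eval w F := by
    intro F hF
    rw [eval_eq_sum_coeffVec hF v, eval_eq_sum_coeffVec hF w, Finset.mul_sum,
      ← Finset.sum_sub_distrib]
    exact Finset.sum_congr rfl fun i _ => by simp only [x]; ring
  have hx0 : x ≠ 0 := by
    intro h0
    obtain ⟨G, hG, hG1⟩ := exists_form_eval_eq_one hv (d - 1)
    have hF : (lin w * G).IsHomogeneous d := by
      have := (lin_isHomogeneous w).mul hG
      rwa [Nat.add_sub_cancel' (by omega : 1 ≤ d)] at this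
    have h1 := hx _ hF
    rw [h0, map_mul (eval v), map_mul (eval w), eval_lin_self, hG1, eval_lin] at h1
    simp only [Pi.zero_apply, zero_mul, Finset.sum_const_zero, mul_zero, sub_zero, mul_one] at h1
    rw [eval_lin] at hvw
    exact hvw (by linear_combination h1)
  refine φ.eval_eq_zero_of_relation hd hx0 (fun c => ?_) hg
  cases c with
  | inl j =>
    have h1 : (monomial (expo (d - 2) j) (1 : ℂ) * quadric (rootCoeff v w)).IsHomogeneous d := by
      have := (monomial_expo_isHomogeneous (n := d - 2) (i := j) (by omega) 1).mul
        (quadric_isHomogeneous (rootCoeff v w))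
      rwa [Nat.sub_add_cancel hd] at this
    have h2 := hx _ h1
    rw [← φ.eval_M_inl hd, quadric_rootCoeff, map_mul, map_mul, map_mul, map_mul, eval_lin_self,
      eval_lin_self] at h2
    refine h2.trans ?_
    ring
  | inr j =>
    have h2 := hx _ (φ.homogeneous j)
    rw [← φ.eval_M_inr (rootCoeff v w)] at h2
    refine h2.trans ?_
    have := congrFun ha j
    simp only [Param.pt, Pi.smul_apply, smul_eq_mul] at this
    rw [this, sub_self]

/-- The map is injective if and only if all common zeros of the maximal minors are squares of linear
forms. -/
theorem Param.injective_iff (φ : Param d) (hd : 2 ≤ d) : Function.Injective φ.map ↔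
    ∀ u : Fin 3 → ℂ, (∀ g ∈ φ.idealX 2, eval u g = 0) → u 1 ^ 2 - 4 * u 0 * u 2 = 0 := by
  constructor
  · intro hinj u hu
    by_cases hu0 : u = 0
    · simp [hu0]
    obtain ⟨v, w, hv, hw, rfl⟩ := exists_eq_rootCoeff hu0
    rw [discrim_rootCoeff]
    by_contra hvw
    have hvw : eval w (lin v) ≠ 0 := fun h => hvw (by rw [h, zero_pow two_ne_zero])
    have hne : φ.map (Projectivization.mk ℂ v hv) ≠ φ.map (Projectivization.mk ℂ w hw) :=
      fun h => hvw ((eval_lin_eq_zero_iff hv hw).mpr (hinj h))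
    -- a line through `φ(v)` that does not contain `φ(w)`
    obtain ⟨i, j, hij⟩ : ∃ i j, φ.pt v i * φ.pt w j ≠ φ.pt v j * φ.pt w i := by
      by_contra! h
      refine hne ?_
      rw [← φ.mk_pt hv, ← φ.mk_pt hw]
      exact mk_eq_mk_of_minors _ _ h
    have hm : (aeval φ.f (minorForm (φ.pt v) i j)).IsHomogeneous d := by
      simpa using φ.aeval_isHomogeneous (minorForm_isHomogeneous (φ.pt v) i j)
    obtain ⟨g, hg, hgeq⟩ := exists_eq_lin_mul hm hv (by
      rw [φ.eval_aeval, eval_minorForm]; ring)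
    have hgw : eval w g ≠ 0 := by
      intro h0
      have := congrArg (eval w) hgeq
      rw [φ.eval_aeval, eval_minorForm, map_mul, h0, mul_zero] at this
      exact hij (by linear_combination this)
    rw [minorForm_eq_lform] at hgeq
    obtain ⟨x, hx, hx0⟩ := φ.exists_eval_rootCoeff_ne_zero hd hv hw hg hgeq hgw
    exact hx0 (hu x hx)
  · intro h Q Q' hQ
    by_contra hne
    have hlin : eval Q'.rep (lin Q.rep) ≠ 0 := fun h0 => hne (by
      rw [← Q.mk_rep, ← Q'.mk_rep]
      exact (eval_lin_eq_zero_iff _ _).mp h0)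
    have h1 := h (rootCoeff Q.rep Q'.rep) fun g hg =>
      φ.eval_rootCoeff_eq_zero hd Q.rep_nonzero Q'.rep_nonzero hlin
        (by rw [Q.mk_rep, Q'.mk_rep, hQ]) hg
    rw [discrim_rootCoeff] at h1
    exact hlin (pow_eq_zero_iff two_ne_zero |>.mp h1)

theorem Param.injective_iff_projSupport_subset (φ : Param d) (hd : 2 ≤ d) :
    Function.Injective φ.map ↔ projSupport (φ.idealX 2) ⊆
      projSupport (Ideal.span {(X 1 ^ 2 - 4 * X 0 * X 2 : MvPolynomial (Fin 3) ℂ)}) := by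
  have hG : (X 1 ^ 2 - 4 * X 0 * X 2 : MvPolynomial (Fin 3) ℂ).IsHomogeneous 2 := by
    have h1 : (X 1 ^ 2 : MvPolynomial (Fin 3) ℂ).IsHomogeneous 2 := isHomogeneous_X_pow 1 2
    have h2 : (C 4 * (X 0 * X 2) : MvPolynomial (Fin 3) ℂ).IsHomogeneous 2 :=
      ((isHomogeneous_X ℂ 0).mul (isHomogeneous_X ℂ 2)).C_mul 4
    have h3 : (C 4 : MvPolynomial (Fin 3) ℂ) = 4 := map_ofNat C 4
    rw [mul_assoc, ← h3]
    exact h1.sub h2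
  rw [φ.injective_iff hd, projSupport_subset_iff (φ.idealX_isHomogeneous 2) hG two_ne_zero]
  refine forall_congr' fun u => imp_congr_right fun _ => ?_
  have h4 : eval u (4 : MvPolynomial (Fin 3) ℂ) = 4 := map_ofNat _ 4
  rw [map_sub, map_pow, map_mul, map_mul, eval_X, eval_X, eval_X, h4]

theorem Param.hasDimensionAndDegree_idealX (φ : Param d) (hd : 3 ≤ d)
    (hφ : φ.IsGenericallyInjective) : HasDimensionAndDegree (φ.idealX 2) 0 φ.delta := by
  have h0 : φ.delta ≠ 0 := by
    have h1 := φ.two_mul_delta hd hφ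
    have h2 : 0 < (d - 1) * (d - 2) := Nat.mul_pos (by omega) (by omega)
    omega
  refine ⟨Polynomial.C (φ.delta : ℚ), ?_, ?_, Polynomial.natDegree_C _, ?_⟩
  · filter_upwards [eventually_ge_atTop (d - 1)] with n hn
    rw [Polynomial.eval_C, Nat.cast_inj]
    have h1 := φ.two_mul_hilbertFunction_idealX hd hφ hn
    have h2 := φ.two_mul_delta hd hφ
    omega
  · rw [Ne, Polynomial.C_eq_zero, Nat.cast_eq_zero]
    exact h0
  · rw [Polynomial.leadingCoeff_C, Nat.factorial_zero, Nat.cast_one, one_mul]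

end DegreeAndSupport

end RationalCurve

end

theorem mainTheorem7 (d : ℕ) (hd : 3 ≤ d) (φ : RationalCurve.Param d)
    (hφ : φ.IsGenericallyInjective) :
    RationalCurve.HasDimensionAndDegree (φ.idealX 2) 0 φ.delta ∧
    φ.delta = (d - 1) * (d - 2) / 2 ∧
    (φ.IsCuspidal ↔
      RationalCurve.projSupport (φ.idealX 2) ⊆
        RationalCurve.projSupport
          (Ideal.span {(X 1 ^ 2 - 4 * X 0 * X 2 : MvPolynomial (Fin 3) ℂ)})) := by
  have h := φ.two_mul_delta hd hφ
  refine ⟨φ.hasDimensionAndDegree_idealX hd hφ, by omega, ?_⟩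
  rw [φ.isCuspidal_iff (by omega) hφ]
  exact φ.injective_iff_projSupport_subset (by omega)
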